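/- **Fell's absorption principle.** Let $A$ be an abelian von Neumann algebra with a faithful normal tracial state $\tau$, let $\Gamma_1,\Gamma_2$ be countable discrete groups, let $\sigma$ be a trace preserving action of $\Gamma=\Gamma_1\times\Gamma_2$ on $(A,\tau)$, and let $M=A\rtimes\Gamma$ be the crossed product von Neumann algebra, with canonical unitaries $u_g$, $g\in\Gamma$. For $i=1,2$ let $\pi_i:\Gamma_i\to\mathcal O(H_i)$ be an orthogonal representation on a real Hilbert space which is weakly contained in the left regular representation of $\Gamma_i$ on $\ell^2(\Gamma_i;\mathbb R)$, i.e. every coefficient $g\mapsto\langle\xi,\pi_i(g)\xi\rangle$ is approximated, on finite subsets of $\Gamma_i$, by finite sums of coefficients $g\mapsto\langle\eta,\lambda_g\eta\rangle$ of the regular representation. Let $(Y_i,\nu_i)$ be the Gaussian construction for $H_i$: a probability space with unitaries $\omega(\xi)\in L^\infty(Y_i,\nu_i)$, $\xi\in H_i$, which generate $L^\infty(Y_i,\nu_i)$ as a von Neumann algebra and satisfy $\omega(0)=1$, $\omega(\xi+\eta)=\omega(\xi)\omega(\eta)$, $\omega(\xi)^*=\omega(-\xi)$ and $\int\omega(\xi)\,d\nu_i=\exp(-\|\xi\|^2)$.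 Let $\Gamma_i$ act on $L^2(Y_i,\nu_i)$ by the Koopman representation $\omega(\xi)\mapsto\omega(\pi_i(g)\xi)$ of the Gaussian action, and on $L^2_0(Y_i)=L^2(Y_i,\nu_i)\ominus\mathbb C1$ by its restriction; denote by $\pi$ the tensor product of the latter two representations, a representation of $\Gamma$ on $L^2_0(Y_1)\bar\otimes L^2_0(Y_2)$. Let $$\mathcal K=L^2(A)\,\bar\otimes\,L^2_0(Y_1)\,\bar\otimes\,L^2_0(Y_2)\,\bar\otimes\,\ell^2(\Gamma)$$ be the $M$-bimodule given by $$(au_g)\cdot(\xi\otimes\xi_1\otimes\xi_2\otimes\delta_k)\cdot(bu_h)=a\,\sigma_g(\xi)\,\sigma_{gk}(b)\otimes\pi_g(\xi_1\otimes\xi_2)\otimes\delta_{gkh}.$$ Let $L^2(\langle M,A\rangle,\mathrm{Tr})$ be the $M$-bimodule of Jones' basic construction $\langle M,A\rangle=(M\cup\{e_A\})''\subset B(L^2(M))$ with its canonical trace, $\mathrm{Tr}(xe_Ay)=\tau(xy)$ for $x,y\in M$. An $M$-bimodule is weakly contained in another if each coefficient $(x,y)\mapsto\langle\xi,x\xi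 y\rangle$ of the first is approximated, on finite subsets of $M\times M$, by finite sums of coefficients of the second. Then: 1. $\mathcal K$ is weakly contained in $L^2(\langle M,A\rangle,\mathrm{Tr})$ (equivalently, in a multiple of it). 2. If, moreover, $\pi_i$ is orthogonally equivalent to the left regular representation of $\Gamma_i$ on $\ell^2(\Gamma_i;\mathbb R)$ for $i=1,2$, then $\mathcal K$ is isomorphic, as an $M$-bimodule, to a multiple of $L^2(\langle M,A\rangle,\mathrm{Tr})$. 3. $\mathcal K$ is weakly contained in the coarse bimodule $L^2(M)\bar\otimes L^2(M)$. -/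

import Mathlib

open scoped ComplexOrder InnerProductSpace TensorProduct ENNReal
open MeasureTheory

set_option linter.unusedSectionVars false

namespace FellAbsorption

/-! ### Hilbert space tools -/

section Tools

/-- The completed Hilbert space tensor product. -/
def HTensor (E F : Type*) [NormedAddCommGroup E] [InnerProductSpace ℂ E]
    [NormedAddCommGroup F] [InnerProductSpace ℂ F] : Type _ :=
  UniformSpace.Completion (E ⊗[ℂ] F)

section HTensor

variable {E E' F F' : Type*} [NormedAddCommGroup E] [InnerProductSpace ℂ E]
  [NormedAddCommGroup F] [InnerProductSpace ℂ F]
  [NormedAddCommGroup E'] [InnerProductSpace ℂ E']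
  [NormedAddCommGroup F'] [InnerProductSpace ℂ F']

noncomputable instance : NormedAddCommGroup (HTensor E F) :=
  inferInstanceAs (NormedAddCommGroup (UniformSpace.Completion (E ⊗[ℂ] F)))

noncomputable instance : InnerProductSpace ℂ (HTensor E F) :=
  inferInstanceAs (InnerProductSpace ℂ (UniformSpace.Completion (E ⊗[ℂ] F)))

instance : CompleteSpace (HTensor E F) :=
  inferInstanceAs (CompleteSpace (UniformSpace.Completion (E ⊗[ℂ] F)))

/-- The inclusion of the algebraic tensor product. -/
noncomputable def hcoe (E F : Type*) [NormedAddCommGroup E] [InnerProductSpace ℂ E]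
    [NormedAddCommGroup F] [InnerProductSpace ℂ F] : E ⊗[ℂ] F →ₗᵢ[ℂ] HTensor E F :=
  UniformSpace.Completion.toComplₗᵢ (𝕜 := ℂ) (E := E ⊗[ℂ] F)

lemma denseRange_hcoe : DenseRange (hcoe E F) :=
  UniformSpace.Completion.denseRange_coe (α := E ⊗[ℂ] F)

/-- The elementary tensor `x ⊗ y` in the completed tensor product. -/
noncomputable def htmul (x : E) (y : F) : HTensor E F := hcoe E F (x ⊗ₜ[ℂ] y)

/-- The bounded operator `S ⊗ T` on the completed tensor product. -/
noncomputable def hmap (S : E →L[ℂ] E') (T : F →L[ℂ] F') : HTensor E F →L[ℂ] HTensor E' F' :=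
  (TensorProduct.mapL S T).completion

lemma hmap_hcoe (S : E →L[ℂ] E') (T : F →L[ℂ] F') (z : E ⊗[ℂ] F) :
    hmap S T (hcoe E F z) = hcoe E' F' (TensorProduct.mapL S T z) :=
  ContinuousLinearMap.completion_apply_coe _ _

@[simp] lemma hmap_htmul (S : E →L[ℂ] E') (T : F →L[ℂ] F') (x : E) (y : F) :
    hmap S T (htmul x y) = htmul (S x) (T y) := by
  simp [htmul, hmap_hcoe]

lemma inner_htmul (x x' : E) (y y' : F) :
    ⟪htmul x y, htmul x' y'⟫_ℂ = ⟪x, x'⟫_ℂ * ⟪y, y'⟫_ℂ := by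
  rw [htmul, htmul, LinearIsometry.inner_map_map, TensorProduct.inner_tmul]

lemma htmul_add (x : E) (y y' : F) : htmul x (y + y') = htmul x y + htmul x y' := by
  simp [htmul, TensorProduct.tmul_add]

lemma add_htmul (x x' : E) (y : F) : htmul (x + x') y = htmul x y + htmul x' y := by
  simp [htmul, TensorProduct.add_tmul]

@[simp] lemma zero_htmul (y : F) : htmul (0 : E) y = 0 := by simp [htmul]

@[simp] lemma htmul_zero (x : E) : htmul x (0 : F) = 0 := by simp [htmul]

lemma smul_htmul (c : ℂ) (x : E) (y : F) : htmul (c • x) y = c • htmul x y := by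
  simp [htmul, ← TensorProduct.smul_tmul']

lemma htmul_smul (c : ℂ) (x : E) (y : F) : htmul x (c • y) = c • htmul x y := by
  simp [htmul]

/-- A closed property that is stable under addition and holds for elementary tensors holds. -/
lemma htensor_induction {p : HTensor E F → Prop} (z : HTensor E F)
    (hc : IsClosed {z | p z}) (h0 : p 0) (ht : ∀ x y, p (htmul x y))
    (ha : ∀ u v, p u → p v → p (u + v)) : p z := by
  refine denseRange_hcoe.induction_on z hc fun a => ?_
  induction a with
  | zero => simpa using h0
  | tmul x y => exact ht x y
  | add u v hu hv => rw [map_add]; exact ha _ _ hu hv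

/-- Two bounded operators agreeing on elementary tensors are equal. -/
lemma htensor_ext {W : Type*} [NormedAddCommGroup W] [NormedSpace ℂ W]
    {S T : HTensor E F →L[ℂ] W} (h : ∀ x y, S (htmul x y) = T (htmul x y)) : S = T := by
  ext z
  refine htensor_induction z (isClosed_eq S.continuous T.continuous) (by simp) h ?_
  intro u v hu hv
  simp [hu, hv]

lemma hmap_comp {E'' F'' : Type*} [NormedAddCommGroup E''] [InnerProductSpace ℂ E'']
    [NormedAddCommGroup F''] [InnerProductSpace ℂ F'']
    (S : E →L[ℂ] E') (T : F →L[ℂ] F') (S' : E' →L[ℂ] E'') (T' : F' →L[ℂ] F'') :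
    (hmap S' T').comp (hmap S T) = hmap (S'.comp S) (T'.comp T) :=
  htensor_ext (by simp)

/-- Two vectors of the completed tensor product with the same inner products against
elementary tensors are equal. -/
lemma htensor_ext_inner {z w : HTensor E F}
    (h : ∀ x y, ⟪htmul x y, z⟫_ℂ = ⟪htmul x y, w⟫_ℂ) : z = w := by
  refine ext_inner_left ℂ fun v => ?_
  refine htensor_induction (p := fun v => ⟪v, z⟫_ℂ = ⟪v, w⟫_ℂ) v
    (isClosed_eq (by fun_prop) (by fun_prop)) (by simp) h ?_
  intro u v hu hv
  simp only [inner_add_left, hu, hv]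

lemma hmap_adjoint [CompleteSpace E] [CompleteSpace E'] [CompleteSpace F] [CompleteSpace F']
    (S : E →L[ℂ] E') (T : F →L[ℂ] F') :
    ContinuousLinearMap.adjoint (hmap S T) =
      hmap (ContinuousLinearMap.adjoint S) (ContinuousLinearMap.adjoint T) := by
  refine htensor_ext fun x y => htensor_ext_inner fun x' y' => ?_
  rw [ContinuousLinearMap.adjoint_inner_right]
  simp [inner_htmul, ContinuousLinearMap.adjoint_inner_right]

/-- The representation `x ↦ x ⊗ 1`. -/
noncomputable def ampLeft (E F : Type*) [NormedAddCommGroup E] [InnerProductSpace ℂ E]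
    [CompleteSpace E] [NormedAddCommGroup F] [InnerProductSpace ℂ F] [CompleteSpace F] :
    (E →L[ℂ] E) →⋆ₐ[ℂ] (HTensor E F →L[ℂ] HTensor E F) where
  toFun S := hmap S (ContinuousLinearMap.id ℂ F)
  map_one' := htensor_ext (by simp)
  map_mul' S S' := htensor_ext (by simp)
  map_zero' := htensor_ext (by simp)
  map_add' S S' := htensor_ext (by simp [add_htmul])
  commutes' c := htensor_ext (by simp [Algebra.algebraMap_eq_smul_one, smul_htmul])
  map_star' S := by
    rw [ContinuousLinearMap.star_eq_adjoint, ContinuousLinearMap.star_eq_adjoint, hmap_adjoint,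
      ContinuousLinearMap.adjoint_id]

/-- The representation `y ↦ 1 ⊗ y`. -/
noncomputable def ampRight (E F : Type*) [NormedAddCommGroup E] [InnerProductSpace ℂ E]
    [CompleteSpace E] [NormedAddCommGroup F] [InnerProductSpace ℂ F] [CompleteSpace F] :
    (F →L[ℂ] F) →⋆ₐ[ℂ] (HTensor E F →L[ℂ] HTensor E F) where
  toFun T := hmap (ContinuousLinearMap.id ℂ E) T
  map_one' := htensor_ext (by simp)
  map_mul' S S' := htensor_ext (by simp)
  map_zero' := htensor_ext (by simp)
  map_add' S S' := htensor_ext (by simp [htmul_add])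
  commutes' c := htensor_ext (by simp [Algebra.algebraMap_eq_smul_one, htmul_smul])
  map_star' S := by
    rw [ContinuousLinearMap.star_eq_adjoint, ContinuousLinearMap.star_eq_adjoint, hmap_adjoint,
      ContinuousLinearMap.adjoint_id]

@[simp] lemma ampLeft_htmul [CompleteSpace E] [CompleteSpace F] (S : E →L[ℂ] E) (x : E) (y : F) :
    ampLeft E F S (htmul x y) = htmul (S x) y := hmap_htmul _ _ _ _

@[simp] lemma ampRight_htmul [CompleteSpace E] [CompleteSpace F] (T : F →L[ℂ] F) (x : E) (y : F) :
    ampRight E F T (htmul x y) = htmul x (T y) := hmap_htmul _ _ _ _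

/-- The isometry `U ⊗ V` of completed tensor products, for isometries `U` and `V`. -/
noncomputable def hisometry (U : E →ₗᵢ[ℂ] E') (V : F →ₗᵢ[ℂ] F') :
    HTensor E F →ₗᵢ[ℂ] HTensor E' F' where
  toLinearMap :=
    (hmap U.toContinuousLinearMap V.toContinuousLinearMap).toLinearMap
  norm_map' z := by
    change ‖hmap U.toContinuousLinearMap V.toContinuousLinearMap z‖ = ‖z‖
    refine denseRange_hcoe.induction_on z (isClosed_eq (by fun_prop) (by fun_prop)) fun a => ?_
    rw [hmap_hcoe, LinearIsometry.norm_map, LinearIsometry.norm_map,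
      TensorProduct.mapL_apply]
    exact (TensorProduct.mapIsometry U V).norm_map a

@[simp] lemma hisometry_htmul (U : E →ₗᵢ[ℂ] E') (V : F →ₗᵢ[ℂ] F') (x : E) (y : F) :
    hisometry U V (htmul x y) = htmul (U x) (V y) :=
  hmap_htmul _ _ _ _

lemma hisometry_comp {E'' F'' : Type*} [NormedAddCommGroup E''] [InnerProductSpace ℂ E'']
    [NormedAddCommGroup F''] [InnerProductSpace ℂ F'']
    (U : E →ₗᵢ[ℂ] E') (V : F →ₗᵢ[ℂ] F') (U' : E' →ₗᵢ[ℂ] E'') (V' : F' →ₗᵢ[ℂ] F'')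
    (z : HTensor E F) :
    hisometry U' V' (hisometry U V z) = hisometry (U'.comp U) (V'.comp V) z :=
  DFunLike.congr_fun (htensor_ext
    (S := (hisometry U' V').toContinuousLinearMap.comp (hisometry U V).toContinuousLinearMap)
    (T := (hisometry (U'.comp U) (V'.comp V)).toContinuousLinearMap) (by simp)) z

lemma hisometry_id (z : HTensor E F) :
    hisometry (LinearIsometry.id : E →ₗᵢ[ℂ] E) (LinearIsometry.id : F →ₗᵢ[ℂ] F) z = z :=
  DFunLike.congr_fun (htensor_ext
    (S := (hisometry (LinearIsometry.id : E →ₗᵢ[ℂ] E)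
      (LinearIsometry.id : F →ₗᵢ[ℂ] F)).toContinuousLinearMap)
    (T := ContinuousLinearMap.id ℂ _) (by simp)) z

/-- The unitary `U ⊗ V`, for unitaries `U` and `V`. -/
noncomputable def hunitary (U : E ≃ₗᵢ[ℂ] E) (V : F ≃ₗᵢ[ℂ] F) :
    HTensor E F ≃ₗᵢ[ℂ] HTensor E F :=
  { hisometry U.toLinearIsometry V.toLinearIsometry with
    invFun := hisometry U.symm.toLinearIsometry V.symm.toLinearIsometry
    left_inv := fun z => by
      refine (hisometry_comp _ _ _ _ z).trans (Eq.trans ?_ (hisometry_id z))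
      congr 2 <;> ext <;> simp
    right_inv := fun z => by
      refine (hisometry_comp _ _ _ _ z).trans (Eq.trans ?_ (hisometry_id z))
      congr 2 <;> ext <;> simp }

@[simp] lemma hunitary_htmul (U : E ≃ₗᵢ[ℂ] E) (V : F ≃ₗᵢ[ℂ] F) (x : E) (y : F) :
    hunitary U V (htmul x y) = htmul (U x) (V y) :=
  hisometry_htmul _ _ _ _

end HTensor

/-! ### The Hilbert spaces `ℓ²(ι; E)` -/

/-- The Hilbert space `ℓ²(ι; E) = E ⊗ ℓ²(ι)` of square summable families;
`lp.single 2 i ξ` is the vector `ξ ⊗ δ_i`. -/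
abbrev L2Sum (ι E : Type*) [NormedAddCommGroup E] : Type _ := lp (fun _ : ι => E) 2

section L2Sum

variable {ι E : Type*} [NormedAddCommGroup E] 

lemma memlp_two_iff (f : ι → E) : Memℓp f 2 ↔ Summable fun i => ‖f i‖ ^ 2 := by
  simpa using memℓp_gen_iff (p := 2) (E := fun _ : ι => E) (f := f) (by simp)

lemma l2sum_norm_sq (f : L2Sum ι E) : ‖f‖ ^ 2 = ∑' i, ‖f i‖ ^ 2 := by
  simpa using lp.norm_rpow_eq_tsum (p := 2) (by simp) f

lemma l2sum_summable (f : L2Sum ι E) : Summable fun i => ‖f i‖ ^ 2 :=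
  (memlp_two_iff _).1 (lp.memℓp f)

/-- Two bounded operators on `ℓ²(ι; E)` agreeing on the vectors `ξ ⊗ δ_i` are equal. -/
lemma l2sum_ext [InnerProductSpace ℂ E] [DecidableEq ι] {W : Type*} [NormedAddCommGroup W]
    [NormedSpace ℂ W] {S T : L2Sum ι E →L[ℂ] W}
    (h : ∀ i ξ, S (lp.single 2 i ξ) = T (lp.single 2 i ξ)) : S = T := by
  ext f
  have h1 := (lp.hasSum_single (p := 2) (E := fun _ : ι => E) (by simp) f)
  have hS := h1.mapL S
  have hT := h1.mapL T
  simp only [h] at hS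
  exact hS.unique hT

/-- The unitary (or antiunitary) `(f i)_i ↦ (T i (f (e i)))_i` of `ℓ²(ι; E)`, for a bijection `e`
and a family of (anti)unitaries `T i`. -/
noncomputable def l2sumCongr {𝕜 : Type*} [NormedField 𝕜] [NormedSpace 𝕜 E]
    {σ₁ σ₂ : 𝕜 →+* 𝕜} [RingHomInvPair σ₁ σ₂] [RingHomInvPair σ₂ σ₁]
    (e : ι ≃ ι) (T : ι → (E ≃ₛₗᵢ[σ₁] E)) : L2Sum ι E ≃ₛₗᵢ[σ₁] L2Sum ι E where
  toFun f := ⟨fun i => T i (f (e i)), (memlp_two_iff _).2 (by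
    simpa [Function.comp_def] using e.summable_iff.2 (l2sum_summable f))⟩
  invFun f := ⟨fun i => (T (e.symm i)).symm (f (e.symm i)), (memlp_two_iff _).2 (by
    simpa [Function.comp_def] using e.symm.summable_iff.2 (l2sum_summable f))⟩
  map_add' f g := by ext i; exact map_add (T i) _ _
  map_smul' c f := by ext i; exact (T i).map_smulₛₗ _ _
  left_inv f := by ext i; simp
  right_inv f := by ext i; simp
  norm_map' f := by
    rw [← sq_eq_sq₀ (norm_nonneg _) (norm_nonneg _), l2sum_norm_sq, l2sum_norm_sq]
    simpa using e.tsum_eq (fun i => ‖f i‖ ^ 2)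

section amp

variable [InnerProductSpace ℂ E]

/-- The operator `(f i)_i ↦ (S (f i))_i`. -/
noncomputable def l2sumMap (ι : Type*) (S : E →L[ℂ] E) : L2Sum ι E →L[ℂ] L2Sum ι E :=
  have hs : ∀ f : L2Sum ι E, ∀ i, ‖S (f i)‖ ^ 2 ≤ ‖S‖ ^ 2 * ‖f i‖ ^ 2 := fun f i => by
    rw [← mul_pow]
    exact pow_le_pow_left₀ (norm_nonneg _) (S.le_opNorm _) 2
  LinearMap.mkContinuous
    { toFun := fun f => ⟨fun i => S (f i), (memlp_two_iff _).2
        (Summable.of_nonneg_of_le (fun _ => by positivity) (hs f)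
          ((l2sum_summable f).mul_left _))⟩
      map_add' := fun f g => by ext i; exact map_add S _ _
      map_smul' := fun c f => by ext i; exact map_smul S _ _ } ‖S‖ fun f => by
    rw [← sq_le_sq₀ (norm_nonneg _) (by positivity), mul_pow, l2sum_norm_sq, l2sum_norm_sq,
      ← tsum_mul_left]
    exact Summable.tsum_le_tsum (hs f) (Summable.of_nonneg_of_le (fun _ => by positivity) (hs f)
          ((l2sum_summable f).mul_left _)) ((l2sum_summable f).mul_left _)

@[simp] lemma l2sumMap_apply (S : E →L[ℂ] E) (f : L2Sum ι E) (i : ι) :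
    l2sumMap ι S f i = S (f i) := rfl

/-- The representation of the bounded operators on `E` by acting on each coordinate
of `ℓ²(ι; E)`. -/
noncomputable def ampSum (ι E : Type*) [NormedAddCommGroup E] [InnerProductSpace ℂ E]
    [CompleteSpace E] : (E →L[ℂ] E) →⋆ₐ[ℂ] (L2Sum ι E →L[ℂ] L2Sum ι E) where
  toFun S := l2sumMap ι S
  map_one' := rfl
  map_mul' _ _ := rfl
  map_zero' := by ext; simp
  map_add' _ _ := by ext; simp
  commutes' c := by ext; simp [Algebra.algebraMap_eq_smul_one]
  map_star' S := by
    rw [ContinuousLinearMap.star_eq_adjoint, ContinuousLinearMap.star_eq_adjoint,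
      ContinuousLinearMap.eq_adjoint_iff]
    intro f g
    simp [lp.inner_eq_tsum, ContinuousLinearMap.adjoint_inner_left]

@[simp] lemma ampSum_apply [CompleteSpace E] (S : E →L[ℂ] E) (f : L2Sum ι E) (i : ι) :
    ampSum ι E S f i = S (f i) := rfl

lemma ampSum_single [CompleteSpace E] [DecidableEq ι] (S : E →L[ℂ] E) (i : ι) (ξ : E) :
    ampSum ι E S (lp.single 2 i ξ) = lp.single 2 i (S ξ) := by
  ext j
  by_cases h : j = i
  · subst h; simp
  · simp [h]

end amp

section tensorSum

variable [InnerProductSpace ℂ E] {P : Type*} [NormedAddCommGroup P] [InnerProductSpace ℂ P]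

/-- The isometry `ξ ↦ ξ ⊗ δ_i`. -/
noncomputable def singleIsometry (E : Type*) [NormedAddCommGroup E] [InnerProductSpace ℂ E]
    [DecidableEq ι] (i : ι) : E →ₗᵢ[ℂ] L2Sum ι E where
  toFun ξ := lp.single 2 i ξ
  map_add' _ _ := lp.single_add 2 i _ _
  map_smul' _ _ := lp.single_smul 2 i _ _
  norm_map' ξ := by
    have h : (0 : ℝ≥0∞) < 2 := by norm_num
    exact lp.norm_single (E := fun _ : ι => E) h i ξ

/-- The isometry `ξ ⊗ η ↦ (ξ ⊗ δ_i) ⊗ η`. -/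
noncomputable def coordIsometry (P : Type*) [NormedAddCommGroup P] [InnerProductSpace ℂ P]
    [DecidableEq ι] (i : ι) : HTensor E P →ₗᵢ[ℂ] HTensor (L2Sum ι E) P :=
  hisometry (singleIsometry E i) LinearIsometry.id

lemma coordIsometry_htmul [DecidableEq ι] (i : ι) (ξ : E) (η : P) :
    coordIsometry P i (htmul ξ η) = htmul (lp.single 2 i ξ : L2Sum ι E) η :=
  hisometry_htmul _ _ _ _

lemma isHilbertSum_coord [DecidableEq ι] : IsHilbertSum ℂ (fun _ : ι => HTensor E P)
    (fun i => coordIsometry (E := E) P i) := by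
  refine IsHilbertSum.mk ?_ ?_
  · intro i j hij z w
    refine htensor_induction (p := fun z => ⟪coordIsometry (E := E) P i z,
      coordIsometry (E := E) P j w⟫_ℂ = 0) z
      (isClosed_eq (by fun_prop) (by fun_prop)) (by simp) ?_ ?_
    · intro x y
      refine htensor_induction (p := fun w => ⟪coordIsometry (E := E) P i (htmul x y),
        coordIsometry (E := E) P j w⟫_ℂ = 0) w
        (isClosed_eq (by fun_prop) (by fun_prop)) (by simp) ?_ ?_
      · intro x' y'
        rw [coordIsometry_htmul, coordIsometry_htmul, inner_htmul, lp.inner_single_left]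
        simp [hij]
      · intro u v hu hv
        simp only [map_add, inner_add_right, hu, hv, add_zero]
    · intro u v hu hv
      simp only [map_add, inner_add_left, hu, hv, add_zero]
  · rintro z -
    set K := (⨆ i : ι, LinearMap.range (coordIsometry (E := E) P i).toLinearMap).topologicalClosure
    change z ∈ K
    have hK : IsClosed (K : Set (HTensor (L2Sum ι E) P)) :=
      Submodule.isClosed_topologicalClosure _
    refine htensor_induction (p := fun z => z ∈ K) z hK K.zero_mem ?_
      (fun u v hu hv => K.add_mem hu hv)
    intro f η
    have h1 := (lp.hasSum_single (p := 2) (E := fun _ : ι => E) (by simp) f)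
    have h2 : Continuous fun f : L2Sum ι E => htmul f η := by
      unfold htmul
      fun_prop
    refine hK.mem_of_tendsto ((h2.tendsto f).comp h1) (Filter.Eventually.of_forall fun s => ?_)
    simp only [Function.comp_apply]
    induction s using Finset.induction_on with
    | empty => simp
    | insert a s ha ih =>
      rw [Finset.sum_insert ha, add_htmul]
      refine K.add_mem (Submodule.le_topologicalClosure _ ?_) ih
      exact Submodule.mem_iSup_of_mem a ⟨htmul (f a) η, coordIsometry_htmul _ _ _⟩

/-- The canonical unitary `ℓ²(ι; E) ⊗ P ≃ ℓ²(ι; E ⊗ P)`,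
`(ξ ⊗ δ_i) ⊗ η ↦ (ξ ⊗ η) ⊗ δ_i`. -/
noncomputable def tensorSumEquiv (ι E P : Type*) [NormedAddCommGroup E] [InnerProductSpace ℂ E]
    [NormedAddCommGroup P] [InnerProductSpace ℂ P] :
    HTensor (L2Sum ι E) P ≃ₗᵢ[ℂ] L2Sum ι (HTensor E P) :=
  open Classical in (isHilbertSum_coord (ι := ι) (E := E) (P := P)).linearIsometryEquiv

lemma tensorSumEquiv_symm_single [hι : DecidableEq ι] (i : ι) (z : HTensor E P) :
    (tensorSumEquiv ι E P).symm (lp.single 2 i z) = coordIsometry P i z := by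
  obtain rfl : hι = fun a b => Classical.propDecidable (a = b) := Subsingleton.elim _ _
  classical
  exact IsHilbertSum.linearIsometryEquiv_symm_apply_single
    (isHilbertSum_coord (ι := ι) (E := E) (P := P)) (i := i) z

lemma tensorSumEquiv_htmul_single [DecidableEq ι] (i : ι) (ξ : E) (η : P) :
    tensorSumEquiv ι E P (htmul (lp.single 2 i ξ : L2Sum ι E) η) =
      lp.single 2 i (htmul ξ η) := by
  rw [← LinearIsometryEquiv.eq_symm_apply, tensorSumEquiv_symm_single, coordIsometry_htmul]

end tensorSum

end L2Sum

/-- The conjugation `x ↦ U x U⁻¹` by a unitary. -/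
noncomputable def conjRep {H K : Type*} [NormedAddCommGroup H] [InnerProductSpace ℂ H]
    [CompleteSpace H] [NormedAddCommGroup K] [InnerProductSpace ℂ K] [CompleteSpace K]
    (U : H ≃ₗᵢ[ℂ] K) : (H →L[ℂ] H) →⋆ₐ[ℂ] (K →L[ℂ] K) where
  toFun x := U.conjStarAlgEquiv x
  map_one' := map_one _
  map_mul' := map_mul _
  map_zero' := map_zero _
  map_add' := map_add _
  commutes' c := by rw [Algebra.algebraMap_eq_smul_one, map_smul, map_one,
    Algebra.algebraMap_eq_smul_one]
  map_star' := map_star _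

@[simp] lemma conjRep_apply {H K : Type*} [NormedAddCommGroup H] [InnerProductSpace ℂ H]
    [CompleteSpace H] [NormedAddCommGroup K] [InnerProductSpace ℂ K] [CompleteSpace K]
    (U : H ≃ₗᵢ[ℂ] K) (x : H →L[ℂ] H) (f : K) : conjRep U x f = U (x (U.symm f)) := rfl

/-- The von Neumann algebra `(S ∪ S*)''` generated by a set of bounded operators. -/
noncomputable def vnGenerated {H : Type*} [NormedAddCommGroup H] [InnerProductSpace ℂ H]
    [CompleteSpace H] (S : Set (H →L[ℂ] H)) : VonNeumannAlgebra H where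
  toStarSubalgebra := StarSubalgebra.centralizer ℂ (StarSubalgebra.centralizer ℂ S :
    Set (H →L[ℂ] H))
  centralizer_centralizer' := by
    change Set.centralizer (Set.centralizer ((StarSubalgebra.centralizer ℂ
      (StarSubalgebra.centralizer ℂ S : Set (H →L[ℂ] H)) : StarSubalgebra ℂ (H →L[ℂ] H)) :
      Set (H →L[ℂ] H))) = ((StarSubalgebra.centralizer ℂ
      (StarSubalgebra.centralizer ℂ S : Set (H →L[ℂ] H)) : StarSubalgebra ℂ (H →L[ℂ] H)) :
      Set (H →L[ℂ] H))
    rw [StarSubalgebra.coe_centralizer_centralizer, Set.centralizer_centralizer_centralizer]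

end Tools

section VN

variable {H : Type*} [NormedAddCommGroup H] [InnerProductSpace ℂ H] [CompleteSpace H]

lemma subset_vnGenerated {S : Set (H →L[ℂ] H)} {x : H →L[ℂ] H} (hx : x ∈ S) :
    x ∈ (vnGenerated S).toStarSubalgebra := by
  refine (StarSubalgebra.mem_centralizer_iff ℂ).2 fun y hy => ?_
  have h1 := ((StarSubalgebra.mem_centralizer_iff ℂ).1 hy x hx).1
  have h2 := ((StarSubalgebra.mem_centralizer_iff ℂ).1 hy x hx).2
  refine ⟨h1.symm, ?_⟩
  have := congrArg star h2
  simpa using this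

/-- An operator commuting with the generators and their adjoints commutes with the generated
von Neumann algebra. -/
lemma commute_of_mem_vnGenerated {S : Set (H →L[ℂ] H)} {x y : H →L[ℂ] H}
    (hy : ∀ s ∈ S, s * y = y * s ∧ star s * y = y * star s)
    (hx : x ∈ (vnGenerated S).toStarSubalgebra) : x * y = y * x :=
  (((StarSubalgebra.mem_centralizer_iff ℂ).1 hx y
    ((StarSubalgebra.mem_centralizer_iff ℂ).2 hy)).1).symm

/-- The operator `J x J`, for an antiunitary `J`. -/
noncomputable def antiConj (J : H ≃ₗᵢ⋆[ℂ] H) (x : H →L[ℂ] H) : H →L[ℂ] H :=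
  ((J : H →L⋆[ℂ] H).comp x).comp (J : H →L⋆[ℂ] H)

@[simp] lemma antiConj_apply (J : H ≃ₗᵢ⋆[ℂ] H) (x : H →L[ℂ] H) (ξ : H) :
    antiConj J x ξ = J (x (J ξ)) := rfl

/-- Polarization for a conjugate linear map with the same norms as a linear map. -/
lemma inner_conjLinear {D : Type*} [AddCommGroup D] [Module ℂ D] (e : D →ₗ[ℂ] H)
    (j : D →ₗ⋆[ℂ] H) (h : ∀ d, ‖j d‖ = ‖e d‖) (ξ η : D) : ⟪j ξ, j η⟫_ℂ = ⟪e η, e ξ⟫_ℂ := by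
  have h1 : j (Complex.I • η) = -(Complex.I • j η) := by
    rw [LinearMap.map_smulₛₗ]
    simp
  have h2 : e (Complex.I • η) = Complex.I • e η := map_smul _ _ _
  rw [← inner_conj_symm (e η) (e ξ), inner_eq_sum_norm_sq_div_four (𝕜 := ℂ) (j ξ) (j η),
    inner_eq_sum_norm_sq_div_four (𝕜 := ℂ) (e ξ) (e η)]
  have e1 : ‖j ξ + j η‖ = ‖e ξ + e η‖ := by rw [← map_add, h, map_add]
  have e2 : ‖j ξ - j η‖ = ‖e ξ - e η‖ := by rw [← map_sub, h, map_sub]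
  have e3 : ‖j ξ - (RCLike.I : ℂ) • j η‖ = ‖e ξ + (RCLike.I : ℂ) • e η‖ := by
    simp only [RCLike.I_to_complex]
    rw [← h2, ← map_add, ← h, map_add, h1, sub_eq_add_neg]
  have e4 : ‖j ξ + (RCLike.I : ℂ) • j η‖ = ‖e ξ - (RCLike.I : ℂ) • e η‖ := by
    simp only [RCLike.I_to_complex]
    rw [← h2, ← map_sub, ← h, map_sub, h1, sub_neg_eq_add]
  have e5 : (starRingEnd ℂ) 4 = 4 := Complex.conj_ofNat 4
  rw [e1, e2, e3, e4]
  simp [e5]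
  ring

lemma inner_antiunitary (J : H ≃ₗᵢ⋆[ℂ] H) (ξ η : H) : ⟪J ξ, J η⟫_ℂ = ⟪η, ξ⟫_ℂ :=
  inner_conjLinear LinearMap.id (J.toLinearEquiv : H →ₗ⋆[ℂ] H) J.norm_map ξ η

/-- The representation `y ↦ J y* J` of the opposite algebra, for an antiunitary involution `J`. -/
noncomputable def antiRep (J : H ≃ₗᵢ⋆[ℂ] H) (hJ : ∀ ξ, J (J ξ) = ξ) :
    (H →L[ℂ] H)ᵐᵒᵖ →⋆ₐ[ℂ] (H →L[ℂ] H) where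
  toFun y := antiConj J (star y.unop)
  map_one' := by ext; simp [hJ]
  map_mul' x y := by ext; simp [hJ]
  map_zero' := by ext; simp
  map_add' x y := by ext; simp
  commutes' c := by
    ext ξ
    change J ((star (c • (1 : H →L[ℂ] H))) (J ξ)) = c • ξ
    rw [star_smul, star_one, smul_apply, one_apply_eq_self,
      LinearIsometryEquiv.map_smulₛₗ, hJ]
    simp
  map_star' x := by
    rw [ContinuousLinearMap.star_eq_adjoint (antiConj J _), ContinuousLinearMap.eq_adjoint_iff]
    intro ξ η
    have h : ∀ ζ χ, ⟪J ζ, χ⟫_ℂ = ⟪J χ, ζ⟫_ℂ := fun ζ χ => by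
      conv_lhs => rw [← hJ χ]
      exact inner_antiunitary J _ _
    rw [antiConj_apply, antiConj_apply, h, MulOpposite.unop_star, star_star,
      ContinuousLinearMap.star_eq_adjoint]
    conv_rhs => rw [← hJ ξ]
    rw [inner_antiunitary, ContinuousLinearMap.adjoint_inner_left]

/-- An operator commuting with `s ⊗ 1` for all generators `s` and their adjoints commutes with
`x ⊗ 1` for all `x` in the generated von Neumann algebra. -/
lemma ampLeft_commute_of_mem_vnGenerated {P : Type*} [NormedAddCommGroup P]
    [InnerProductSpace ℂ P] [CompleteSpace P] {S : Set (H →L[ℂ] H)}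
    {Q : HTensor H P →L[ℂ] HTensor H P}
    (hQ : ∀ s ∈ S, ampLeft H P s * Q = Q * ampLeft H P s ∧
      ampLeft H P (star s) * Q = Q * ampLeft H P (star s))
    {x : H →L[ℂ] H} (hx : x ∈ (vnGenerated S).toStarSubalgebra) :
    ampLeft H P x * Q = Q * ampLeft H P x := by
  let ι : P → (H →L[ℂ] HTensor H P) := fun η =>
    LinearMap.mkContinuous
      { toFun := fun f => htmul f η
        map_add' := fun f g => add_htmul f g η
        map_smul' := fun c f => smul_htmul c f η } ‖η‖ fun f => by
      simp [htmul, mul_comm]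
  have hι : ∀ η f, ι η f = htmul f η := fun _ _ => rfl
  have hint : ∀ (y : H →L[ℂ] H) (u : HTensor H P) (f : H) (η : P),
      ⟪htmul f η, ampLeft H P y u⟫_ℂ = ⟪htmul (star y f) η, u⟫_ℂ := fun y u f η => by
    have h := map_star (ampLeft H P) y
    rw [ContinuousLinearMap.star_eq_adjoint (ampLeft H P y)] at h
    rw [← ContinuousLinearMap.adjoint_inner_left, ← h, ampLeft_htmul]
  have key : ∀ (y : H →L[ℂ] H) (η η' : P), ampLeft H P y * Q = Q * ampLeft H P y →
      y * ((ContinuousLinearMap.adjoint (ι η')).comp (Q.comp (ι η))) =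
        ((ContinuousLinearMap.adjoint (ι η')).comp (Q.comp (ι η))) * y := by
    intro y η η' hy
    ext f
    refine ext_inner_left ℂ fun g => ?_
    have h1 := DFunLike.congr_fun hy (htmul f η)
    simp only [mul_apply_eq_comp, ampLeft_htmul] at h1
    simp only [mul_apply_eq_comp, ContinuousLinearMap.comp_apply]
    rw [ContinuousLinearMap.adjoint_inner_right]
    simp only [hι]
    rw [← h1, hint,
      ← ContinuousLinearMap.adjoint_inner_left, ContinuousLinearMap.adjoint_inner_right, hι,
      ContinuousLinearMap.star_eq_adjoint]
  refine htensor_ext fun f η => htensor_ext_inner fun g η' => ?_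
  have h2 := commute_of_mem_vnGenerated (S := S) (x := x)
    (y := (ContinuousLinearMap.adjoint (ι η')).comp (Q.comp (ι η)))
    (fun s hs => ⟨key s η η' (hQ s hs).1, key (star s) η η' (hQ s hs).2⟩) hx
  have h3 := congrArg (fun v => ⟪g, v⟫_ℂ) (DFunLike.congr_fun h2 f)
  simp only [mul_apply_eq_comp, ContinuousLinearMap.comp_apply] at h3
  rw [ContinuousLinearMap.adjoint_inner_right, hι, hι,
    ← ContinuousLinearMap.adjoint_inner_left x, ContinuousLinearMap.adjoint_inner_right, hι, hι,
    ← ContinuousLinearMap.star_eq_adjoint] at h3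
  simp only [mul_apply_eq_comp, ampLeft_htmul]
  rw [hint, h3]

end VN

/-! ### Bimodules over a von Neumann algebra -/

section Bimodule

variable {H : Type*} [NormedAddCommGroup H] [InnerProductSpace ℂ H] [CompleteSpace H]

/-- A (Hilbert) bimodule over a von Neumann algebra `M`: commuting unital `*`-representations of
`M` (left action) and of its opposite algebra (right action). -/
structure Bimodule (M : VonNeumannAlgebra H) (K : Type*) [NormedAddCommGroup K]
    [InnerProductSpace ℂ K] [CompleteSpace K] where
  /-- The left action `ξ ↦ x · ξ`. -/
  left : M.toStarSubalgebra →⋆ₐ[ℂ] (K →L[ℂ] K)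
  /-- The right action `ξ ↦ ξ · y`. -/
  right : (M.toStarSubalgebra)ᵐᵒᵖ →⋆ₐ[ℂ] (K →L[ℂ] K)
  left_right_comm : ∀ x y ξ, left x (right (.op y) ξ) = right (.op y) (left x ξ)

namespace Bimodule

variable {M : VonNeumannAlgebra H}
  {K : Type*} [NormedAddCommGroup K] [InnerProductSpace ℂ K] [CompleteSpace K]
  {L : Type*} [NormedAddCommGroup L] [InnerProductSpace ℂ L] [CompleteSpace L]

/-- The vector `x · ξ · y`. -/
noncomputable def act (B : Bimodule M K) (x : M.toStarSubalgebra) (ξ : K)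
    (y : M.toStarSubalgebra) : K :=
  B.left x (B.right (.op y) ξ)

/-- Isomorphism of bimodules: a unitary intertwining the left and the right actions. -/
def Isomorphic (B : Bimodule M K) (C : Bimodule M L) : Prop :=
  ∃ U : K ≃ₗᵢ[ℂ] L, ∀ x ξ y, U (B.act x ξ y) = C.act x (U ξ) y

/-- Weak containment of bimodules: every coefficient `(x, y) ↦ ⟨ξ, x ξ y⟩` of `B` can be
approximated, on finite subsets of `M`, by finite sums of coefficients of `C`. -/
def WeaklyContained (B : Bimodule M K) (C : Bimodule M L) : Prop :=
  ∀ (ξ : K) (F : Finset M.toStarSubalgebra) (ε : ℝ), 0 < ε →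
    ∃ (n : ℕ) (η : Fin n → L), ∀ x ∈ F, ∀ y ∈ F,
      ‖⟪ξ, B.act x ξ y⟫_ℂ - ∑ i, ⟪η i, C.act x (η i) y⟫_ℂ‖ < ε

/-- The multiple `⊕_{i ∈ I} B` of a bimodule. -/
noncomputable def multiple (I : Type*) (B : Bimodule M K) : Bimodule M (L2Sum I K) where
  left := (ampSum I K).comp B.left
  right := (ampSum I K).comp B.right
  left_right_comm x y ξ := by
    ext i
    exact B.left_right_comm x y (ξ i)

end Bimodule

/-- The inclusion of the opposite algebra of `M` into the opposite algebra of `B(H)`. -/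
noncomputable def opIncl (M : VonNeumannAlgebra H) :
    (M.toStarSubalgebra)ᵐᵒᵖ →⋆ₐ[ℂ] (H →L[ℂ] H)ᵐᵒᵖ where
  toFun y := .op (y.unop : H →L[ℂ] H)
  map_one' := rfl
  map_mul' _ _ := rfl
  map_zero' := rfl
  map_add' _ _ := rfl
  commutes' _ := rfl
  map_star' _ := rfl

end Bimodule

/-! ### The tracial algebra `(A, τ)` and the Hilbert space `L²(A)` -/

section Tracial

variable {A : Type*} [CommCStarAlgebra A] [PartialOrder A] [StarOrderedRing A]

/-- `τ` is a faithful normal (tracial) state on the abelian algebra `A`. -/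
structure IsFaithfulNormalTrace (τ : A →ₚ[ℂ] ℂ) : Prop where
  map_one : τ 1 = 1
  faithful : ∀ a, τ (star a * a) = 0 → a = 0
  normal : ∀ s : Set A, s.Nonempty → DirectedOn (· ≤ ·) s → ∀ a, IsLUB s a →
    IsLUB (τ '' s) (τ a)

/-- The Hilbert space `L²(A, τ)`, the GNS Hilbert space of `τ`. -/
def L2A (τ : A →ₚ[ℂ] ℂ) : Type _ := τ.GNS

noncomputable instance (τ : A →ₚ[ℂ] ℂ) : NormedAddCommGroup (L2A τ) :=
  inferInstanceAs (NormedAddCommGroup τ.GNS)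

noncomputable instance (τ : A →ₚ[ℂ] ℂ) : InnerProductSpace ℂ (L2A τ) :=
  inferInstanceAs (InnerProductSpace ℂ τ.GNS)

instance (τ : A →ₚ[ℂ] ℂ) : CompleteSpace (L2A τ) :=
  inferInstanceAs (CompleteSpace τ.GNS)

/-- The vector `â` of `L²(A, τ)` given by `a ∈ A`. -/
noncomputable def hat (τ : A →ₚ[ℂ] ℂ) (a : A) : L2A τ := ((τ.toPreGNS a : τ.PreGNS) : τ.GNS)

/-- The action of `A` on `L²(A, τ)` by multiplication. -/
noncomputable def mulA (τ : A →ₚ[ℂ] ℂ) : A →⋆ₐ[ℂ] (L2A τ →L[ℂ] L2A τ) := τ.gnsStarAlgHom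

variable {τ : A →ₚ[ℂ] ℂ}

lemma denseRange_hat : DenseRange (hat τ) :=
  (UniformSpace.Completion.denseRange_coe (α := τ.PreGNS)).comp
    τ.toPreGNS.surjective.denseRange (UniformSpace.Completion.continuous_coe _)

lemma inner_hat (a b : A) : ⟪hat τ a, hat τ b⟫_ℂ = τ (star a * b) := by
  change ⟪((τ.toPreGNS a : τ.PreGNS) : τ.GNS), ((τ.toPreGNS b : τ.PreGNS) : τ.GNS)⟫_ℂ = _
  simp [PositiveLinearMap.preGNS_inner_def]

lemma mulA_hat (a b : A) : mulA τ a (hat τ b) = hat τ (a * b) := by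
  change τ.gnsStarAlgHom a ((τ.toPreGNS b : τ.PreGNS) : τ.GNS) =
    ((τ.toPreGNS (a * b) : τ.PreGNS) : τ.GNS)
  simp

lemma norm_hat_sq (a : A) : ((‖hat τ a‖ ^ 2 : ℝ) : ℂ) = τ (star a * a) := by
  rw [← inner_hat]
  simp [inner_self_eq_norm_sq_to_K]

lemma norm_hat_eq {a b : A} (h : τ (star a * a) = τ (star b * b)) : ‖hat τ a‖ = ‖hat τ b‖ := by
  rw [← sq_eq_sq₀ (norm_nonneg _) (norm_nonneg _)]
  exact_mod_cast (norm_hat_sq a).trans (h.trans (norm_hat_sq b).symm)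

/-- The linear map `a ↦ â`. -/
noncomputable def hatₗ (τ : A →ₚ[ℂ] ℂ) : A →ₗ[ℂ] L2A τ :=
  (UniformSpace.Completion.toComplₗᵢ (𝕜 := ℂ) (E := τ.PreGNS)).toLinearMap.comp
    τ.toPreGNS.toLinearMap

@[simp] lemma hatₗ_apply (a : A) : hatₗ τ a = hat τ a := rfl

/-- The canonical conjugation `â ↦ (a*)^` of `L²(A, τ)`. -/
noncomputable def conjA (τ : A →ₚ[ℂ] ℂ) : L2A τ ≃ₗᵢ⋆[ℂ] L2A τ :=
  (starLinearEquiv ℂ (A := A)).extendOfIsometry (hatₗ τ) (hatₗ τ) denseRange_hat denseRange_hat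
    fun a => norm_hat_eq (by simp [mul_comm])

@[simp] lemma conjA_hat (a : A) : conjA τ (hat τ a) = hat τ (star a) :=
  LinearEquiv.extendOfIsometry_eq _ _ _ _ _ _ _

/-- A trace preserving action of a group on `(A, τ)` by `*`-automorphisms. -/
structure TraceAction (G : Type*) [Group G] (τ : A →ₚ[ℂ] ℂ) where
  /-- The action by automorphisms. -/
  toHom : G →* (A ≃⋆ₐ[ℂ] A)
  trace_map : ∀ g a, τ (toHom g a) = τ a

variable {G : Type*} [Group G]

/-- The unitary `â ↦ (σ_g(a))^` of `L²(A, τ)`. -/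
noncomputable def TraceAction.unitary (σ : TraceAction G τ) (g : G) : L2A τ ≃ₗᵢ[ℂ] L2A τ :=
  (σ.toHom g).toAlgEquiv.toLinearEquiv.extendOfIsometry (hatₗ τ) (hatₗ τ)
    denseRange_hat denseRange_hat
    fun a => norm_hat_eq (by
      change τ (star (σ.toHom g a) * σ.toHom g a) = _
      rw [← map_star, ← map_mul, σ.trace_map])

@[simp] lemma TraceAction.unitary_hat (σ : TraceAction G τ) (g : G) (a : A) :
    σ.unitary g (hat τ a) = hat τ (σ.toHom g a) :=
  LinearEquiv.extendOfIsometry_eq _ _ _ _ _ _ _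

lemma conjA_conjA (ξ : L2A τ) : conjA τ (conjA τ ξ) = ξ := by
  refine denseRange_hat.induction_on ξ (isClosed_eq (by fun_prop) (by fun_prop)) ?_
  simp

lemma conjA_mulA (a : A) (ξ : L2A τ) : conjA τ (mulA τ a ξ) = mulA τ (star a) (conjA τ ξ) := by
  refine denseRange_hat.induction_on ξ (isClosed_eq (by fun_prop) (by fun_prop)) fun b => ?_
  rw [mulA_hat, conjA_hat, conjA_hat, mulA_hat, star_mul, mul_comm]

lemma TraceAction.conjA_unitary (σ : TraceAction G τ) (g : G) (ξ : L2A τ) :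
    conjA τ (σ.unitary g ξ) = σ.unitary g (conjA τ ξ) := by
  refine denseRange_hat.induction_on ξ (isClosed_eq (by fun_prop) (by fun_prop)) fun b => ?_
  simp [map_star]

lemma TraceAction.unitary_mulA (σ : TraceAction G τ) (g : G) (a : A) (ξ : L2A τ) :
    σ.unitary g (mulA τ a ξ) = mulA τ (σ.toHom g a) (σ.unitary g ξ) := by
  refine denseRange_hat.induction_on ξ (isClosed_eq (by fun_prop) (by fun_prop)) fun b => ?_
  rw [mulA_hat, unitary_hat, unitary_hat, mulA_hat, map_mul]

lemma TraceAction.unitary_mul (σ : TraceAction G τ) (g h : G) (ξ : L2A τ) :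
    σ.unitary (g * h) ξ = σ.unitary g (σ.unitary h ξ) := by
  refine denseRange_hat.induction_on ξ (isClosed_eq (by fun_prop) (by fun_prop)) fun b => ?_
  simp

@[simp] lemma TraceAction.unitary_one (σ : TraceAction G τ) (ξ : L2A τ) :
    σ.unitary 1 ξ = ξ := by
  refine denseRange_hat.induction_on ξ (isClosed_eq (by fun_prop) (by fun_prop)) fun b => ?_
  simp

end Tracial

/-! ### The crossed product `M = A ⋊ G` -/

section CrossedProduct

variable {A : Type*} [CommCStarAlgebra A] [PartialOrder A] [StarOrderedRing A]
  {τ : A →ₚ[ℂ] ℂ} {G : Type*} [Group G]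

/-- The Hilbert space `L²(M) = L²(A) ⊗ ℓ²(G)`; the vector `lp.single 2 g (hat τ a) = â ⊗ δ_g`
is the vector of `L²(M)` given by `a u_g ∈ M`. -/
abbrev L2M (G : Type*) (τ : A →ₚ[ℂ] ℂ) : Type _ := L2Sum G (L2A τ)

/-- The operator `ξ ⊗ δ_k ↦ a ξ ⊗ δ_k` of `L²(M)`. -/
noncomputable def opA (G : Type*) (τ : A →ₚ[ℂ] ℂ) (a : A) : L2M G τ →L[ℂ] L2M G τ :=
  ampSum G (L2A τ) (mulA τ a)

/-- The unitary `u_g : ξ ⊗ δ_k ↦ σ_g(ξ) ⊗ δ_{gk}` of `L²(M)`. -/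
noncomputable def unitaryU (σ : TraceAction G τ) (g : G) : L2M G τ ≃ₗᵢ[ℂ] L2M G τ :=
  l2sumCongr (Equiv.mulLeft g⁻¹) (fun _ => σ.unitary g)

/-- The unitary `u_g` as a bounded operator. -/
noncomputable def opU (σ : TraceAction G τ) (g : G) : L2M G τ →L[ℂ] L2M G τ := unitaryU σ g

@[simp] lemma opA_apply (a : A) (f : L2M G τ) (k : G) : opA G τ a f k = mulA τ a (f k) := rfl

@[simp] lemma opU_apply (σ : TraceAction G τ) (g : G) (f : L2M G τ) (k : G) :
    opU σ g f k = σ.unitary g (f (g⁻¹ * k)) := rfl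

lemma opA_single [DecidableEq G] (a : A) (k : G) (ξ : L2A τ) :
    opA G τ a (lp.single 2 k ξ) = lp.single 2 k (mulA τ a ξ) :=
  ampSum_single _ _ _

lemma opU_single [DecidableEq G] (σ : TraceAction G τ) (g k : G) (ξ : L2A τ) :
    opU σ g (lp.single 2 k ξ) = lp.single 2 (g * k) (σ.unitary g ξ) := by
  ext j
  rw [opU_apply]
  by_cases h : j = g * k
  · subst h; simp
  · have h' : g⁻¹ * j ≠ k := fun h' => h (by rw [← h']; simp)
    simp [h, h']

lemma star_opA (a : A) : star (opA G τ a) = opA G τ (star a) := by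
  unfold opA
  rw [map_star, map_star]

lemma star_opU (σ : TraceAction G τ) (g : G) : star (opU σ g) = opU σ g⁻¹ := by
  have h : (unitaryU σ g).symm = unitaryU σ g⁻¹ := by
    ext f k
    have h1 : f = unitaryU σ g (unitaryU σ g⁻¹ f) := by
      ext k
      change _ = σ.unitary g (σ.unitary g⁻¹ (f (g⁻¹⁻¹ * (g⁻¹ * k))))
      rw [← σ.unitary_mul]
      simp
    conv_lhs => rw [h1]
    rw [LinearIsometryEquiv.symm_apply_apply]
  unfold opU
  rw [← h, ContinuousLinearMap.star_eq_adjoint]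
  exact LinearIsometryEquiv.adjoint_eq_symm _

/-- The canonical generators `a ∈ A` and `u_g`, `g ∈ G`, of the crossed product. -/
def crossedGenerators (σ : TraceAction G τ) : Set (L2M G τ →L[ℂ] L2M G τ) :=
  Set.range (opA G τ) ∪ Set.range (opU σ)

/-- The crossed product von Neumann algebra `M = A ⋊ G`, acting on `L²(M)`. -/
noncomputable def crossedProduct (σ : TraceAction G τ) : VonNeumannAlgebra (L2M G τ) :=
  vnGenerated (crossedGenerators σ)

/-- The elements `a u_g` of `M`. -/
noncomputable def elemM (σ : TraceAction G τ) (a : A) (g : G) :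
    (crossedProduct σ).toStarSubalgebra :=
  ⟨opA G τ a * opU σ g, mul_mem (subset_vnGenerated (.inl ⟨a, rfl⟩))
    (subset_vnGenerated (.inr ⟨g, rfl⟩))⟩

/-- The canonical conjugation `J : x̂ ↦ (x*)^` of `L²(M)`:
`J (ξ ⊗ δ_k) = σ_{k⁻¹}(ξ*) ⊗ δ_{k⁻¹}`. -/
noncomputable def conjM (σ : TraceAction G τ) : L2M G τ ≃ₗᵢ⋆[ℂ] L2M G τ :=
  l2sumCongr (Equiv.inv G) (fun k => (conjA τ).trans (σ.unitary k))

lemma conjM_apply (σ : TraceAction G τ) (f : L2M G τ) (k : G) :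
    conjM σ f k = σ.unitary k (conjA τ (f k⁻¹)) := rfl

lemma conjM_conjM (σ : TraceAction G τ) (f : L2M G τ) : conjM σ (conjM σ f) = f := by
  ext k
  rw [conjM_apply, conjM_apply, σ.conjA_unitary, conjA_conjA, ← σ.unitary_mul]
  simp

/-- The right action `y ↦ J y* J` of `M` on `L²(M)`. -/
noncomputable def rightM (σ : TraceAction G τ) :
    ((crossedProduct σ).toStarSubalgebra)ᵐᵒᵖ →⋆ₐ[ℂ] (L2M G τ →L[ℂ] L2M G τ) :=
  (antiRep (conjM σ) (conjM_conjM σ)).comp (opIncl (crossedProduct σ))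

lemma antiConj_opA (σ : TraceAction G τ) (a : A) (f : L2M G τ) (k : G) :
    antiConj (conjM σ) (opA G τ a) f k = mulA τ (σ.toHom k (star a)) (f k) := by
  rw [antiConj_apply, conjM_apply, opA_apply, conjM_apply, conjA_mulA, σ.unitary_mulA,
    σ.conjA_unitary, conjA_conjA, ← σ.unitary_mul]
  simp

lemma antiConj_opU (σ : TraceAction G τ) (h : G) (f : L2M G τ) (k : G) :
    antiConj (conjM σ) (opU σ h) f k = f (k * h) := by
  rw [antiConj_apply, conjM_apply, opU_apply, conjM_apply]
  simp only [σ.conjA_unitary, conjA_conjA, ← σ.unitary_mul]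
  simp

lemma mulA_comm (a b : A) (ξ : L2A τ) : mulA τ a (mulA τ b ξ) = mulA τ b (mulA τ a ξ) := by
  rw [← mul_apply_eq_comp, ← mul_apply_eq_comp, ← map_mul, ← map_mul, mul_comm]

lemma star_mem_crossedGenerators (σ : TraceAction G τ) {s : L2M G τ →L[ℂ] L2M G τ}
    (hs : s ∈ crossedGenerators σ) : star s ∈ crossedGenerators σ := by
  rcases hs with ⟨a, rfl⟩ | ⟨g, rfl⟩
  · exact .inl ⟨star a, (star_opA a).symm⟩
  · exact .inr ⟨g⁻¹, (star_opU σ g).symm⟩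

lemma crossedGenerators_commute (σ : TraceAction G τ) {s t : L2M G τ →L[ℂ] L2M G τ}
    (hs : s ∈ crossedGenerators σ) (ht : t ∈ crossedGenerators σ) :
    s * antiConj (conjM σ) t = antiConj (conjM σ) t * s := by
  ext f k
  simp only [mul_apply_eq_comp]
  rcases hs with ⟨a, rfl⟩ | ⟨g, rfl⟩ <;> rcases ht with ⟨b, rfl⟩ | ⟨h, rfl⟩
  · rw [opA_apply, antiConj_opA, antiConj_opA, opA_apply, mulA_comm]
  · rw [opA_apply, antiConj_opU, antiConj_opU, opA_apply]
  · rw [opU_apply, antiConj_opA, antiConj_opA, opU_apply, σ.unitary_mulA]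
    have h : σ.toHom g (σ.toHom (g⁻¹ * k) (star b)) = σ.toHom k (star b) := by
      change (σ.toHom g * σ.toHom (g⁻¹ * k)) (star b) = _
      rw [← map_mul, mul_inv_cancel_left]
    rw [h]
  · rw [opU_apply, antiConj_opU, antiConj_opU, opU_apply, mul_assoc]

lemma antiConj_antiConj {H : Type*} [NormedAddCommGroup H] [InnerProductSpace ℂ H]
    [CompleteSpace H] (J : H ≃ₗᵢ⋆[ℂ] H) (hJ : ∀ ξ, J (J ξ) = ξ) (x : H →L[ℂ] H) :
    antiConj J (antiConj J x) = x := by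
  ext ξ
  simp [hJ]

lemma antiConj_mul {H : Type*} [NormedAddCommGroup H] [InnerProductSpace ℂ H]
    [CompleteSpace H] (J : H ≃ₗᵢ⋆[ℂ] H) (hJ : ∀ ξ, J (J ξ) = ξ) (x y : H →L[ℂ] H) :
    antiConj J (x * y) = antiConj J x * antiConj J y := by
  ext ξ
  simp [hJ]

/-- `M` commutes with `J M J`. -/
lemma crossedProduct_commute (σ : TraceAction G τ) {x y : L2M G τ →L[ℂ] L2M G τ}
    (hx : x ∈ (crossedProduct σ).toStarSubalgebra)
    (hy : y ∈ (crossedProduct σ).toStarSubalgebra) :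
    x * antiConj (conjM σ) y = antiConj (conjM σ) y * x := by
  have h1 : ∀ s ∈ crossedGenerators σ,
      s * antiConj (conjM σ) y = antiConj (conjM σ) y * s := by
    intro s hs
    have h2 : y * antiConj (conjM σ) s = antiConj (conjM σ) s * y :=
      commute_of_mem_vnGenerated (fun t ht => ⟨crossedGenerators_commute σ ht hs,
        crossedGenerators_commute σ (star_mem_crossedGenerators σ ht) hs⟩) hy
    have h3 := congrArg (antiConj (conjM σ)) h2
    rw [antiConj_mul _ (conjM_conjM σ), antiConj_mul _ (conjM_conjM σ),
      antiConj_antiConj _ (conjM_conjM σ)] at h3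
    exact h3.symm
  exact commute_of_mem_vnGenerated (fun s hs => ⟨h1 s hs,
    h1 _ (star_mem_crossedGenerators σ hs)⟩) hx

lemma rightM_commute (σ : TraceAction G τ) (x y : (crossedProduct σ).toStarSubalgebra) :
    (x : L2M G τ →L[ℂ] L2M G τ) * rightM σ (.op y) = rightM σ (.op y) * x :=
  crossedProduct_commute σ x.2 (star_mem y.2)

lemma rightM_elemM_single [DecidableEq G] (σ : TraceAction G τ) (b : A) (h k : G) (ξ : L2A τ) :
    rightM σ (.op (elemM σ b h)) (lp.single 2 k ξ) =
      lp.single 2 (k * h) (mulA τ (σ.toHom k b) ξ) := by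
  change antiConj (conjM σ) (star (opA G τ b * opU σ h)) (lp.single 2 k ξ) = _
  rw [star_mul, star_opA, star_opU, antiConj_mul _ (conjM_conjM σ)]
  ext j
  rw [mul_apply_eq_comp, antiConj_opU, antiConj_opA]
  by_cases hj : j = k * h
  · subst hj; simp
  · have h' : j * h⁻¹ ≠ k := fun h' => hj (by rw [← h']; simp)
    simp [hj, h']

/-- The coarse bimodule `L²(M) ⊗ L²(M)`: `x · (ξ ⊗ η) · y = xξ ⊗ ηy`. -/
noncomputable def coarseBimodule (σ : TraceAction G τ) :
    Bimodule (crossedProduct σ) (HTensor (L2M G τ) (L2M G τ)) where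
  left := (ampLeft (L2M G τ) (L2M G τ)).comp (crossedProduct σ).toStarSubalgebra.subtype
  right := (ampRight (L2M G τ) (L2M G τ)).comp (rightM σ)
  left_right_comm x y ξ := DFunLike.congr_fun (htensor_ext
    (S := (ampLeft (L2M G τ) (L2M G τ) x).comp (ampRight (L2M G τ) (L2M G τ) (rightM σ (.op y))))
    (T := (ampRight (L2M G τ) (L2M G τ) (rightM σ (.op y))).comp (ampLeft (L2M G τ) (L2M G τ) x))
    (by simp)) ξ

/-! ### The bimodule `L²(A) ⊗ P ⊗ ℓ²(G)` -/

section Rep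

variable {P : Type*} [NormedAddCommGroup P] [InnerProductSpace ℂ P] [CompleteSpace P]

/-- The unitary `ξ ⊗ η ⊗ δ_k ↦ ξ ⊗ ρ_k(η) ⊗ δ_k` of `L²(A) ⊗ P ⊗ ℓ²(G)`. -/
noncomputable def twist (τ : A →ₚ[ℂ] ℂ) (ρ : G →* (P ≃ₗᵢ[ℂ] P)) :
    L2Sum G (HTensor (L2A τ) P) ≃ₗᵢ[ℂ] L2Sum G (HTensor (L2A τ) P) :=
  l2sumCongr (Equiv.refl G) (fun k => hunitary (LinearIsometryEquiv.refl ℂ (L2A τ)) (ρ k))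

lemma twist_single [DecidableEq G] (ρ : G →* (P ≃ₗᵢ[ℂ] P)) (k : G) (ξ : L2A τ) (η : P) :
    twist τ ρ (lp.single 2 k (htmul ξ η)) = lp.single 2 k (htmul ξ (ρ k η)) := by
  ext j
  change hunitary (LinearIsometryEquiv.refl ℂ (L2A τ)) (ρ j) _ = _
  by_cases h : j = k
  · subst h; simp
  · simp [h]

lemma twist_symm_single [DecidableEq G] (ρ : G →* (P ≃ₗᵢ[ℂ] P)) (k : G) (ξ : L2A τ) (η : P) :
    (twist τ ρ).symm (lp.single 2 k (htmul ξ η)) = lp.single 2 k (htmul ξ ((ρ k).symm η)) := by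
  rw [LinearIsometryEquiv.symm_apply_eq, twist_single, LinearIsometryEquiv.apply_symm_apply]

/-- Two bounded operators on `L²(A) ⊗ P ⊗ ℓ²(G)` which agree on elementary tensors agree. -/
lemma repSpace_ext [DecidableEq G] {W : Type*} [NormedAddCommGroup W] [NormedSpace ℂ W]
    {S T : L2Sum G (HTensor (L2A τ) P) →L[ℂ] W}
    (h : ∀ k ξ η, S (lp.single 2 k (htmul ξ η)) = T (lp.single 2 k (htmul ξ η))) : S = T := by
  refine l2sum_ext fun k z => ?_
  exact DFunLike.congr_fun (htensor_ext
    (S := S.comp (singleIsometry (HTensor (L2A τ) P) k).toContinuousLinearMap)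
    (T := T.comp (singleIsometry (HTensor (L2A τ) P) k).toContinuousLinearMap) (h k)) z

/-- The left action of `B(L²(M))` on `L²(A) ⊗ P ⊗ ℓ²(G)`, the conjugate of `x ↦ x ⊗ 1_P` by the
unitary `twist`; it maps `a u_g` to `ξ ⊗ η ⊗ δ_k ↦ a σ_g(ξ) ⊗ ρ_g(η) ⊗ δ_{gk}`. -/
noncomputable def repLeft (τ : A →ₚ[ℂ] ℂ) (ρ : G →* (P ≃ₗᵢ[ℂ] P)) :
    (L2M G τ →L[ℂ] L2M G τ) →⋆ₐ[ℂ]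
      (L2Sum G (HTensor (L2A τ) P) →L[ℂ] L2Sum G (HTensor (L2A τ) P)) :=
  (conjRep ((tensorSumEquiv G (L2A τ) P).trans (twist τ ρ))).comp
    (ampLeft (L2M G τ) P)

/-- The right action of `M` on `L²(A) ⊗ P ⊗ ℓ²(G)`: the right action on `L²(M)` tensored with the
identity of `P`; it maps `b u_h` to `ξ ⊗ η ⊗ δ_k ↦ ξ σ_k(b) ⊗ η ⊗ δ_{kh}`. -/
noncomputable def repRight (σ : TraceAction G τ) (P : Type*) [NormedAddCommGroup P]
    [InnerProductSpace ℂ P] [CompleteSpace P] :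
    ((crossedProduct σ).toStarSubalgebra)ᵐᵒᵖ →⋆ₐ[ℂ]
      (L2Sum G (HTensor (L2A τ) P) →L[ℂ] L2Sum G (HTensor (L2A τ) P)) :=
  ((conjRep (tensorSumEquiv G (L2A τ) P)).comp
    (ampLeft (L2M G τ) P)).comp (rightM σ)

lemma tensorSumEquiv_symm_single_htmul [DecidableEq G] (k : G) (ξ : L2A τ) (η : P) :
    (tensorSumEquiv G (L2A τ) P).symm (lp.single 2 k (htmul ξ η)) =
      htmul (lp.single 2 k ξ : L2M G τ) η := by
  rw [LinearIsometryEquiv.symm_apply_eq, tensorSumEquiv_htmul_single]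

lemma repLeft_apply (ρ : G →* (P ≃ₗᵢ[ℂ] P)) (x : L2M G τ →L[ℂ] L2M G τ)
    (f : L2Sum G (HTensor (L2A τ) P)) :
    repLeft τ ρ x f = twist τ ρ (tensorSumEquiv G (L2A τ) P (ampLeft (L2M G τ) P x
      ((tensorSumEquiv G (L2A τ) P).symm ((twist τ ρ).symm f)))) := rfl

lemma repRight_apply (σ : TraceAction G τ) (y : (crossedProduct σ).toStarSubalgebra)
    (f : L2Sum G (HTensor (L2A τ) P)) :
    repRight σ P (.op y) f = tensorSumEquiv G (L2A τ) P (ampLeft (L2M G τ) P (rightM σ (.op y))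
      ((tensorSumEquiv G (L2A τ) P).symm f)) := rfl

lemma repLeft_opA_single [DecidableEq G] (ρ : G →* (P ≃ₗᵢ[ℂ] P)) (a : A) (k : G) (ξ : L2A τ)
    (η : P) : repLeft τ ρ (opA G τ a) (lp.single 2 k (htmul ξ η)) =
      lp.single 2 k (htmul (mulA τ a ξ) η) := by
  rw [repLeft_apply, twist_symm_single, tensorSumEquiv_symm_single_htmul, ampLeft_htmul,
    opA_single, tensorSumEquiv_htmul_single, twist_single, LinearIsometryEquiv.apply_symm_apply]

lemma repLeft_opU_single [DecidableEq G] (σ : TraceAction G τ) (ρ : G →* (P ≃ₗᵢ[ℂ] P)) (g k : G)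
    (ξ : L2A τ) (η : P) : repLeft τ ρ (opU σ g) (lp.single 2 k (htmul ξ η)) =
      lp.single 2 (g * k) (htmul (σ.unitary g ξ) (ρ g η)) := by
  rw [repLeft_apply, twist_symm_single, tensorSumEquiv_symm_single_htmul, ampLeft_htmul,
    opU_single, tensorSumEquiv_htmul_single, twist_single, map_mul]
  rw [show (ρ g * ρ k) ((ρ k).symm η) = ρ g (ρ k ((ρ k).symm η)) from rfl,
    LinearIsometryEquiv.apply_symm_apply]

lemma repLeft_opA (ρ : G →* (P ≃ₗᵢ[ℂ] P)) (a : A) (f : L2Sum G (HTensor (L2A τ) P)) :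
    repLeft τ ρ (opA G τ a) f = tensorSumEquiv G (L2A τ) P (ampLeft (L2M G τ) P (opA G τ a)
      ((tensorSumEquiv G (L2A τ) P).symm f)) := by
  classical
  refine DFunLike.congr_fun (repSpace_ext
    (T := conjRep (tensorSumEquiv G (L2A τ) P) (ampLeft (L2M G τ) P (opA G τ a)))
    fun k ξ η => ?_) f
  rw [repLeft_opA_single, conjRep_apply,
    tensorSumEquiv_symm_single_htmul, ampLeft_htmul, opA_single, tensorSumEquiv_htmul_single]

lemma repLeft_opU (σ : TraceAction G τ) (ρ : G →* (P ≃ₗᵢ[ℂ] P)) (g : G)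
    (f : L2Sum G (HTensor (L2A τ) P)) :
    repLeft τ ρ (opU σ g) f = tensorSumEquiv G (L2A τ) P (ampLeft (L2M G τ) P (opU σ g)
      (ampRight (L2M G τ) P (ρ g : P →L[ℂ] P) ((tensorSumEquiv G (L2A τ) P).symm f))) := by
  classical
  refine DFunLike.congr_fun (repSpace_ext
    (T := conjRep (tensorSumEquiv G (L2A τ) P)
      (ampLeft (L2M G τ) P (opU σ g) * ampRight (L2M G τ) P (ρ g : P →L[ℂ] P)))
    fun k ξ η => ?_) f
  rw [repLeft_opU_single, conjRep_apply,
    tensorSumEquiv_symm_single_htmul, mul_apply_eq_comp, ampRight_htmul, ampLeft_htmul, opU_single,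
    tensorSumEquiv_htmul_single]
  rfl

/-- The `M`-bimodule `L²(A) ⊗ P ⊗ ℓ²(G)` associated with a unitary representation `ρ` of `G`
on `P`: `(a u_g) · (ξ ⊗ η ⊗ δ_k) · (b u_h) = a σ_g(ξ) σ_{gk}(b) ⊗ ρ_g(η) ⊗ δ_{gkh}`
(see `repBimodule_act`). -/
noncomputable def repBimodule (σ : TraceAction G τ) (ρ : G →* (P ≃ₗᵢ[ℂ] P)) :
    Bimodule (crossedProduct σ) (L2Sum G (HTensor (L2A τ) P)) where
  left := (repLeft τ ρ).comp (crossedProduct σ).toStarSubalgebra.subtype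
  right := repRight σ P
  left_right_comm x y f := by
    set Φ := tensorSumEquiv G (L2A τ) P
    set W := Φ.trans (twist τ ρ)
    set R := ampLeft (L2M G τ) P (rightM σ (.op y))
    set Q := conjRep W.symm (conjRep Φ R) with hQdef
    have hconj : ∀ s : L2M G τ →L[ℂ] L2M G τ,
        repLeft τ ρ s * conjRep Φ R = conjRep Φ R * repLeft τ ρ s →
        ampLeft (L2M G τ) P s * Q = Q * ampLeft (L2M G τ) P s := by
      intro s hs
      have h1 := congrArg (conjRep W.symm) hs
      rw [map_mul, map_mul] at h1
      have h2 : conjRep W.symm (repLeft τ ρ s) = ampLeft (L2M G τ) P s := by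
        ext z
        change W.symm (W (ampLeft (L2M G τ) P s (W.symm (W z)))) = _
        simp
      rw [h2] at h1
      exact h1
    have hgen : ∀ s ∈ crossedGenerators σ,
        repLeft τ ρ s * conjRep Φ R = conjRep Φ R * repLeft τ ρ s := by
      have hR : ∀ s ∈ crossedGenerators σ, ampLeft (L2M G τ) P s * R =
          R * ampLeft (L2M G τ) P s := by
        intro s hs
        rw [← map_mul, ← map_mul]
        exact congrArg _ (rightM_commute σ ⟨s, subset_vnGenerated hs⟩ y)
      rintro s (⟨a, rfl⟩ | ⟨g, rfl⟩)
      · ext1 f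
        have h := DFunLike.congr_fun (hR _ (.inl ⟨a, rfl⟩)) (Φ.symm f)
        simp only [mul_apply_eq_comp] at h
        simp only [mul_apply_eq_comp, conjRep_apply]
        rw [repLeft_opA, repLeft_opA]
        change Φ (ampLeft (L2M G τ) P (opA G τ a) (Φ.symm (Φ (R (Φ.symm f))))) =
          Φ (R (Φ.symm (Φ (ampLeft (L2M G τ) P (opA G τ a) (Φ.symm f)))))
        rw [LinearIsometryEquiv.symm_apply_apply, LinearIsometryEquiv.symm_apply_apply, h]
      · ext1 f
        have h3 : ampRight (L2M G τ) P (ρ g : P →L[ℂ] P) * R =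
            R * ampRight (L2M G τ) P (ρ g : P →L[ℂ] P) := htensor_ext fun u v => by
          simp [R]
        have h := DFunLike.congr_fun (hR _ (.inr ⟨g, rfl⟩))
          (ampRight (L2M G τ) P (ρ g : P →L[ℂ] P) (Φ.symm f))
        have h4 := DFunLike.congr_fun h3 (Φ.symm f)
        simp only [mul_apply_eq_comp] at h h4
        simp only [mul_apply_eq_comp, conjRep_apply]
        rw [repLeft_opU, repLeft_opU]
        change Φ (ampLeft (L2M G τ) P (opU σ g) (ampRight (L2M G τ) P (ρ g : P →L[ℂ] P)
            (Φ.symm (Φ (R (Φ.symm f)))))) =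
          Φ (R (Φ.symm (Φ (ampLeft (L2M G τ) P (opU σ g)
            (ampRight (L2M G τ) P (ρ g : P →L[ℂ] P) (Φ.symm f))))))
        rw [LinearIsometryEquiv.symm_apply_apply, LinearIsometryEquiv.symm_apply_apply, h4, h]
    have hx := ampLeft_commute_of_mem_vnGenerated (P := P) (Q := Q)
      (fun s hs => ⟨hconj s (hgen s hs),
        hconj _ (hgen _ (star_mem_crossedGenerators σ hs))⟩) x.2
    have h5 := congrArg W (DFunLike.congr_fun hx (W.symm f))
    simp only [mul_apply_eq_comp] at h5
    change W (ampLeft (L2M G τ) P x (W.symm (Φ (R (Φ.symm (W (W.symm f))))))) =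
      W (W.symm (Φ (R (Φ.symm (W (ampLeft (L2M G τ) P x (W.symm f))))))) at h5
    rw [LinearIsometryEquiv.apply_symm_apply, LinearIsometryEquiv.apply_symm_apply] at h5
    exact h5

/-- The formula for the bimodule structure on elementary tensors. -/
theorem repBimodule_act [DecidableEq G] (σ : TraceAction G τ) (ρ : G →* (P ≃ₗᵢ[ℂ] P)) (a b : A)
    (g k h : G) (ξ : L2A τ) (η : P) :
    (repBimodule σ ρ).act (elemM σ a g) (lp.single 2 k (htmul ξ η)) (elemM σ b h) =
      lp.single 2 (g * k * h)
        (htmul (mulA τ a (mulA τ (σ.toHom (g * k) b) (σ.unitary g ξ))) (ρ g η)) := by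
  change repLeft τ ρ (opA G τ a * opU σ g) (repRight σ P (.op (elemM σ b h)) _) = _
  rw [repRight_apply, tensorSumEquiv_symm_single_htmul, ampLeft_htmul, rightM_elemM_single,
    tensorSumEquiv_htmul_single, map_mul, mul_apply_eq_comp, repLeft_opU_single,
    repLeft_opA_single, σ.unitary_mulA, mul_assoc, map_mul]
  rfl

end Rep

end CrossedProduct

/-! ### The basic construction and `L²(⟨M, A⟩, Tr)` -/

section Extension

variable {K : Type*} [NormedAddCommGroup K] [InnerProductSpace ℂ K] [CompleteSpace K]
  {D : Type*} [AddCommGroup D] [Module ℂ D]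

lemma dense_ext {e : D →ₗ[ℂ] K} (he : DenseRange e) {S T : K →L[ℂ] K}
    (h : ∀ d, S (e d) = T (e d)) : S = T :=
  ContinuousLinearMap.coeFn_injective (he.equalizer S.continuous T.continuous (funext h))

variable {R : Type*} [Ring R] [StarRing R] [Algebra ℂ R]

/-- The bounded extension to `K` of a representation `φ` on a dense subspace `e : D → K`. -/
noncomputable def extRep (e : D →ₗ[ℂ] K) (he : DenseRange e) (φ : R →ₐ[ℂ] Module.End ℂ D)
    (hb : ∀ x, ∃ C : ℝ, ∀ d, ‖e (φ x d)‖ ≤ C * ‖e d‖)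
    (ha : ∀ x c d, ⟪e (φ (star x) c), e d⟫_ℂ = ⟪e c, e (φ x d)⟫_ℂ) : R →⋆ₐ[ℂ] (K →L[ℂ] K) :=
  have happ : ∀ x d, (e.comp (φ x)).extendOfNorm e (e d) = e (φ x d) := fun x d =>
    LinearMap.extendOfNorm_eq (f := e.comp (φ x)) he (hb x) d
  { toFun := fun x => (e.comp (φ x)).extendOfNorm e
    map_one' := dense_ext he fun d => by rw [happ]; simp
    map_mul' := fun x y => dense_ext he fun d => by rw [mul_apply_eq_comp, happ, happ, happ]; simp
    map_zero' := dense_ext he fun d => by rw [happ]; simp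
    map_add' := fun x y => dense_ext he fun d => by rw [add_apply, happ, happ, happ]; simp
    commutes' := fun c => dense_ext he fun d => by
      rw [happ]; simp [Algebra.algebraMap_eq_smul_one]
    map_star' := fun x => by
      rw [ContinuousLinearMap.star_eq_adjoint, ContinuousLinearMap.eq_adjoint_iff]
      intro u v
      refine he.induction_on u (isClosed_eq (by fun_prop) (by fun_prop)) fun c => ?_
      refine he.induction_on v (isClosed_eq (by fun_prop) (by fun_prop)) fun d => ?_
      rw [happ, happ, ha] }

lemma extRep_apply (e : D →ₗ[ℂ] K) (he : DenseRange e) (φ : R →ₐ[ℂ] Module.End ℂ D)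
    (hb : ∀ x, ∃ C : ℝ, ∀ d, ‖e (φ x d)‖ ≤ C * ‖e d‖)
    (ha : ∀ x c d, ⟪e (φ (star x) c), e d⟫_ℂ = ⟪e c, e (φ x d)⟫_ℂ) (x : R) (d : D) :
    extRep e he φ hb ha x (e d) = e (φ x d) :=
  LinearMap.extendOfNorm_eq (f := e.comp (φ x)) he (hb x) d

end Extension

section BasicConstruction

variable {A : Type*} [CommCStarAlgebra A] [PartialOrder A] [StarOrderedRing A]
  {τ : A →ₚ[ℂ] ℂ} {G : Type*} [Group G]

open Classical in
/-- The inclusion `ξ ↦ ξ ⊗ δ_1` of `L²(A)` in `L²(M)`. -/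
noncomputable def inclA (G : Type*) [Group G] (τ : A →ₚ[ℂ] ℂ) : L2A τ →L[ℂ] L2M G τ :=
  (singleIsometry (L2A τ) (1 : G)).toContinuousLinearMap

/-- The Jones projection `e_A`: the orthogonal projection of `L²(M)` onto `L²(A)`. -/
noncomputable def jonesProj (G : Type*) [Group G] (τ : A →ₚ[ℂ] ℂ) : L2M G τ →L[ℂ] L2M G τ :=
  (inclA G τ).comp (ContinuousLinearMap.adjoint (inclA G τ))

/-- Jones' basic construction `⟨M, A⟩ = (M ∪ {e_A})''`. -/
noncomputable def basicConstruction (σ : TraceAction G τ) : VonNeumannAlgebra (L2M G τ) :=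
  vnGenerated ((crossedProduct σ).toStarSubalgebra ∪ {jonesProj G τ})

open Classical in
/-- The vector `û_g` of `L²(M)`. -/
noncomputable def vecU (τ : A →ₚ[ℂ] ℂ) (g : G) : L2M G τ := lp.single 2 g (hat τ 1)

/-- The canonical trace `Tr` of `⟨M, A⟩`, characterized by `Tr(x e_A y) = τ(x y)` for
`x, y ∈ M`; explicitly `Tr(T) = ∑_g ⟨û_g, T û_g⟩` for `T ≥ 0`. -/
noncomputable def basicTrace (τ : A →ₚ[ℂ] ℂ) (T : L2M G τ →L[ℂ] L2M G τ) : ℝ≥0∞ :=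
  ∑' g : G, ENNReal.ofReal (RCLike.re ⟪vecU τ g, T (vecU τ g)⟫_ℂ)

lemma basicTrace_star_mul (T : L2M G τ →L[ℂ] L2M G τ) :
    basicTrace τ (star T * T) = ∑' g : G, ‖T (vecU τ g)‖ₑ ^ 2 := by
  refine tsum_congr fun g => ?_
  rw [mul_apply_eq_comp, ContinuousLinearMap.star_eq_adjoint,
    ContinuousLinearMap.adjoint_inner_right, inner_self_eq_norm_sq, ENNReal.ofReal_pow
    (norm_nonneg _), ofReal_norm]

lemma enorm_sq_l2 {ι E : Type*} [NormedAddCommGroup E] (f : L2Sum ι E) :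
    ‖f‖ₑ ^ 2 = ∑' i, ‖f i‖ₑ ^ 2 := by
  rw [← ofReal_norm, ← ENNReal.ofReal_pow (norm_nonneg _), l2sum_norm_sq,
    ENNReal.ofReal_tsum_of_nonneg (fun _ => by positivity) (l2sum_summable f)]
  exact tsum_congr fun i => by rw [ENNReal.ofReal_pow (norm_nonneg _), ofReal_norm]

lemma memlp_two_iff_enorm {ι E : Type*} [NormedAddCommGroup E] (f : ι → E) :
    Memℓp f 2 ↔ ∑' i, ‖f i‖ₑ ^ 2 ≠ ⊤ := by
  have h : ∀ i, ‖f i‖ₑ ^ 2 = ((‖f i‖₊ ^ 2 : NNReal) : ℝ≥0∞) := fun i => by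
    push_cast; rfl
  rw [memlp_two_iff]
  simp only [h]
  rw [ENNReal.tsum_coe_ne_top_iff_summable, ← NNReal.summable_coe]
  simp

lemma mem_trace_iff (T : L2M G τ →L[ℂ] L2M G τ) :
    basicTrace τ (star T * T) ≠ ⊤ ↔ Memℓp (fun g => T (vecU τ g)) 2 := by
  rw [basicTrace_star_mul, memlp_two_iff_enorm]

/-- The operators `T ∈ ⟨M, A⟩` with `Tr(T* T) < ∞`. -/
noncomputable def hilbertSchmidt (σ : TraceAction G τ) : Submodule ℂ (L2M G τ →L[ℂ] L2M G τ) where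
  carrier := {T | T ∈ (basicConstruction σ).toStarSubalgebra ∧ basicTrace τ (star T * T) ≠ ⊤}
  zero_mem' := ⟨zero_mem _, by rw [mem_trace_iff]; exact zero_memℓp⟩
  add_mem' := by
    rintro S T ⟨hS, hS'⟩ ⟨hT, hT'⟩
    rw [mem_trace_iff] at hS' hT'
    exact ⟨add_mem hS hT, (mem_trace_iff _).2 (hS'.add hT')⟩
  smul_mem' := by
    rintro c T ⟨hT, hT'⟩
    rw [mem_trace_iff] at hT'
    exact ⟨SMulMemClass.smul_mem c hT, (mem_trace_iff _).2 (hT'.const_smul c)⟩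

/-- The map `T ↦ (T û_g)_g`, which satisfies `⟨emb S, emb T⟩ = Tr(S* T)`. -/
noncomputable def emb (σ : TraceAction G τ) : hilbertSchmidt σ →ₗ[ℂ] L2Sum G (L2M G τ) where
  toFun T := ⟨fun g => (T : L2M G τ →L[ℂ] L2M G τ) (vecU τ g), (mem_trace_iff _).1 T.2.2⟩
  map_add' _ _ := rfl
  map_smul' _ _ := rfl

lemma emb_apply (σ : TraceAction G τ) (T : hilbertSchmidt σ) (g : G) :
    emb σ T g = (T : L2M G τ →L[ℂ] L2M G τ) (vecU τ g) := rfl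

/-- The Hilbert space `L²⟨M, A⟩`, the completion of `{T ∈ ⟨M, A⟩ | Tr(T* T) < ∞}` with respect
to the inner product `⟨S, T⟩ = Tr(S* T)`. -/
abbrev L2Basic (σ : TraceAction G τ) : Type _ := (LinearMap.range (emb σ)).topologicalClosure

/-- The canonical dense embedding of `{T ∈ ⟨M, A⟩ | Tr(T* T) < ∞}` in `L²⟨M, A⟩`. -/
noncomputable def embL2 (σ : TraceAction G τ) : hilbertSchmidt σ →ₗ[ℂ] L2Basic σ :=
  (emb σ).codRestrict _ fun T => Submodule.le_topologicalClosure _ ⟨T, rfl⟩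

lemma denseRange_embL2 (σ : TraceAction G τ) : DenseRange (embL2 σ) := by
  have h : DenseRange (Set.inclusion (subset_closure (s := Set.range (emb σ)))) :=
    denseRange_inclusion_iff subset_closure |>.2 subset_rfl
  refine Dense.mono ?_ h
  rintro _ ⟨⟨_, T, rfl⟩, rfl⟩
  exact ⟨T, rfl⟩

lemma inner_embL2 (σ : TraceAction G τ) (S T : hilbertSchmidt σ) :
    ⟪embL2 σ S, embL2 σ T⟫_ℂ = ∑' g : G, ⟪(S : L2M G τ →L[ℂ] L2M G τ) (vecU τ g),
      (T : L2M G τ →L[ℂ] L2M G τ) (vecU τ g)⟫_ℂ :=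
  lp.inner_eq_tsum _ _

open Classical in
lemma inclA_apply (ξ : L2A τ) : inclA G τ ξ = lp.single 2 (1 : G) ξ := rfl

lemma inclA_adjoint (f : L2M G τ) : ContinuousLinearMap.adjoint (inclA G τ) f = f 1 := by
  classical
  refine ext_inner_left ℂ fun ξ => ?_
  rw [ContinuousLinearMap.adjoint_inner_right, inclA_apply, lp.inner_single_left]

open Classical in
lemma jonesProj_apply (f : L2M G τ) : jonesProj G τ f = lp.single 2 1 (f 1) := by
  change inclA G τ (ContinuousLinearMap.adjoint (inclA G τ) f) = _
  rw [inclA_adjoint]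
  rfl

lemma star_jonesProj : star (jonesProj G τ) = jonesProj G τ := by
  rw [ContinuousLinearMap.star_eq_adjoint, jonesProj, ContinuousLinearMap.adjoint_comp,
    ContinuousLinearMap.adjoint_adjoint]

lemma crossed_le_basic (σ : TraceAction G τ) :
    (crossedProduct σ).toStarSubalgebra ≤ (basicConstruction σ).toStarSubalgebra :=
  fun _ hx => subset_vnGenerated (.inl hx)

/-- `⟨M, A⟩` commutes with the right multiplications by elements of `A`. -/
lemma basic_commute (σ : TraceAction G τ) {T : L2M G τ →L[ℂ] L2M G τ}
    (hT : T ∈ (basicConstruction σ).toStarSubalgebra) (a : A) :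
    T * antiConj (conjM σ) (opA G τ a) = antiConj (conjM σ) (opA G τ a) * T := by
  have hA : opA G τ a ∈ (crossedProduct σ).toStarSubalgebra := subset_vnGenerated (.inl ⟨a, rfl⟩)
  refine commute_of_mem_vnGenerated (fun s hs => ?_) hT
  rcases hs with hs | rfl
  · exact ⟨crossedProduct_commute σ hs hA, crossedProduct_commute σ (star_mem hs) hA⟩
  · rw [star_jonesProj]
    refine ⟨?_, ?_⟩ <;>
    · ext f k
      simp only [mul_apply_eq_comp, jonesProj_apply, antiConj_opA]
      by_cases hk : k = 1
      · subst hk; simp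
      · simp [hk]

open Classical in
lemma basic_apply_single (σ : TraceAction G τ) {T : L2M G τ →L[ℂ] L2M G τ}
    (hT : T ∈ (basicConstruction σ).toStarSubalgebra) (b : A) (g k : G) :
    T (lp.single 2 g (hat τ b)) k = mulA τ (σ.toHom (k * g⁻¹) b) (T (vecU τ g) k) := by
  have h := DFunLike.congr_fun (basic_commute σ hT (star (σ.toHom g⁻¹ b))) (vecU τ g)
  simp only [mul_apply_eq_comp] at h
  have h1 : antiConj (conjM σ) (opA G τ (star (σ.toHom g⁻¹ b))) (vecU τ g) =
      lp.single 2 g (hat τ b) := by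
    ext j
    rw [antiConj_opA, vecU]
    by_cases hj : j = g
    · subst hj
      have h2 : σ.toHom j (σ.toHom j⁻¹ b) = b := by
        change (σ.toHom j * σ.toHom j⁻¹) b = b
        rw [← map_mul]
        simp
      rw [lp.single_apply_self, star_star, mulA_hat, mul_one, h2, lp.single_apply_self]
    · simp [hj]
  have h3 : σ.toHom k (σ.toHom g⁻¹ b) = σ.toHom (k * g⁻¹) b := by
    rw [map_mul]; rfl
  rw [← h1, h, antiConj_opA, star_star, h3]

lemma basic_star_apply (σ : TraceAction G τ) {T : L2M G τ →L[ℂ] L2M G τ}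
    (hT : T ∈ (basicConstruction σ).toStarSubalgebra) (g k : G) :
    (star T) (vecU τ g) k = conjA τ (σ.unitary (k * g⁻¹) (T (vecU τ k) g)) := by
  classical
  have key : ∀ b : A, ⟪hat τ b, (star T) (vecU τ g) k⟫_ℂ =
      ⟪hat τ b, conjA τ (σ.unitary (k * g⁻¹) (T (vecU τ k) g))⟫_ℂ := by
    intro b
    have h1 : ⟪hat τ b, (star T) (vecU τ g) k⟫_ℂ =
        ⟪(lp.single 2 k (hat τ b) : L2M G τ), (star T) (vecU τ g)⟫_ℂ := by
      rw [lp.inner_single_left]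
    have h2 : ∀ f : L2M G τ, ⟪f, vecU τ g⟫_ℂ = ⟪f g, hat τ 1⟫_ℂ := fun f => by
      rw [vecU, lp.inner_single_right]
    rw [h1, ContinuousLinearMap.star_eq_adjoint, ContinuousLinearMap.adjoint_inner_right, h2,
      basic_apply_single σ hT, ← ContinuousLinearMap.adjoint_inner_right,
      ← ContinuousLinearMap.star_eq_adjoint, ← map_star, mulA_hat, mul_one, ← map_star]
    have h3 : hat τ b = conjA τ (conjA τ (hat τ b)) := (conjA_conjA _).symm
    conv_rhs => rw [h3, inner_antiunitary, conjA_hat]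
    have h4 : hat τ (star b) = σ.unitary (k * g⁻¹) (hat τ (σ.toHom (g * k⁻¹) (star b))) := by
      rw [← σ.unitary_hat, ← σ.unitary_mul]
      simp
    conv_rhs => rw [h4, LinearIsometryEquiv.inner_map_map]
  refine ext_inner_left ℂ fun ξ => ?_
  exact denseRange_hat.induction_on ξ (isClosed_eq (by fun_prop) (by fun_prop)) key

/-- The trace property of `Tr`. -/
lemma basicTrace_star_comm (σ : TraceAction G τ) {T : L2M G τ →L[ℂ] L2M G τ}
    (hT : T ∈ (basicConstruction σ).toStarSubalgebra) :
    basicTrace τ (star (star T) * star T) = basicTrace τ (star T * T) := by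
  rw [basicTrace_star_mul, basicTrace_star_mul]
  simp only [enorm_sq_l2]
  rw [ENNReal.tsum_comm]
  refine tsum_congr fun k => tsum_congr fun g => ?_
  rw [basic_star_apply σ hT, LinearIsometryEquiv.enorm_map, LinearIsometryEquiv.enorm_map]

/-- The adjoint `T ↦ T*` of `{T ∈ ⟨M, A⟩ | Tr(T* T) < ∞}`. -/
noncomputable def starHS (σ : TraceAction G τ) : hilbertSchmidt σ →ₗ⋆[ℂ] hilbertSchmidt σ where
  toFun T := ⟨star (T : L2M G τ →L[ℂ] L2M G τ), star_mem T.2.1, by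
    rw [basicTrace_star_comm σ T.2.1]; exact T.2.2⟩
  map_add' _ _ := Subtype.ext (star_add _ _)
  map_smul' _ _ := Subtype.ext (star_smul _ _)

lemma enorm_embL2 (σ : TraceAction G τ) (T : hilbertSchmidt σ) :
    ‖embL2 σ T‖ₑ ^ 2 = 
      basicTrace τ (star (T : L2M G τ →L[ℂ] L2M G τ) * (T : L2M G τ →L[ℂ] L2M G τ)) := by
  rw [basicTrace_star_mul]
  exact enorm_sq_l2 (emb σ T)

lemma norm_embL2_starHS (σ : TraceAction G τ) (T : hilbertSchmidt σ) :
    ‖embL2 σ (starHS σ T)‖ = ‖embL2 σ T‖ := by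
  have h : ‖embL2 σ (starHS σ T)‖ₑ ^ 2 = ‖embL2 σ T‖ₑ ^ 2 := by
    rw [enorm_embL2, enorm_embL2]
    exact basicTrace_star_comm σ T.2.1
  rw [← ofReal_norm, ← ofReal_norm, ← ENNReal.ofReal_pow (norm_nonneg _),
    ← ENNReal.ofReal_pow (norm_nonneg _),
    ENNReal.ofReal_eq_ofReal_iff (by positivity) (by positivity)] at h
  exact (sq_eq_sq₀ (norm_nonneg _) (norm_nonneg _)).1 h

lemma inner_starHS (σ : TraceAction G τ) (S T : hilbertSchmidt σ) :
    ⟪embL2 σ (starHS σ S), embL2 σ (starHS σ T)⟫_ℂ = ⟪embL2 σ T, embL2 σ S⟫_ℂ :=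
  inner_conjLinear (embL2 σ) ((embL2 σ).comp (starHS σ)) (norm_embL2_starHS σ) S T

/-- Left multiplication by an element of `M`. -/
noncomputable def mulLeftHS (σ : TraceAction G τ) :
    (crossedProduct σ).toStarSubalgebra →ₐ[ℂ] Module.End ℂ (hilbertSchmidt σ) :=
  AlgHom.ofLinearMap
    { toFun := fun x =>
        { toFun := fun T => ⟨(x : L2M G τ →L[ℂ] L2M G τ) * T,
            mul_mem (crossed_le_basic σ x.2) T.2.1, (mem_trace_iff _).2
              (lp.memℓp (l2sumMap G (x : L2M G τ →L[ℂ] L2M G τ) (emb σ T)))⟩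
          map_add' := fun _ _ => Subtype.ext (mul_add _ _ _)
          map_smul' := fun _ _ => Subtype.ext (mul_smul_comm _ _ _) }
      map_add' := fun _ _ => LinearMap.ext fun _ => Subtype.ext (add_mul _ _ _)
      map_smul' := fun _ _ => LinearMap.ext fun _ => Subtype.ext (smul_mul_assoc _ _ _) }
    (LinearMap.ext fun _ => Subtype.ext (one_mul _))
    (fun _ _ => LinearMap.ext fun _ => Subtype.ext (mul_assoc _ _ _))

lemma mulLeftHS_coe (σ : TraceAction G τ) (x : (crossedProduct σ).toStarSubalgebra)
    (T : hilbertSchmidt σ) : (mulLeftHS σ x T : L2M G τ →L[ℂ] L2M G τ) =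
      (x : L2M G τ →L[ℂ] L2M G τ) * T := rfl

/-- Right multiplication by an element of `M`. -/
noncomputable def mulRightHS (σ : TraceAction G τ) :
    ((crossedProduct σ).toStarSubalgebra)ᵐᵒᵖ →ₐ[ℂ] Module.End ℂ (hilbertSchmidt σ) :=
  AlgHom.ofLinearMap
    { toFun := fun y =>
        { toFun := fun T => ⟨(T : L2M G τ →L[ℂ] L2M G τ) * (y.unop : L2M G τ →L[ℂ] L2M G τ), by
            have h := (starHS σ (mulLeftHS σ (star y.unop) (starHS σ T))).2
            have h1 : (starHS σ (mulLeftHS σ (star y.unop) (starHS σ T)) :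
                L2M G τ →L[ℂ] L2M G τ) =
                (T : L2M G τ →L[ℂ] L2M G τ) * (y.unop : L2M G τ →L[ℂ] L2M G τ) := by
              change star (star (y.unop : L2M G τ →L[ℂ] L2M G τ) *
                star (T : L2M G τ →L[ℂ] L2M G τ)) = _
              rw [star_mul, star_star, star_star]
            rwa [h1] at h⟩
          map_add' := fun _ _ => Subtype.ext (add_mul _ _ _)
          map_smul' := fun _ _ => Subtype.ext (smul_mul_assoc _ _ _) }
      map_add' := fun _ _ => LinearMap.ext fun _ => Subtype.ext (mul_add _ _ _)
      map_smul' := fun _ _ => LinearMap.ext fun _ => Subtype.ext (mul_smul_comm _ _ _) }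
    (LinearMap.ext fun _ => Subtype.ext (mul_one _))
    (fun _ _ => LinearMap.ext fun _ => Subtype.ext (mul_assoc _ _ _).symm)

lemma mulRightHS_eq (σ : TraceAction G τ) (y : ((crossedProduct σ).toStarSubalgebra)ᵐᵒᵖ)
    (T : hilbertSchmidt σ) :
    mulRightHS σ y T = starHS σ (mulLeftHS σ (star y.unop) (starHS σ T)) := by
  refine Subtype.ext ?_
  change _ = star (star (y.unop : L2M G τ →L[ℂ] L2M G τ) * star (T : L2M G τ →L[ℂ] L2M G τ))
  rw [star_mul, star_star, star_star]
  rfl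

lemma starHS_starHS (σ : TraceAction G τ) (T : hilbertSchmidt σ) :
    starHS σ (starHS σ T) = T := Subtype.ext (star_star _)

lemma norm_mulLeftHS (σ : TraceAction G τ) (x : (crossedProduct σ).toStarSubalgebra)
    (T : hilbertSchmidt σ) :
    ‖embL2 σ (mulLeftHS σ x T)‖ ≤ ‖ampSum G (L2M G τ) x‖ * ‖embL2 σ T‖ :=
  (ampSum G (L2M G τ) x).le_opNorm (emb σ T)

lemma inner_mulLeftHS (σ : TraceAction G τ) (x : (crossedProduct σ).toStarSubalgebra)
    (S T : hilbertSchmidt σ) :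
    ⟪embL2 σ (mulLeftHS σ (star x) S), embL2 σ T⟫_ℂ = ⟪embL2 σ S, embL2 σ (mulLeftHS σ x T)⟫_ℂ := by
  rw [inner_embL2, inner_embL2]
  refine tsum_congr fun g => ?_
  change ⟪(star (x : L2M G τ →L[ℂ] L2M G τ)) ((S : L2M G τ →L[ℂ] L2M G τ) (vecU τ g)), _⟫_ℂ = _
  rw [ContinuousLinearMap.star_eq_adjoint, ContinuousLinearMap.adjoint_inner_left]
  rfl

lemma inner_mulRightHS (σ : TraceAction G τ) (y : ((crossedProduct σ).toStarSubalgebra)ᵐᵒᵖ)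
    (S T : hilbertSchmidt σ) :
    ⟪embL2 σ (mulRightHS σ (star y) S), embL2 σ T⟫_ℂ =
      ⟪embL2 σ S, embL2 σ (mulRightHS σ y T)⟫_ℂ := by
  have h1 := inner_starHS σ (mulLeftHS σ y.unop (starHS σ S)) (starHS σ T)
  have h2 := inner_starHS σ (starHS σ S) (mulLeftHS σ (star y.unop) (starHS σ T))
  rw [starHS_starHS] at h1 h2
  rw [mulRightHS_eq, mulRightHS_eq, MulOpposite.unop_star, star_star, h1, h2, inner_mulLeftHS]

lemma norm_mulRightHS (σ : TraceAction G τ) (y : ((crossedProduct σ).toStarSubalgebra)ᵐᵒᵖ)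
    (T : hilbertSchmidt σ) :
    ‖embL2 σ (mulRightHS σ y T)‖ ≤
      ‖ampSum G (L2M G τ) (star y.unop : (crossedProduct σ).toStarSubalgebra)‖ * ‖embL2 σ T‖ := by
  rw [mulRightHS_eq, norm_embL2_starHS, ← norm_embL2_starHS σ T]
  exact norm_mulLeftHS σ _ _

/-- The left action of `M` on `L²⟨M, A⟩`. -/
noncomputable def basicLeft (σ : TraceAction G τ) :
    (crossedProduct σ).toStarSubalgebra →⋆ₐ[ℂ] (L2Basic σ →L[ℂ] L2Basic σ) :=
  extRep (embL2 σ) (denseRange_embL2 σ) (mulLeftHS σ)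
    (fun x => ⟨_, norm_mulLeftHS σ x⟩) (inner_mulLeftHS σ)

/-- The right action of `M` on `L²⟨M, A⟩`. -/
noncomputable def basicRight (σ : TraceAction G τ) :
    ((crossedProduct σ).toStarSubalgebra)ᵐᵒᵖ →⋆ₐ[ℂ] (L2Basic σ →L[ℂ] L2Basic σ) :=
  extRep (embL2 σ) (denseRange_embL2 σ) (mulRightHS σ)
    (fun y => ⟨_, norm_mulRightHS σ y⟩) (inner_mulRightHS σ)

lemma basicLeft_apply (σ : TraceAction G τ) (x : (crossedProduct σ).toStarSubalgebra)
    (T : hilbertSchmidt σ) : basicLeft σ x (embL2 σ T) = embL2 σ (mulLeftHS σ x T) :=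
  extRep_apply _ _ _ _ _ _ _

lemma basicRight_apply (σ : TraceAction G τ) (y : ((crossedProduct σ).toStarSubalgebra)ᵐᵒᵖ)
    (T : hilbertSchmidt σ) : basicRight σ y (embL2 σ T) = embL2 σ (mulRightHS σ y T) :=
  extRep_apply _ _ _ _ _ _ _

/-- The `M`-bimodule `L²⟨M, A⟩`, with `x · T · y = x T y` for `T ∈ ⟨M, A⟩`, `Tr(T* T) < ∞`. -/
noncomputable def basicBimodule (σ : TraceAction G τ) :
    Bimodule (crossedProduct σ) (L2Basic σ) where
  left := basicLeft σ
  right := basicRight σ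
  left_right_comm x y ξ := by
    refine (denseRange_embL2 σ).induction_on ξ (isClosed_eq (by fun_prop) (by fun_prop))
      fun T => ?_
    rw [basicRight_apply, basicLeft_apply, basicLeft_apply, basicRight_apply]
    exact congrArg _ (Subtype.ext (mul_assoc _ _ _).symm)

end BasicConstruction

/-! ### The Gaussian construction -/

section Gaussian

variable {Y : Type*} [MeasurableSpace Y] {ν : Measure Y}

/-- The multiplication operator on `L²(Y, ν)` given by `f ∈ L^∞(Y, ν)`. -/
noncomputable def mulOp (f : Lp ℂ ∞ ν) : Lp ℂ 2 ν →L[ℂ] Lp ℂ 2 ν :=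
  (ContinuousLinearMap.mul ℂ ℂ).holderL ν ∞ 2 2 f

lemma coeFn_mulOp (f : Lp ℂ ∞ ν) (h : Lp ℂ 2 ν) : mulOp f h =ᵐ[ν] fun y => f y * h y :=
  ContinuousLinearMap.coeFn_holder _ f h

/-- The Gaussian construction for a real Hilbert space `V`: a family of unitaries
`ω(ξ) ∈ L^∞(Y, ν)`, for `ξ ∈ V`, with `ω(0) = 1`, `ω(ξ + η) = ω(ξ) ω(η)`, `ω(ξ)* = ω(-ξ)` and
`∫ ω(ξ) dν = exp(-‖ξ‖²)`, which generates `L^∞(Y, ν)` as a von Neumann algebra. -/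
structure GaussianConstruction (V : Type*) [NormedAddCommGroup V] [InnerProductSpace ℝ V]
    (ν : Measure Y) [IsProbabilityMeasure ν] where
  /-- The unitaries `ω(ξ)`. -/
  ω : V → Lp ℂ ∞ ν
  ω_zero : ω 0 =ᵐ[ν] fun _ => 1
  ω_add : ∀ ξ η, ω (ξ + η) =ᵐ[ν] fun y => ω ξ y * ω η y
  ω_neg : ∀ ξ, ω (-ξ) =ᵐ[ν] fun y => starRingEnd ℂ (ω ξ y)
  integral_ω : ∀ ξ, ∫ y, ω ξ y ∂ν = Real.exp (-‖ξ‖ ^ 2)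
  generates : ∀ f : Lp ℂ ∞ ν,
    mulOp f ∈ (vnGenerated (Set.range fun ξ => mulOp (ω ξ))).toStarSubalgebra

namespace GaussianConstruction

variable [IsProbabilityMeasure ν] {V : Type*} [NormedAddCommGroup V] [InnerProductSpace ℝ V]

/-- The constant function `1 ∈ L²(Y, ν)`. -/
noncomputable def one (ν : Measure Y) [IsProbabilityMeasure ν] : Lp ℂ 2 ν := Lp.const 2 ν 1

lemma coeFn_one : one ν =ᵐ[ν] fun _ => 1 := Lp.coeFn_const _ _ _

/-- The vector of `L²(Y, ν)` given by `ω(ξ)`. -/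
noncomputable def vec (Ω : GaussianConstruction V ν) (ξ : V) : Lp ℂ 2 ν := mulOp (Ω.ω ξ) (one ν)

variable (Ω : GaussianConstruction V ν)

lemma coeFn_vec (ξ : V) : Ω.vec ξ =ᵐ[ν] Ω.ω ξ := by
  filter_upwards [coeFn_mulOp (Ω.ω ξ) (one ν), coeFn_one (ν := ν)] with y h1 h2
  rw [vec, h1, h2, mul_one]

lemma vec_zero : Ω.vec 0 = one ν := by
  refine Lp.ext ?_
  filter_upwards [Ω.coeFn_vec 0, Ω.ω_zero, coeFn_one (ν := ν)] with y h1 h2 h3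
  rw [h1, h2, h3]

lemma inner_vec (ξ η : V) : ⟪Ω.vec ξ, Ω.vec η⟫_ℂ = Real.exp (-‖η - ξ‖ ^ 2) := by
  rw [← Ω.integral_ω, L2.inner_def]
  refine integral_congr_ae ?_
  filter_upwards [Ω.coeFn_vec ξ, Ω.coeFn_vec η, Ω.ω_add η (-ξ), Ω.ω_neg ξ] with y h1 h2 h3 h4
  rw [h1, h2, sub_eq_add_neg, h3, h4]
  simp

lemma mulOp_vec (ξ η : V) : mulOp (Ω.ω ξ) (Ω.vec η) = Ω.vec (ξ + η) := by
  refine Lp.ext ?_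
  filter_upwards [coeFn_mulOp (Ω.ω ξ) (Ω.vec η), Ω.coeFn_vec η, Ω.coeFn_vec (ξ + η),
    Ω.ω_add ξ η] with y h1 h2 h3 h4
  rw [h1, h2, h3, h4]

lemma star_mulOp (ξ : V) : star (mulOp (Ω.ω ξ)) = mulOp (Ω.ω (-ξ)) := by
  rw [ContinuousLinearMap.star_eq_adjoint, eq_comm, ContinuousLinearMap.eq_adjoint_iff]
  intro f g
  rw [L2.inner_def, L2.inner_def]
  refine integral_congr_ae ?_
  filter_upwards [coeFn_mulOp (Ω.ω (-ξ)) f, coeFn_mulOp (Ω.ω ξ) g, Ω.ω_neg ξ] with y h1 h2 h3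
  rw [h1, h2, h3]
  simp
  ring

/-- The linear map `∑ c_ξ ξ ↦ ∑ c_ξ ω(ξ)`. -/
noncomputable def lin : (V →₀ ℂ) →ₗ[ℂ] Lp ℂ 2 ν := Finsupp.linearCombination ℂ Ω.vec

lemma denseRange_lin : DenseRange Ω.lin := by
  set K := (LinearMap.range Ω.lin).topologicalClosure with hK
  have hvec : ∀ ξ, Ω.vec ξ ∈ K := fun ξ => Submodule.le_topologicalClosure _
    ⟨Finsupp.single ξ 1, by simp [lin]⟩
  have hmul : ∀ ξ, ∀ v ∈ K, mulOp (Ω.ω ξ) v ∈ K := by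
    intro ξ v hv
    have hle : K ≤ K.comap (mulOp (Ω.ω ξ)).toLinearMap := by
      refine Submodule.topologicalClosure_minimal _ ?_
        ((Submodule.isClosed_topologicalClosure _).preimage (mulOp (Ω.ω ξ)).continuous)
      rintro _ ⟨c, rfl⟩
      induction c using Finsupp.induction_linear with
      | zero => simp
      | add c d hc hd => rw [map_add]; exact Submodule.add_mem _ hc hd
      | single η a =>
        change mulOp (Ω.ω ξ) (Ω.lin (Finsupp.single η a)) ∈ K
        rw [lin, Finsupp.linearCombination_single, map_smul, mulOp_vec]
        exact K.smul_mem _ (hvec _)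
    exact hle hv
  have hcl : IsClosed (K : Set (Lp ℂ 2 ν)) := Submodule.isClosed_topologicalClosure _
  have : CompleteSpace K := hcl.completeSpace_coe
  have hcomm : ∀ ξ, mulOp (Ω.ω ξ) * K.starProjection = K.starProjection * mulOp (Ω.ω ξ) := by
    intro ξ
    ext1 v
    rw [mul_apply_eq_comp, mul_apply_eq_comp]
    refine (Submodule.eq_starProjection_of_mem_orthogonal
      (hmul ξ _ (Submodule.starProjection_apply_mem K v)) ?_).symm
    rw [← map_sub, Submodule.mem_orthogonal]
    intro u hu
    have h1 := ContinuousLinearMap.adjoint_inner_left (mulOp (Ω.ω ξ)) (v - K.starProjection v) u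
    rw [← h1, ← ContinuousLinearMap.star_eq_adjoint, star_mulOp]
    exact (Submodule.mem_orthogonal _ _).1 (Submodule.sub_starProjection_mem_orthogonal v) _
      (hmul _ _ hu)
  have hall : ∀ f : Lp ℂ ∞ ν, mulOp f (one ν) ∈ K := by
    intro f
    have h1 : mulOp f * K.starProjection = K.starProjection * mulOp f := by
      refine commute_of_mem_vnGenerated ?_ (Ω.generates f)
      rintro _ ⟨ξ, rfl⟩
      exact ⟨hcomm ξ, by simp only [star_mulOp]; exact hcomm _⟩
    have h2 := DFunLike.congr_fun h1 (one ν)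
    rw [mul_apply_eq_comp, mul_apply_eq_comp, Submodule.starProjection_eq_self_iff.2
      (by rw [← Ω.vec_zero]; exact hvec 0)] at h2
    rw [h2]
    exact Submodule.starProjection_apply_mem K _
  have htop : ∀ f : Lp ℂ 2 ν, f ∈ K := by
    intro f
    refine Lp.induction (by simp) (fun f => f ∈ K) ?_ ?_ hcl f
    · intro c s hs hμs
      rw [Lp.simpleFunc.coe_indicatorConst]
      convert hall (indicatorConstLp ∞ hs hμs.ne c) using 1
      refine Lp.ext ?_
      filter_upwards [coeFn_mulOp (indicatorConstLp ∞ hs hμs.ne c) (one ν), coeFn_one (ν := ν),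
        indicatorConstLp_coeFn (p := 2) (hs := hs) (hμs := hμs.ne) (c := c),
        indicatorConstLp_coeFn (p := ∞) (hs := hs) (hμs := hμs.ne) (c := c)] with y h1 h2 h3 h4
      rw [h1, h2, h3, h4, mul_one]
    · intro f g hf hg _ h1 h2
      exact K.add_mem h1 h2
  intro f
  exact htop f

lemma inner_lin (c d : V →₀ ℂ) : ⟪Ω.lin c, Ω.lin d⟫_ℂ =
    c.sum fun ξ a => d.sum fun η b => starRingEnd ℂ a * (b * Real.exp (-‖η - ξ‖ ^ 2)) := by
  simp only [lin, Finsupp.linearCombination_apply, Finsupp.sum, sum_inner]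
  refine Finset.sum_congr rfl fun ξ _ => ?_
  rw [inner_sum]
  refine Finset.sum_congr rfl fun η _ => ?_
  rw [inner_smul_left, inner_smul_right, inner_vec]

/-- The linear map `∑ c_ξ ξ ↦ ∑ c_ξ T(ξ)`. -/
noncomputable def relabel (T : V ≃ₗᵢ[ℝ] V) : (V →₀ ℂ) ≃ₗ[ℂ] (V →₀ ℂ) :=
  Finsupp.domLCongr (R := ℂ) T.toEquiv

lemma relabel_single (T : V ≃ₗᵢ[ℝ] V) (ξ : V) (a : ℂ) :
    relabel T (Finsupp.single ξ a) = Finsupp.single (T ξ) a :=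
  Finsupp.domLCongr_single _ _ _

lemma norm_lin_relabel (T : V ≃ₗᵢ[ℝ] V) (c : V →₀ ℂ) : ‖Ω.lin (relabel T c)‖ = ‖Ω.lin c‖ := by
  have hs : ∀ (c : V →₀ ℂ) (f : V → ℂ → ℂ),
      (relabel T c).sum f = c.sum fun ξ a => f (T ξ) a := fun c f =>
    Finset.sum_map _ _ _ |>.trans (Finset.sum_congr rfl fun ξ _ => by
      change f (T ξ) (c (T.symm (T ξ))) = _
      rw [LinearIsometryEquiv.symm_apply_apply])
  have h : ⟪Ω.lin (relabel T c), Ω.lin (relabel T c)⟫_ℂ = ⟪Ω.lin c, Ω.lin c⟫_ℂ := by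
    rw [inner_lin, inner_lin, hs]
    simp only [hs, ← map_sub, LinearIsometryEquiv.norm_map]
  rw [inner_self_eq_norm_sq_to_K, inner_self_eq_norm_sq_to_K] at h
  exact (sq_eq_sq₀ (norm_nonneg _) (norm_nonneg _)).1 (by exact_mod_cast h)

/-- The Koopman unitary `ω(ξ) ↦ ω(T ξ)` of `L²(Y, ν)`, for an orthogonal operator `T`. -/
noncomputable def koopmanUnitary (T : V ≃ₗᵢ[ℝ] V) : Lp ℂ 2 ν ≃ₗᵢ[ℂ] Lp ℂ 2 ν :=
  (relabel T).extendOfIsometry Ω.lin Ω.lin Ω.denseRange_lin Ω.denseRange_lin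
    (Ω.norm_lin_relabel T)

lemma koopmanUnitary_lin (T : V ≃ₗᵢ[ℝ] V) (c : V →₀ ℂ) :
    Ω.koopmanUnitary T (Ω.lin c) = Ω.lin (relabel T c) :=
  LinearEquiv.extendOfIsometry_eq _ _ _ _ _ _ _

lemma koopmanUnitary_vec (T : V ≃ₗᵢ[ℝ] V) (ξ : V) :
    Ω.koopmanUnitary T (Ω.vec ξ) = Ω.vec (T ξ) := by
  have h := Ω.koopmanUnitary_lin T (Finsupp.single ξ 1)
  rw [relabel_single] at h
  simpa only [lin, Finsupp.linearCombination_single, one_smul] using h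

lemma ext_vec {S T : Lp ℂ 2 ν ≃ₗᵢ[ℂ] Lp ℂ 2 ν} (h : ∀ ξ, S (Ω.vec ξ) = T (Ω.vec ξ)) : S = T := by
  ext1 v
  refine Ω.denseRange_lin.induction_on v (isClosed_eq (by fun_prop) (by fun_prop)) fun c => ?_
  induction c using Finsupp.induction_linear with
  | zero => simp
  | add c d hc hd => simp only [map_add, hc, hd]
  | single η a => simp [lin, h]

variable {Γ : Type*} [Group Γ]

/-- The Koopman representation on `L²(Y, ν)` of the Gaussian action associated with an orthogonal
representation `π`, given by `ω(ξ) ↦ ω(π_g(ξ))`. -/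
noncomputable def koopman (π : Γ →* (V ≃ₗᵢ[ℝ] V)) : Γ →* (Lp ℂ 2 ν ≃ₗᵢ[ℂ] Lp ℂ 2 ν) where
  toFun g := Ω.koopmanUnitary (π g)
  map_one' := Ω.ext_vec fun ξ => by rw [koopmanUnitary_vec, map_one]; rfl
  map_mul' g h := Ω.ext_vec fun ξ => by
    rw [koopmanUnitary_vec, map_mul]
    change _ = Ω.koopmanUnitary (π g) (Ω.koopmanUnitary (π h) (Ω.vec ξ))
    rw [koopmanUnitary_vec, koopmanUnitary_vec]
    rfl

lemma koopman_vec (π : Γ →* (V ≃ₗᵢ[ℝ] V)) (g : Γ) (ξ : V) :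
    Ω.koopman π g (Ω.vec ξ) = Ω.vec (π g ξ) := Ω.koopmanUnitary_vec _ _

/-- The Hilbert space `L²₀(Y, ν) = L²(Y, ν) ⊖ ℂ1`. -/
abbrev L20 (ν : Measure Y) [IsProbabilityMeasure ν] : Type _ := (ℂ ∙ one ν)ᗮ

lemma koopman_mem (π : Γ →* (V ≃ₗᵢ[ℝ] V)) (g : Γ) {v : Lp ℂ 2 ν} (hv : v ∈ (ℂ ∙ one ν)ᗮ) :
    Ω.koopman π g v ∈ (ℂ ∙ one ν)ᗮ := by
  rw [Submodule.mem_orthogonal_singleton_iff_inner_right] at hv ⊢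
  have h : Ω.koopman π g (one ν) = one ν := by
    rw [← Ω.vec_zero, koopman_vec, map_zero]
  rw [← h, LinearIsometryEquiv.inner_map_map, hv]

/-- The Koopman representation on `L²₀(Y, ν)`. -/
noncomputable def koopman₀ (π : Γ →* (V ≃ₗᵢ[ℝ] V)) : Γ →* (L20 ν ≃ₗᵢ[ℂ] L20 ν) where
  toFun g :=
    { toFun := fun v => ⟨Ω.koopman π g v, Ω.koopman_mem π g v.2⟩
      invFun := fun v => ⟨Ω.koopman π g⁻¹ v, Ω.koopman_mem π g⁻¹ v.2⟩
      map_add' := fun v w => Subtype.ext (map_add (Ω.koopman π g) (v : Lp ℂ 2 ν) w)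
      map_smul' := fun c v => Subtype.ext (map_smul (Ω.koopman π g) c (v : Lp ℂ 2 ν))
      left_inv := fun v => Subtype.ext (by
        change (Ω.koopman π g⁻¹ * Ω.koopman π g) (v : Lp ℂ 2 ν) = v
        rw [← map_mul, inv_mul_cancel, map_one]; rfl)
      right_inv := fun v => Subtype.ext (by
        change (Ω.koopman π g * Ω.koopman π g⁻¹) (v : Lp ℂ 2 ν) = v
        rw [← map_mul, mul_inv_cancel, map_one]; rfl)
      norm_map' := fun v => (Ω.koopman π g).norm_map (v : Lp ℂ 2 ν) }
  map_one' := LinearIsometryEquiv.ext fun v => Subtype.ext (by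
    change Ω.koopman π 1 (v : Lp ℂ 2 ν) = v
    rw [map_one]; rfl)
  map_mul' g h := LinearIsometryEquiv.ext fun v => Subtype.ext (by
    change Ω.koopman π (g * h) (v : Lp ℂ 2 ν) = (Ω.koopman π g * Ω.koopman π h) v
    rw [map_mul])

lemma koopman₀_coe (π : Γ →* (V ≃ₗᵢ[ℝ] V)) (g : Γ) (v : L20 ν) :
    (Ω.koopman₀ π g v : Lp ℂ 2 ν) = Ω.koopman π g v := rfl

end GaussianConstruction

end Gaussian

/-! ### Orthogonal representations -/

section Orthogonal

variable {Γ : Type*} [Group Γ]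
  {V : Type*} [NormedAddCommGroup V] [InnerProductSpace ℝ V]
  {W : Type*} [NormedAddCommGroup W] [InnerProductSpace ℝ W]

/-- The real left regular representation `δ_h ↦ δ_{gh}` on `ℓ²(Γ; ℝ)`. -/
noncomputable def regularRep (Γ : Type*) [Group Γ] : Γ →* (L2Sum Γ ℝ ≃ₗᵢ[ℝ] L2Sum Γ ℝ) where
  toFun g := l2sumCongr (Equiv.mulLeft g⁻¹) (fun _ => LinearIsometryEquiv.refl ℝ ℝ)
  map_one' := by
    ext f h
    change f (1⁻¹ * h) = f h
    simp
  map_mul' g g' := by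
    ext f h
    change f ((g * g')⁻¹ * h) = f (g'⁻¹ * (g⁻¹ * h))
    simp [mul_assoc]

/-- Weak containment of orthogonal representations: every coefficient `g ↦ ⟨ξ, π_g ξ⟩` can be
approximated, on finite subsets of `Γ`, by finite sums of coefficients of `ρ`. -/
def OrthWeaklyContained (π : Γ →* (V ≃ₗᵢ[ℝ] V)) (ρ : Γ →* (W ≃ₗᵢ[ℝ] W)) : Prop :=
  ∀ (ξ : V) (F : Finset Γ) (ε : ℝ), 0 < ε → ∃ (n : ℕ) (η : Fin n → W), ∀ g ∈ F,
    |⟪ξ, π g ξ⟫_ℝ - ∑ i, ⟪η i, ρ g (η i)⟫_ℝ| < ε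

/-- Orthogonal equivalence of orthogonal representations. -/
def OrthEquivalent (π : Γ →* (V ≃ₗᵢ[ℝ] V)) (ρ : Γ →* (W ≃ₗᵢ[ℝ] W)) : Prop :=
  ∃ T : V ≃ₗᵢ[ℝ] W, ∀ g v, T (π g v) = ρ g (T v)

/-- The tensor product representation `(g₁, g₂) ↦ κ₁(g₁) ⊗ κ₂(g₂)` of a product group. -/
noncomputable def prodRep {Γ₁ Γ₂ P₁ P₂ : Type*} [Group Γ₁] [Group Γ₂]
    [NormedAddCommGroup P₁] [InnerProductSpace ℂ P₁] [NormedAddCommGroup P₂]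
    [InnerProductSpace ℂ P₂] (κ₁ : Γ₁ →* (P₁ ≃ₗᵢ[ℂ] P₁)) (κ₂ : Γ₂ →* (P₂ ≃ₗᵢ[ℂ] P₂)) :
    Γ₁ × Γ₂ →* (HTensor P₁ P₂ ≃ₗᵢ[ℂ] HTensor P₁ P₂) where
  toFun g := hunitary (κ₁ g.1) (κ₂ g.2)
  map_one' := by
    ext z
    refine htensor_induction (p := fun z => hunitary (κ₁ 1) (κ₂ 1) z = z) z
      (isClosed_eq (by fun_prop) (by fun_prop)) (by simp) (fun x y => ?_) fun u v hu hv => ?_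
    · rw [hunitary_htmul, map_one, map_one]; rfl
    · rw [map_add, hu, hv]
  map_mul' g h := by
    ext z
    refine htensor_induction (p := fun z => hunitary (κ₁ (g * h).1) (κ₂ (g * h).2) z =
      hunitary (κ₁ g.1) (κ₂ g.2) (hunitary (κ₁ h.1) (κ₂ h.2) z)) z
      (isClosed_eq (by fun_prop) (by fun_prop)) (by simp) (fun x y => ?_) fun u v hu hv => ?_
    · rw [hunitary_htmul, hunitary_htmul, hunitary_htmul, Prod.fst_mul, Prod.snd_mul, map_mul,
        map_mul]
      rfl
    · simp only [map_add, hu, hv]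

end Orthogonal

/-! ### The bimodule `L²(A) ⊗ L²₀(Y₁) ⊗ L²₀(Y₂) ⊗ ℓ²(Γ₁ × Γ₂)` -/

open GaussianConstruction in
/-- The `M`-bimodule `K = L²(A) ⊗ L²₀(Y₁) ⊗ L²₀(Y₂) ⊗ ℓ²(Γ₁ × Γ₂)`, with
`(a u_g) · (ξ ⊗ ξ₁ ⊗ ξ₂ ⊗ δ_k) · (b u_h) = a σ_g(ξ) σ_{gk}(b) ⊗ π_g(ξ₁ ⊗ ξ₂) ⊗ δ_{gkh}`. -/
noncomputable def gaussianBimodule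
    {A : Type*} [CommCStarAlgebra A] [PartialOrder A] [StarOrderedRing A] {τ : A →ₚ[ℂ] ℂ}
    {Γ₁ Γ₂ : Type*} [Group Γ₁] [Group Γ₂] (σ : TraceAction (Γ₁ × Γ₂) τ)
    {V₁ V₂ : Type*} [NormedAddCommGroup V₁] [InnerProductSpace ℝ V₁]
    [NormedAddCommGroup V₂] [InnerProductSpace ℝ V₂]
    {Y₁ Y₂ : Type*} [MeasurableSpace Y₁] [MeasurableSpace Y₂]
    {ν₁ : Measure Y₁} [IsProbabilityMeasure ν₁] {ν₂ : Measure Y₂} [IsProbabilityMeasure ν₂]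
    (Ω₁ : GaussianConstruction V₁ ν₁) (π₁ : Γ₁ →* (V₁ ≃ₗᵢ[ℝ] V₁))
    (Ω₂ : GaussianConstruction V₂ ν₂) (π₂ : Γ₂ →* (V₂ ≃ₗᵢ[ℝ] V₂)) :
    Bimodule (crossedProduct σ)
      (L2Sum (Γ₁ × Γ₂) (HTensor (L2A τ) (HTensor (L20 ν₁) (L20 ν₂)))) :=
  repBimodule σ (prodRep (Ω₁.koopman₀ π₁) (Ω₂.koopman₀ π₂))

end FellAbsorption

open FellAbsorption

/-! Write E for the conditional expectation of M onto A. Everything reduces to the single function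
(x, y) ↦ τ(E(x)E(y)), which is `coefTerm σ 1`. It is the coefficient of the cyclic vector e_A of
L²⟨M, A⟩ (`inner_jonesHS`, `total_jonesHS`). For a unitary representation ρ of G on P, the vectors 1
⊗ p ⊗ δ_1, with p in a total family, generate the bimodule L²(A) ⊗ P ⊗ ℓ²(G). Their coefficients are
the sums over g of `coefTerm σ g x y` times ⟨p, ρ_g q⟩ (`inner_repVec`), so ρ enters only through
its matrix coefficients. If the translates ρ_g p_i form an orthonormal basis of P, only g = 1
survives and the bimodule is a multiple of L²⟨M, A⟩ (`repBimodule_isomorphic_multiple`). This is the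
absorption principle.

On the Gaussian side, the vectors exp(‖ξ‖²)ω(ξ) - 1 are total in L²₀(Y), are permuted by the Koopman
representation, and have inner products exp(2⟨ξ, η⟩) - 1 (`inner_expVec`). This power series has
nonnegative coefficients and no constant term, so only tensor powers π^{⊗k} with k ≥ 1 are involved.

For the isomorphism, let π be the regular representation. The series embeds L²₀(Y) into the positive
part of the full Fock space of ℓ²(Γ). Its basis, the nonempty words in Γ, is a free Γ-set, so the
target is a multiple of the regular representation. (On unordered words, the basis of the symmetric
Fock space, translation can have fixed points; since only an embedding is needed, they never
appear.) Conversely, the vectors attached to the multiples of δ_1 are linearly independent and have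
mutually orthogonal translates, so an infinite multiple of the regular representation embeds into
L²₀(Y). A Cantor–Bernstein argument for unitary representations (`exists_unitary_intertwiner`) then
yields a basis permuted freely by Γ, and tensoring the bases for Γ₁ and Γ₂ gives one for Γ₁ × Γ₂.

For weak containment, let `regCone` be the pointwise closure of the finite sums of matrix
coefficients, over tuples of vectors, of the regular representation. It is stable under sums,
products and nonnegative multiples, hence under φ ↦ exp(2φ) - 1. The hypothesis, stated for single
vectors, is upgraded to tuples by splitting off cyclic subspaces (`orthCoef_mem_regCone`), so the
Gaussian coefficients lie in the cone. Bimodule coefficients depend continuously enough on group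
coefficients (`tupleCoef_mem`) to conclude weak containment in every bimodule whose coefficients
approximate τ(E(x)E(y)). For L²⟨M, A⟩ this is immediate. For the coarse bimodule it holds because A
is abelian: a fine partition of unity approximates L²(A) by pieces of rank one
(`coefTerm_mem_coarse`). -/

namespace FellAbsorption

/-! ### Total families in Hilbert spaces -/

section Total

variable {ι κ E F : Type*} [NormedAddCommGroup E] [InnerProductSpace ℂ E]
  [NormedAddCommGroup F] [InnerProductSpace ℂ F]

/-- A family of vectors is total if only the zero vector is orthogonal to all its members. -/
def Total (v : ι → E) : Prop := ∀ x, (∀ i, ⟪v i, x⟫_ℂ = 0) → x = 0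

lemma Total.topologicalClosure_span [CompleteSpace E] {v : ι → E} (hv : Total v) :
    (Submodule.span ℂ (Set.range v)).topologicalClosure = ⊤ := by
  rw [Submodule.topologicalClosure_eq_top_iff, Submodule.eq_bot_iff]
  intro x hx
  exact hv x fun i => (Submodule.mem_orthogonal _ _).1 hx _ (Submodule.subset_span ⟨i, rfl⟩)

/-- A closed property, stable under linear combinations, which holds for a total family holds. -/
lemma Total.induction [CompleteSpace E] {v : ι → E} (hv : Total v) {p : E → Prop} (x : E)
    (hc : IsClosed {x | p x}) (h0 : p 0) (ha : ∀ x y, p x → p y → p (x + y))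
    (hs : ∀ (c : ℂ) x, p x → p (c • x)) (h : ∀ i, p (v i)) : p x := by
  let S : Submodule ℂ E :=
    { carrier := {x | p x}, add_mem' := fun hx hy => ha _ _ hx hy, zero_mem' := h0
      smul_mem' := fun c _ hx => hs c _ hx }
  have h1 : (Submodule.span ℂ (Set.range v)).topologicalClosure ≤ S :=
    Submodule.topologicalClosure_minimal _
      (Submodule.span_le.2 (by rintro _ ⟨i, rfl⟩; exact h i)) hc
  rw [hv.topologicalClosure_span] at h1
  exact h1 (Submodule.mem_top (x := x))

lemma Total.denseRange [CompleteSpace E] {v : ι → E} (hv : Total v) :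
    DenseRange (Finsupp.linearCombination ℂ v) := by
  have h := hv.topologicalClosure_span
  rw [← Finsupp.range_linearCombination] at h
  exact (Submodule.dense_iff_topologicalClosure_eq_top).2 h

/-- Bounded operators that agree on a total family are equal. -/
lemma Total.ext [CompleteSpace E] {W : Type*} [NormedAddCommGroup W] [NormedSpace ℂ W] {v : ι → E}
    (hv : Total v) {S T : E →L[ℂ] W} (h : ∀ i, S (v i) = T (v i)) : S = T := by
  ext x
  refine hv.induction x (isClosed_eq S.continuous T.continuous) (by simp) ?_ ?_ h
  · intro x y hx hy
    simp [hx, hy]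
  · intro c x hx
    simp [hx]

lemma total_of_denseRange {v : ι → E} (hv : DenseRange v) : Total v := by
  intro x hx
  refine (inner_self_eq_zero (𝕜 := ℂ)).1 ?_
  exact hv.induction_on (p := fun y => ⟪y, x⟫_ℂ = 0) x
    (isClosed_eq (by fun_prop) (by fun_prop)) hx

lemma Total.comp_surjective {v : ι → E} (hv : Total v) {f : κ → ι} (hf : Function.Surjective f) :
    Total (fun k => v (f k)) := fun x hx => hv x fun i => by
  obtain ⟨k, rfl⟩ := hf i
  exact hx k

lemma Total.map {v : ι → E} (hv : Total v) (U : E ≃ₗᵢ[ℂ] F) : Total (fun i => U (v i)) :=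
  fun x hx => by
    have h := hv (U.symm x) fun i => by
      rw [← U.inner_map_map, U.apply_symm_apply]
      exact hx i
    simpa using h

lemma Total.htmul [CompleteSpace E] [CompleteSpace F] {v : ι → E} {w : κ → F} (hv : Total v)
    (hw : Total w) : Total (fun i : ι × κ => htmul (v i.1) (w i.2)) := by
  intro z hz
  have h1 : ∀ (x : E) (y : F), ⟪FellAbsorption.htmul x y, z⟫_ℂ = 0 := by
    intro x y
    refine hv.induction (p := fun x => ⟪FellAbsorption.htmul x y, z⟫_ℂ = 0) x
      (isClosed_eq (by unfold FellAbsorption.htmul; fun_prop) (by fun_prop)) (by simp)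
      (fun x x' hx hx' => by rw [add_htmul, inner_add_left, hx, hx', add_zero])
      (fun c x hx => by rw [smul_htmul, inner_smul_left, hx, mul_zero]) fun i => ?_
    exact hw.induction (p := fun y => ⟪FellAbsorption.htmul (v i) y, z⟫_ℂ = 0) y
      (isClosed_eq (by unfold FellAbsorption.htmul; fun_prop) (by fun_prop)) (by simp)
      (fun y y' hy hy' => by rw [htmul_add, inner_add_left, hy, hy', add_zero])
      (fun c y hy => by rw [htmul_smul, inner_smul_left, hy, mul_zero]) fun j => hz (i, j)
  exact htensor_ext_inner fun x y => by rw [h1, inner_zero_right]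

open scoped Classical in
lemma Total.single {v : κ → E} (hv : Total v) :
    Total (fun i : ι × κ => (lp.single 2 i.1 (v i.2) : L2Sum ι E)) := by
  intro x hx
  ext i
  refine hv (x i) fun k => ?_
  have := hx (i, k)
  rwa [lp.inner_single_left] at this

/-- Families with the same Gram matrix, the first one total, are related by an isometry. -/
lemma exists_isometry_of_inner_eq [CompleteSpace E] [CompleteSpace F] {v : ι → E} {w : ι → F}
    (hv : Total v) (h : ∀ i j, ⟪v i, v j⟫_ℂ = ⟪w i, w j⟫_ℂ) :
    ∃ U : E →ₗᵢ[ℂ] F, ∀ i, U (v i) = w i := by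
  -- On the free vector space over `ι` both families extend without a well-definedness question.
  -- Equal Gram matrices give equal norms, so `f` factors through the dense range of `e`.
  set e := Finsupp.linearCombination ℂ v
  set f := Finsupp.linearCombination ℂ w
  have hin : ∀ c d, ⟪e c, e d⟫_ℂ = ⟪f c, f d⟫_ℂ := fun c d => by
    simp only [e, f, Finsupp.linearCombination_apply, Finsupp.sum, sum_inner, inner_sum,
      inner_smul_left, inner_smul_right, h]
  have hn : ∀ c, ‖f c‖ = ‖e c‖ := fun c => by
    rw [@norm_eq_sqrt_re_inner ℂ, @norm_eq_sqrt_re_inner ℂ, hin]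
  have hb : ∃ C : ℝ, ∀ c, ‖f c‖ ≤ C * ‖e c‖ := ⟨1, fun c => by rw [hn, one_mul]⟩
  have happ : ∀ c, f.extendOfNorm e (e c) = f c := fun c =>
    LinearMap.extendOfNorm_eq (f := f) hv.denseRange hb c
  refine ⟨{ (f.extendOfNorm e).toLinearMap with
    norm_map' := fun x => ?_ }, fun i => ?_⟩
  · change ‖f.extendOfNorm e x‖ = ‖x‖
    refine hv.denseRange.induction_on x (isClosed_eq (by fun_prop) (by fun_prop)) fun c => ?_
    rw [happ, hn]
  · change f.extendOfNorm e (v i) = w i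
    have := happ (Finsupp.single i 1)
    simpa [e, f] using this

/-- The range of an isometry defined on a complete space is closed, and totality makes it dense. -/
lemma surjective_of_total [CompleteSpace E] [CompleteSpace F] (U : E →ₗᵢ[ℂ] F)
    (h : Total (fun x => U x)) : Function.Surjective U := by
  have hcl : IsClosed (LinearMap.range U.toLinearMap : Set F) :=
    U.isometry.isClosedEmbedding.isClosed_range
  have h1 := h.topologicalClosure_span
  have h2 : Submodule.span ℂ (Set.range fun x => U x) = LinearMap.range U.toLinearMap := by
    refine le_antisymm (Submodule.span_le.2 ?_) ?_
    · rintro _ ⟨x, rfl⟩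
      exact ⟨x, rfl⟩
    · rintro _ ⟨x, rfl⟩
      exact Submodule.subset_span ⟨x, rfl⟩
  rw [h2, IsClosed.submodule_topologicalClosure_eq hcl] at h1
  intro y
  have : y ∈ LinearMap.range U.toLinearMap := h1 ▸ Submodule.mem_top
  exact this

lemma Total.mono {v : ι → E} {w : κ → E} (hv : Total v) (h : ∀ i, ∃ k, w k = v i) : Total w :=
  fun x hx => hv x fun i => by
    obtain ⟨k, hk⟩ := h i
    rw [← hk]
    exact hx k

/-- Total families with the same Gram matrix are related by a unitary. -/
lemma exists_unitary_of_inner_eq [CompleteSpace E] [CompleteSpace F] {v : ι → E} {w : ι → F}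
    (hv : Total v) (hw : Total w) (h : ∀ i j, ⟪v i, v j⟫_ℂ = ⟪w i, w j⟫_ℂ) :
    ∃ U : E ≃ₗᵢ[ℂ] F, ∀ i, U (v i) = w i := by
  obtain ⟨U, hU⟩ := exists_isometry_of_inner_eq hv h
  exact ⟨LinearIsometryEquiv.ofSurjective U
    (surjective_of_total U (hw.mono fun i => ⟨v i, hU i⟩)), hU⟩

end Total

/-! ### The Cantor–Bernstein theorem for unitary representations -/

section CantorBernstein

variable {G P Q : Type*} [Group G] [NormedAddCommGroup P] [InnerProductSpace ℂ P] [CompleteSpace P]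
  [NormedAddCommGroup Q] [InnerProductSpace ℂ Q] [CompleteSpace Q]

/-- If `K` is a closed subspace with `T K ⊆ K` and `(W Q)ᗮ ⊆ K`, where `T = W V`, and the only
vector of `K` orthogonal to `T K` and `(W Q)ᗮ` is zero, then `V` on `K` and `W*` on `Kᗮ` combine to
a unitary. -/
lemma exists_unitary_of_isometries (V : P →ₗᵢ[ℂ] Q) (W : Q →ₗᵢ[ℂ] P) (K : Submodule ℂ P)
    [K.HasOrthogonalProjection]
    (hT : ∀ x ∈ K, W (V x) ∈ K) (hW : ∀ x, (∀ q, ⟪W q, x⟫_ℂ = 0) → x ∈ K)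
    (hK : ∀ x ∈ K, (∀ y ∈ K, ⟪W (V y), x⟫_ℂ = 0) →
      (∀ y, (∀ q, ⟪W q, y⟫_ℂ = 0) → ⟪y, x⟫_ℂ = 0) → x = 0) :
    ∃ U : P ≃ₗᵢ[ℂ] Q, ∀ x, U x = V (K.starProjection x) +
      ContinuousLinearMap.adjoint W.toContinuousLinearMap (x - K.starProjection x) := by
  set W' := ContinuousLinearMap.adjoint W.toContinuousLinearMap with hW'
  have hadj : ∀ x q, ⟪W' x, q⟫_ℂ = ⟪x, W q⟫_ℂ := fun x q =>
    ContinuousLinearMap.adjoint_inner_left W.toContinuousLinearMap q x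
  have hW'W : ∀ q, W' (W q) = q := fun q => by
    refine ext_inner_right ℂ fun q' => ?_
    rw [hadj, LinearIsometry.inner_map_map]
  -- The defect W W* x - x is orthogonal to the range of W, hence lies in K; being orthogonal both
  -- to W W* x and to x, it is orthogonal to itself.
  have hWW' : ∀ x ∈ Kᗮ, W (W' x) = x := by
    intro x hx
    have hd : ∀ q, ⟪W q, W (W' x) - x⟫_ℂ = 0 := fun q => by
      rw [inner_sub_right, LinearIsometry.inner_map_map, sub_eq_zero, ← inner_conj_symm, hadj,
        inner_conj_symm]
    have h2 : ⟪W (W' x) - x, W (W' x) - x⟫_ℂ = 0 := by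
      rw [inner_sub_left, hd, (Submodule.mem_orthogonal' _ _).1 hx _ (hW _ hd), sub_zero]
    exact sub_eq_zero.1 (inner_self_eq_zero.1 h2)
  have hp : ∀ x, K.starProjection x ∈ K := fun x => Submodule.starProjection_apply_mem K x
  have hr : ∀ x, x - K.starProjection x ∈ Kᗮ := fun x =>
    Submodule.sub_starProjection_mem_orthogonal x
  let U₀ : P →L[ℂ] Q := V.toContinuousLinearMap.comp K.starProjection +
    W'.comp (ContinuousLinearMap.id ℂ P - K.starProjection)
  have hU₀ : ∀ x, U₀ x = V (K.starProjection x) + W' (x - K.starProjection x) := fun _ => rfl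
  -- Pythagoras on both sides: the two summands of `U₀ x` are orthogonal because W V maps K into K.
  have hn : ∀ x, ‖U₀ x‖ = ‖x‖ := by
    intro x
    have e1 : ⟪V (K.starProjection x), W' (x - K.starProjection x)⟫_ℂ = 0 := by
      rw [← inner_conj_symm, hadj, (Submodule.mem_orthogonal' _ _).1 (hr x) _ (hT _ (hp x)),
        map_zero]
    have e2 : ⟪K.starProjection x, x - K.starProjection x⟫_ℂ = 0 :=
      (Submodule.mem_orthogonal _ _).1 (hr x) _ (hp x)
    have e3 := norm_add_sq_eq_norm_sq_add_norm_sq_of_inner_eq_zero _ _ e1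
    have e4 := norm_add_sq_eq_norm_sq_add_norm_sq_of_inner_eq_zero _ _ e2
    have e5 : ‖W' (x - K.starProjection x)‖ = ‖x - K.starProjection x‖ := by
      rw [← W.norm_map, hWW' _ (hr x)]
    rw [← hU₀, V.norm_map, e5, ← e4, add_sub_cancel] at e3
    exact (mul_self_inj (norm_nonneg _) (norm_nonneg _)).1 e3
  let U₁ : P →ₗᵢ[ℂ] Q := { U₀.toLinearMap with norm_map' := hn }
  have hU₁ : ∀ x, U₁ x = V (K.starProjection x) + W' (x - K.starProjection x) := fun _ => rfl
  -- If q is orthogonal to the range, then W q is orthogonal to Kᗮ, so it lies in K. It is also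
  -- orthogonal to T K and to (W Q)ᗮ, hence zero.
  refine ⟨LinearIsometryEquiv.ofSurjective U₁ (surjective_of_total U₁ fun q hq => ?_), hU₁⟩
  have h1 : ∀ y ∈ K, U₁ y = V y := fun y hy => by
    rw [hU₁, Submodule.starProjection_eq_self_iff.2 hy, sub_self, map_zero, add_zero]
  have h2 : ∀ y ∈ Kᗮ, U₁ y = W' y := fun y hy => by
    rw [hU₁, (Submodule.starProjection_apply_eq_zero_iff K).2 hy, map_zero, sub_zero, zero_add]
  have h3 : W q ∈ K := by
    rw [← Submodule.orthogonal_orthogonal K, Submodule.mem_orthogonal]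
    intro y hy
    rw [← hadj, ← h2 y hy]
    exact hq y
  have h4 : W q = 0 := hK _ h3
    (fun y hy => by rw [LinearIsometry.inner_map_map, ← h1 y hy]; exact hq y)
    (fun y hy => by rw [← inner_conj_symm, hy, map_zero])
  exact (map_eq_zero_iff W W.injective).1 h4

/-- Unitary representations which embed in each other are unitarily equivalent. -/
theorem exists_unitary_intertwiner {κ : G →* (P ≃ₗᵢ[ℂ] P)} {ρ : G →* (Q ≃ₗᵢ[ℂ] Q)}
    (V : P →ₗᵢ[ℂ] Q) (hV : ∀ g x, V (κ g x) = ρ g (V x))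
    (W : Q →ₗᵢ[ℂ] P) (hW : ∀ g x, W (ρ g x) = κ g (W x)) :
    ∃ U : P ≃ₗᵢ[ℂ] Q, ∀ g x, U (κ g x) = ρ g (U x) := by
  -- As in the set-theoretic Cantor–Bernstein proof: N is the complement of the image of W, and K
  -- below is the closed span of the sets Tⁿ N with T = W V. Both are invariant under κ, so the
  -- unitary glued from V on K and W* on Kᗮ intertwines.
  let N : Set P := {y | ∀ q, ⟪W q, y⟫_ℂ = 0}
  let T : P → P := fun x => W (V x)
  have hTκ : ∀ n g x, T^[n] (κ g x) = κ g (T^[n] x) := by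
    intro n g
    induction n with
    | zero => intro x; rfl
    | succ n ih => intro x; rw [Function.iterate_succ_apply, Function.iterate_succ_apply, ← ih]; simp only [T, hV, hW]
  let v : ℕ × N → P := fun i => T^[i.1] i.2
  let K : Submodule ℂ P := (Submodule.span ℂ (Set.range v)).topologicalClosure
  have hcl : IsClosed (K : Set P) := Submodule.isClosed_topologicalClosure _
  have : CompleteSpace K := hcl.completeSpace_coe
  have hvK : ∀ i, v i ∈ K := fun i =>
    Submodule.le_topologicalClosure _ (Submodule.subset_span ⟨i, rfl⟩)
  have hmap : ∀ S : P →L[ℂ] P, (∀ i, S (v i) ∈ K) → ∀ x ∈ K, S x ∈ K := fun S hS x hx => by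
    have hle : K ≤ K.comap S.toLinearMap := Submodule.topologicalClosure_minimal _
      (Submodule.span_le.2 (by rintro _ ⟨i, rfl⟩; exact hS i)) (hcl.preimage S.continuous)
    exact hle hx
  have hinv : ∀ g x, ⟪x, κ g (κ g⁻¹ x)⟫_ℂ = ⟪x, x⟫_ℂ ∧ κ g (κ g⁻¹ x) = x := fun g x => by
    have h : κ g (κ g⁻¹ x) = x := by
      change (κ g * κ g⁻¹) x = x
      rw [← map_mul, mul_inv_cancel, map_one]
      rfl
    exact ⟨by rw [h], h⟩
  have hκK : ∀ g, ∀ x ∈ K, κ g x ∈ K := fun g => by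
    refine hmap (κ g : P →L[ℂ] P) fun i => ?_
    have h1 : κ g (i.2 : P) ∈ N := fun q => by
      have h2 := i.2.2 (ρ g⁻¹ q)
      rwa [hW, ← LinearIsometryEquiv.inner_map_map (κ g), (hinv g _).2] at h2
    have h3 := hvK (i.1, ⟨_, h1⟩)
    simp only [v, hTκ] at h3
    exact h3
  have hκproj : ∀ g x, K.starProjection (κ g x) = κ g (K.starProjection x) := by
    intro g x
    refine Submodule.eq_starProjection_of_mem_orthogonal
      (hκK g _ (Submodule.starProjection_apply_mem K x)) ?_
    rw [← map_sub, Submodule.mem_orthogonal]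
    intro u hu
    rw [← (hinv g u).2, LinearIsometryEquiv.inner_map_map]
    exact (Submodule.mem_orthogonal _ _).1 (Submodule.sub_starProjection_mem_orthogonal x) _
      (hκK _ _ hu)
  have hTK : ∀ x ∈ K, W (V x) ∈ K := by
    refine hmap (W.toContinuousLinearMap.comp V.toContinuousLinearMap) fun i => ?_
    have h3 := hvK (i.1 + 1, i.2)
    simp only [v, Function.iterate_succ_apply'] at h3
    exact h3
  -- The last condition holds because each generator Tⁿ y of K lies in N when n = 0 and in T K
  -- otherwise, so a vector of K orthogonal to both is orthogonal to K.
  obtain ⟨U, hU⟩ := exists_unitary_of_isometries V W K hTK (fun x hx => hvK (0, ⟨x, hx⟩)) (by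
    intro x hx h1 h2
    have h3 : x ∈ Kᗮ := by
      rw [show Kᗮ = _ from Submodule.orthogonal_closure _, Submodule.mem_orthogonal]
      intro u hu
      induction hu using Submodule.span_induction with
      | mem u hu =>
        obtain ⟨⟨n, y⟩, rfl⟩ := hu
        cases n with
        | zero => exact h2 _ y.2
        | succ n =>
          simp only [v, Function.iterate_succ_apply']
          exact h1 _ (hvK (n, y))
      | zero => exact inner_zero_left _
      | add u u' _ _ hu hu' => rw [inner_add_left, hu, hu', add_zero]
      | smul c u _ hu => rw [inner_smul_left, hu, mul_zero]
    exact inner_self_eq_zero.1 ((Submodule.mem_orthogonal _ _).1 h3 x hx))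
  refine ⟨U, fun g x => ?_⟩
  have hW' : ∀ x, ContinuousLinearMap.adjoint W.toContinuousLinearMap (κ g x) =
      ρ g (ContinuousLinearMap.adjoint W.toContinuousLinearMap x) := by
    intro x
    refine ext_inner_left ℂ fun q => ?_
    have h : ρ g (ρ g⁻¹ q) = q := by
      change (ρ g * ρ g⁻¹) q = q
      rw [← map_mul, mul_inv_cancel, map_one]
      rfl
    rw [← h, LinearIsometryEquiv.inner_map_map, ContinuousLinearMap.adjoint_inner_right,
      ContinuousLinearMap.adjoint_inner_right]
    change ⟪W _, _⟫_ℂ = ⟪W _, _⟫_ℂ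
    rw [hW, LinearIsometryEquiv.inner_map_map]
  rw [hU, hU, map_add, hκproj, hV, ← map_sub, hW']

end CantorBernstein

end FellAbsorption

namespace FellAbsorption

/-! ### Closed cones of coefficients -/

section Cones

variable {A B : Type*} [AddCommMonoid A] [AddCommMonoid B]

lemma exists_fin_sum_of_mem_closure_range {X : Type*} {c : X → A} {a : A}
    (ha : a ∈ AddSubmonoid.closure (Set.range c)) :
    ∃ (n : ℕ) (x : Fin n → X), a = ∑ i, c (x i) := by
  obtain ⟨l, hl, rfl⟩ := AddSubmonoid.exists_list_of_mem_closure ha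
  choose x hx using fun i : Fin l.length => hl (l.get i) (l.get_mem i)
  refine ⟨l.length, x, ?_⟩
  simp only [hx]
  exact (Fin.sum_univ_getElem l).symm

variable [TopologicalSpace A] [ContinuousAdd A] [TopologicalSpace B]

/-- The preimage of a closed submonoid under a continuous additive map is again a closed submonoid,
so generators suffice. Each operation on approximable coefficients is handled in this way. -/
lemma map_mem_of_mem_topologicalClosure (Φ : A →+ B) (hΦ : Continuous Φ) {s : Set A}
    {T : AddSubmonoid B} (hT : IsClosed (T : Set B)) (h : ∀ a ∈ s, Φ a ∈ T) {a : A}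
    (ha : a ∈ (AddSubmonoid.closure s).topologicalClosure) : Φ a ∈ T := by
  have h1 : (AddSubmonoid.closure s).topologicalClosure ≤ T.comap Φ :=
    AddSubmonoid.topologicalClosure_minimal _ ((AddSubmonoid.closure_le).2 h) (hT.preimage hΦ)
  exact h1 ha

end Cones

/-! ### Coefficients of bimodules -/

namespace Bimodule

variable {H : Type*} [NormedAddCommGroup H] [InnerProductSpace ℂ H] [CompleteSpace H]
  {M : VonNeumannAlgebra H}
  {K : Type*} [NormedAddCommGroup K] [InnerProductSpace ℂ K] [CompleteSpace K]
  {L : Type*} [NormedAddCommGroup L] [InnerProductSpace ℂ L] [CompleteSpace L]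

lemma act_act (B : Bimodule M K) (x x' y y' : M.toStarSubalgebra) (ξ : K) :
    B.act x (B.act x' ξ y') y = B.act (x * x') ξ (y' * y) := by
  unfold act
  rw [← B.left_right_comm, map_mul, MulOpposite.op_mul, map_mul]
  rfl

lemma inner_act (B : Bimodule M K) (x y : M.toStarSubalgebra) (ξ η : K) :
    ⟪ξ, B.act x η y⟫_ℂ = ⟪B.act (star x) ξ (star y), η⟫_ℂ := by
  unfold act
  rw [B.left_right_comm (star x), MulOpposite.op_star, map_star, map_star,
    ContinuousLinearMap.star_eq_adjoint, ContinuousLinearMap.star_eq_adjoint,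
    ContinuousLinearMap.adjoint_inner_left, ContinuousLinearMap.adjoint_inner_left]

lemma inner_act_act (B : Bimodule M K) (x x' y y' : M.toStarSubalgebra) (ξ η : K) :
    ⟪B.act x ξ y, B.act x' η y'⟫_ℂ = ⟪ξ, B.act (star x * x') η (y' * star y)⟫_ℂ := by
  rw [← act_act, inner_act B (star x), star_star, star_star]

/-- The operator `ξ ↦ x · ξ · y`. -/
noncomputable def actL (B : Bimodule M K) (x y : M.toStarSubalgebra) : K →L[ℂ] K :=
  (B.left x).comp (B.right (.op y))

lemma actL_apply (B : Bimodule M K) (x y : M.toStarSubalgebra) (ξ : K) :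
    B.actL x y ξ = B.act x ξ y := rfl

/-- The coefficient `(x, y) ↦ ⟨ξ, x ξ y⟩`. -/
noncomputable def coef (B : Bimodule M K) (ξ : K) :
    M.toStarSubalgebra → M.toStarSubalgebra → ℂ := fun x y => ⟪ξ, B.act x ξ y⟫_ℂ

lemma continuous_coef (B : Bimodule M K) : Continuous B.coef :=
  continuous_pi fun x => continuous_pi fun y =>
    Continuous.inner continuous_id (B.actL x y).continuous

/-- The pointwise closure of the set of finite sums of coefficients. -/
noncomputable def coefCone (B : Bimodule M K) :
    AddSubmonoid (M.toStarSubalgebra → M.toStarSubalgebra → ℂ) :=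
  (AddSubmonoid.closure (Set.range B.coef)).topologicalClosure

lemma isClosed_coefCone (B : Bimodule M K) : IsClosed (B.coefCone : Set (M.toStarSubalgebra → M.toStarSubalgebra → ℂ)) :=
  AddSubmonoid.isClosed_topologicalClosure _

lemma coef_mem_coefCone (B : Bimodule M K) (ξ : K) : B.coef ξ ∈ B.coefCone :=
  AddSubmonoid.le_topologicalClosure _ (AddSubmonoid.subset_closure ⟨ξ, rfl⟩)

/-- A finite set of pairs and a tolerance define an open set of the product topology, so weak
containment is membership of coefficients in the pointwise closure. -/
lemma weaklyContained_of_coef_mem {B : Bimodule M K} {C : Bimodule M L}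
    (h : ∀ ξ, B.coef ξ ∈ C.coefCone) : B.WeaklyContained C := by
  intro ξ F ε hε
  let U : Set (M.toStarSubalgebra → M.toStarSubalgebra → ℂ) :=
    ⋂ x ∈ F, ⋂ y ∈ F, {f | ‖B.coef ξ x y - f x y‖ < ε}
  have hU : IsOpen U := isOpen_biInter_finset fun x _ => isOpen_biInter_finset fun y _ =>
    isOpen_lt (by fun_prop) continuous_const
  have hξ : B.coef ξ ∈ U := by simp [U, hε]
  obtain ⟨f, hf, hf'⟩ := mem_closure_iff.1 (h ξ) U hU hξ
  obtain ⟨n, η, rfl⟩ := exists_fin_sum_of_mem_closure_range hf'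
  refine ⟨n, η, fun x hx y hy => ?_⟩
  have h1 : ‖B.coef ξ x y - (∑ i, C.coef (η i)) x y‖ < ε := by
    simp only [U, Set.mem_iInter] at hf
    exact hf x hx y hy
  simpa only [Finset.sum_apply, coef] using h1

/-- The effect on coefficients of replacing `ξ` by `∑ c_p x_p ξ y_p`. -/
noncomputable def coefTransform (c : M.toStarSubalgebra × M.toStarSubalgebra →₀ ℂ) :
    (M.toStarSubalgebra → M.toStarSubalgebra → ℂ) →+
      (M.toStarSubalgebra → M.toStarSubalgebra → ℂ) where
  toFun f := fun x y => ∑ p ∈ c.support, ∑ q ∈ c.support, starRingEnd ℂ (c p) * c q *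
    f (star p.1 * x * q.1) (q.2 * y * star p.2)
  map_zero' := by ext; simp
  map_add' f g := by ext; simp [mul_add, Finset.sum_add_distrib]

/-- The coefficient of a vector in the span of M ξ M depends only on the coefficient of ξ,
additively and by a formula valid in every bimodule. Approximations therefore transfer from ξ to the
span. -/
lemma coef_linearCombination (B : Bimodule M K) (ξ : K)
    (c : M.toStarSubalgebra × M.toStarSubalgebra →₀ ℂ) :
    B.coef (Finsupp.linearCombination ℂ (fun p => B.act p.1 ξ p.2) c) =
      coefTransform c (B.coef ξ) := by
  ext x y
  simp only [coef, coefTransform, AddMonoidHom.coe_mk, ZeroHom.coe_mk,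
    Finsupp.linearCombination_apply, Finsupp.sum, sum_inner, ← actL_apply, map_sum, map_smul,
    inner_sum, inner_smul_left, inner_smul_right]
  rw [Finset.sum_comm]
  refine Finset.sum_congr rfl fun q _ => ?_
  rw [Finset.mul_sum]
  refine Finset.sum_congr rfl fun p _ => ?_
  simp only [actL_apply, act_act, inner_act_act]
  rw [← mul_assoc, mul_comm (c q), mul_assoc (star p.1)]

/-- Weak containment is decided by the coefficient of a cyclic vector. -/
lemma coef_mem_of_total {B : Bimodule M K} {C : Bimodule M L} {ξ : K}
    (hξ : Total fun p : M.toStarSubalgebra × M.toStarSubalgebra => B.act p.1 ξ p.2)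
    (h : B.coef ξ ∈ C.coefCone) (ζ : K) : B.coef ζ ∈ C.coefCone := by
  refine hξ.denseRange.induction_on ζ (C.isClosed_coefCone.preimage B.continuous_coef) fun c => ?_
  rw [coef_linearCombination]
  refine map_mem_of_mem_topologicalClosure (coefTransform c) ?_ C.isClosed_coefCone ?_ h
  · refine continuous_pi fun x => continuous_pi fun y => ?_
    change Continuous fun f : M.toStarSubalgebra → M.toStarSubalgebra → ℂ =>
      ∑ p ∈ c.support, ∑ q ∈ c.support, starRingEnd ℂ (c p) * c q *
        f (star p.1 * x * q.1) (q.2 * y * star p.2)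
    fun_prop
  -- Read backwards in `C`, the transform of a coefficient of η is the coefficient of the same
  -- combination of translates of η.
  · rintro _ ⟨η, rfl⟩
    rw [← coef_linearCombination]
    exact C.coef_mem_coefCone _

/-- Bimodules with cyclic families which have the same coefficients are isomorphic. -/
lemma isomorphic_of_total {I : Type*} {B : Bimodule M K} {C : Bimodule M L} {ξ : I → K}
    {η : I → L}
    (hξ : Total fun p : I × M.toStarSubalgebra × M.toStarSubalgebra =>
      B.act p.2.1 (ξ p.1) p.2.2)
    (hη : Total fun p : I × M.toStarSubalgebra × M.toStarSubalgebra =>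
      C.act p.2.1 (η p.1) p.2.2)
    (h : ∀ i j x y, ⟪ξ i, B.act x (ξ j) y⟫_ℂ = ⟪η i, C.act x (η j) y⟫_ℂ) : B.Isomorphic C := by
  -- Moving the actions to one side turns the Gram matrix of translates into coefficients of the
  -- generators. The unitary intertwines since the actions map each translate to another one.
  obtain ⟨U, hU⟩ := exists_unitary_of_inner_eq hξ hη fun p q => by
    rw [inner_act_act, inner_act_act, h]
  refine ⟨U, fun x ζ y => ?_⟩
  refine DFunLike.congr_fun (hξ.ext (S := (U : K →L[ℂ] L).comp (B.actL x y))
    (T := (C.actL x y).comp (U : K →L[ℂ] L)) fun p => ?_) ζ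
  have h1 := hU (p.1, x * p.2.1, p.2.2 * y)
  simp only [ContinuousLinearMap.comp_apply]
  change U (B.act x (B.act p.2.1 (ξ p.1) p.2.2) y) = C.act x (U (B.act p.2.1 (ξ p.1) p.2.2)) y
  rw [hU, act_act, act_act, h1]

end Bimodule

end FellAbsorption

/-! ### Coefficients of the bimodule L²(A) ⊗ P ⊗ ℓ²(G) and of L²⟨M, A⟩ -/

namespace FellAbsorption

/-- Testing against elementary tensors extends the formula from basis vectors ξ ⊗ δ_i to all `f`;
this is needed because the vector of a general element of M has infinitely many nonzero coordinates.
-/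
lemma tensorSumEquiv_htmul_apply {ι E P : Type*} [NormedAddCommGroup E] [InnerProductSpace ℂ E]
    [NormedAddCommGroup P] [InnerProductSpace ℂ P] (f : L2Sum ι E) (η : P) (i : ι) :
    tensorSumEquiv ι E P (htmul f η) i = htmul (f i) η := by
  classical
  refine htensor_ext_inner fun x y => ?_
  have h : ⟪htmul x y, tensorSumEquiv ι E P (htmul f η) i⟫_ℂ =
      ⟪(lp.single 2 i (htmul x y) : L2Sum ι (HTensor E P)), tensorSumEquiv ι E P (htmul f η)⟫_ℂ := by
    rw [lp.inner_single_left]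
  rw [h, ← LinearIsometryEquiv.inner_map_map (tensorSumEquiv ι E P).symm,
    LinearIsometryEquiv.symm_apply_apply, tensorSumEquiv_symm_single, coordIsometry_htmul,
    inner_htmul, inner_htmul, lp.inner_single_left]

section Coefficients

variable {A : Type*} [CommCStarAlgebra A] [PartialOrder A] [StarOrderedRing A]
  {τ : A →ₚ[ℂ] ℂ} {G : Type*} [Group G]
  {P : Type*} [NormedAddCommGroup P] [InnerProductSpace ℂ P] [CompleteSpace P]

lemma total_hat (τ : A →ₚ[ℂ] ℂ) : Total (hat τ) := total_of_denseRange denseRange_hat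

lemma elemM_one_one (σ : TraceAction G τ) : elemM σ 1 1 = 1 := by
  refine Subtype.ext ?_
  change opA G τ 1 * opU σ 1 = 1
  ext f k
  rw [mul_apply_eq_comp, opA_apply, opU_apply, map_one]
  simp

/-- The `g`-th term `⟨E(y* u_g*), E(x u_g*)⟩` of the coefficient of `1 ⊗ p ⊗ δ_1`. -/
noncomputable def coefTerm (σ : TraceAction G τ) (g : G)
    (x y : (crossedProduct σ).toStarSubalgebra) : ℂ :=
  ⟪rightM σ (.op (star y)) (vecU τ 1) g, (x : L2M G τ →L[ℂ] L2M G τ) (vecU τ 1) g⟫_ℂ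

/-- The terms are coordinatewise inner products of two vectors of ℓ²(G; L²(A)). Absolute summability
provides the dominating series used when the group coefficients vary. -/
lemma summable_norm_coefTerm (σ : TraceAction G τ) (x y : (crossedProduct σ).toStarSubalgebra) :
    Summable fun g => ‖coefTerm σ g x y‖ :=
  (lp.summable_inner (𝕜 := ℂ) (rightM σ (.op (star y)) (vecU τ 1))
    ((x : L2M G τ →L[ℂ] L2M G τ) (vecU τ 1))).norm

open Classical in
/-- The vector `1 ⊗ p ⊗ δ_1` of `L²(A) ⊗ P ⊗ ℓ²(G)`. -/
noncomputable def repVec (G : Type*) [Group G] (τ : A →ₚ[ℂ] ℂ) (p : P) :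
    L2Sum G (HTensor (L2A τ) P) := lp.single 2 1 (htmul (hat τ 1) p)

/-- The left action twists the coordinate at g by ρ_g while the right action leaves P alone; this
asymmetry is the source of the factor ⟨p, ρ_g q⟩ in the coefficients. -/
lemma repBimodule_left_repVec (σ : TraceAction G τ) (ρ : G →* (P ≃ₗᵢ[ℂ] P)) (p : P)
    (x : (crossedProduct σ).toStarSubalgebra) (g : G) :
    (repBimodule σ ρ).left x (repVec G τ p) g =
      htmul ((x : L2M G τ →L[ℂ] L2M G τ) (vecU τ 1) g) (ρ g p) := by
  change repLeft τ ρ (x : L2M G τ →L[ℂ] L2M G τ) (repVec G τ p) g = _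
  classical
  rw [repLeft_apply, repVec, twist_symm_single, tensorSumEquiv_symm_single_htmul, ampLeft_htmul]
  change hunitary (LinearIsometryEquiv.refl ℂ (L2A τ)) (ρ g) (tensorSumEquiv G (L2A τ) P _ g) = _
  rw [tensorSumEquiv_htmul_apply, hunitary_htmul, map_one]
  rfl

lemma repBimodule_right_repVec (σ : TraceAction G τ) (ρ : G →* (P ≃ₗᵢ[ℂ] P)) (p : P)
    (y : (crossedProduct σ).toStarSubalgebra) (g : G) :
    (repBimodule σ ρ).right (.op y) (repVec G τ p) g =
      htmul (rightM σ (.op y) (vecU τ 1) g) p := by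
  change repRight σ P (.op y) (repVec G τ p) g = _
  classical
  rw [repRight_apply, repVec, tensorSumEquiv_symm_single_htmul, ampLeft_htmul,
    tensorSumEquiv_htmul_apply]
  rfl

/-- Moving y to the other side as y* leaves the left action on one vector and the right action on
the other, and the two coordinate formulas multiply. The coefficient is thus linear in the function
g ↦ ⟨p, ρ_g q⟩. -/
lemma inner_repVec (σ : TraceAction G τ) (ρ : G →* (P ≃ₗᵢ[ℂ] P)) (p q : P)
    (x y : (crossedProduct σ).toStarSubalgebra) :
    ⟪repVec G τ p, (repBimodule σ ρ).act x (repVec G τ q) y⟫_ℂ =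
      ∑' g, coefTerm σ g x y * ⟪p, ρ g q⟫_ℂ := by
  unfold Bimodule.act
  rw [Bimodule.left_right_comm, ← ContinuousLinearMap.adjoint_inner_left,
    ← ContinuousLinearMap.star_eq_adjoint, ← map_star, ← MulOpposite.op_star, lp.inner_eq_tsum]
  refine tsum_congr fun g => ?_
  rw [repBimodule_left_repVec, repBimodule_right_repVec, inner_htmul]
  rfl

/-- Right multiplication by a u_k sends 1 ⊗ p ⊗ δ_1 to â ⊗ p ⊗ δ_k, so right translates suffice as
soon as the vectors p are total in P. -/
lemma total_repVec_right (σ : TraceAction G τ) (ρ : G →* (P ≃ₗᵢ[ℂ] P)) {I : Type*} {p : I → P}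
    (hp : Total p) : Total fun i : I × (crossedProduct σ).toStarSubalgebra =>
      (repBimodule σ ρ).act 1 (repVec G τ (p i.1)) i.2 := by
  classical
  refine (((total_hat τ).htmul hp).single (ι := G)).mono ?_
  rintro ⟨k, a, i⟩
  refine ⟨(i, elemM σ a k), ?_⟩
  rw [← elemM_one_one, repVec, repBimodule_act]
  simp [mulA_hat]

/-- With both actions available, a u_g on the left and u_{g⁻¹k} on the right produce â ⊗ ρ_g p ⊗
δ_k, so only the orbits of the vectors p need to be total. -/
lemma total_repVec (σ : TraceAction G τ) (ρ : G →* (P ≃ₗᵢ[ℂ] P)) {I : Type*} {p : I → P}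
    (hp : Total fun i : G × I => ρ i.1 (p i.2)) :
    Total fun i : I × (crossedProduct σ).toStarSubalgebra × (crossedProduct σ).toStarSubalgebra =>
      (repBimodule σ ρ).act i.2.1 (repVec G τ (p i.1)) i.2.2 := by
  classical
  refine (((total_hat τ).htmul hp).single (ι := G)).mono ?_
  rintro ⟨k, a, g, i⟩
  refine ⟨(i, elemM σ a g, elemM σ 1 (g⁻¹ * k)), ?_⟩
  simp only [repVec]
  rw [repBimodule_act]
  simp [mulA_hat]

open scoped Classical in
-- A free orthonormal orbit annihilates every term with g ≠ 1. This is the step at which the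
-- representation is absorbed.
lemma inner_repVec_of_orthonormal (σ : TraceAction G τ) (ρ : G →* (P ≃ₗᵢ[ℂ] P)) {I : Type*}
    {p : I → P} (hp : Orthonormal ℂ fun i : G × I => ρ i.1 (p i.2)) (i j : I)
    (x y : (crossedProduct σ).toStarSubalgebra) :
    ⟪repVec G τ (p i), (repBimodule σ ρ).act x (repVec G τ (p j)) y⟫_ℂ =
      if i = j then coefTerm σ 1 x y else 0 := by
  have h : ∀ g, ⟪p i, ρ g (p j)⟫_ℂ = if (1, i) = (g, j) then 1 else 0 := fun g => by
    have := (orthonormal_iff_ite.1 hp) (1, i) (g, j)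
    simpa using this
  rw [inner_repVec]
  simp only [h]
  rw [tsum_eq_single 1]
  · by_cases hij : i = j <;> simp [hij]
  · intro g hg
    have : ¬ ((1 : G) = g ∧ i = j) := fun h => hg h.1.symm
    simp [this]

/-! ### The cyclic vector `e_A` of `L²⟨M, A⟩` -/

open scoped Classical in
lemma jonesProj_vecU (g : G) : jonesProj G τ (vecU τ g) = if g = 1 then vecU τ 1 else 0 := by
  rw [jonesProj_apply, vecU]
  by_cases hg : g = 1
  · subst hg
    simp [vecU]
  · simp [hg, Ne.symm hg]

/-- The Jones projection as an element of `{T ∈ ⟨M, A⟩ | Tr(T* T) < ∞}`. -/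
noncomputable def jonesHS (σ : TraceAction G τ) : hilbertSchmidt σ :=
  ⟨jonesProj G τ, subset_vnGenerated (.inr rfl), (mem_trace_iff _).2 (by
    classical
    have h : (fun g => jonesProj G τ (vecU τ g)) =
        (lp.single 2 1 (vecU τ 1) : L2Sum G (L2M G τ)) := by
      funext g
      rw [jonesProj_vecU]
      by_cases hg : g = 1
      · subst hg; simp
      · simp [hg]
    rw [h]
    exact lp.memℓp _)⟩

lemma basicBimodule_act_embL2 (σ : TraceAction G τ) (x y : (crossedProduct σ).toStarSubalgebra)
    (T : hilbertSchmidt σ) : (basicBimodule σ).act x (embL2 σ T) y =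
      embL2 σ (mulLeftHS σ x (mulRightHS σ (.op y) T)) := by
  change basicLeft σ x (basicRight σ (.op y) (embL2 σ T)) = _
  rw [basicRight_apply, basicLeft_apply]

lemma conjM_vecU_one (σ : TraceAction G τ) : conjM σ (vecU τ 1) = vecU τ 1 := by
  ext k
  rw [conjM_apply, vecU]
  by_cases hk : k = 1
  · subst hk
    simp
  · have : k⁻¹ ≠ 1 := by simpa using hk
    simp [hk, this]

lemma rightM_star_vecU_one (σ : TraceAction G τ) (y : (crossedProduct σ).toStarSubalgebra) :
    rightM σ (.op (star y)) (vecU τ 1) 1 =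
      conjA τ ((y : L2M G τ →L[ℂ] L2M G τ) (vecU τ 1) 1) := by
  change antiConj (conjM σ) (star (star (y : L2M G τ →L[ℂ] L2M G τ))) (vecU τ 1) 1 = _
  rw [star_star, antiConj_apply, conjM_vecU_one, conjM_apply]
  simp

lemma inner_conjA_left (ξ η : L2A τ) : ⟪conjA τ ξ, η⟫_ℂ = ⟪conjA τ η, ξ⟫_ℂ := by
  conv_lhs => rw [← conjA_conjA η]
  exact inner_antiunitary _ _ _

/-- This is Tr(e_A x e_A y) = τ(E(x)E(y)): in the sum defining the trace, e_A kills û_g for g ≠ 1.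
-/
lemma inner_jonesHS (σ : TraceAction G τ) (x y : (crossedProduct σ).toStarSubalgebra) :
    ⟪embL2 σ (jonesHS σ), (basicBimodule σ).act x (embL2 σ (jonesHS σ)) y⟫_ℂ =
      coefTerm σ 1 x y := by
  classical
  rw [basicBimodule_act_embL2, inner_embL2, tsum_eq_single 1]
  · change ⟪jonesProj G τ (vecU τ 1), (x : L2M G τ →L[ℂ] L2M G τ) (jonesProj G τ
      ((y : L2M G τ →L[ℂ] L2M G τ) (vecU τ 1)))⟫_ℂ = _
    rw [jonesProj_vecU, if_pos rfl, ← ContinuousLinearMap.adjoint_inner_left,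
      ← ContinuousLinearMap.star_eq_adjoint, jonesProj_apply, lp.inner_single_right,
      basic_star_apply σ (crossed_le_basic σ x.2), coefTerm, rightM_star_vecU_one]
    rw [mul_inv_cancel, σ.unitary_one, inner_conjA_left]
  · intro g hg
    change ⟪jonesProj G τ (vecU τ g), _⟫_ℂ = _
    rw [jonesProj_vecU, if_neg hg, inner_zero_left]

/-- The operator a u_h e_A u_k* sends û_k to the vector of a u_h and kills the other û_g, so it is
the vector (â ⊗ δ_h) ⊗ δ_k. These are total even in the ambient space ℓ²(G; L²(M)). -/
lemma total_jonesHS (σ : TraceAction G τ) :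
    Total fun p : (crossedProduct σ).toStarSubalgebra × (crossedProduct σ).toStarSubalgebra =>
      (basicBimodule σ).act p.1 (embL2 σ (jonesHS σ)) p.2 := by
  classical
  intro v hv
  have h : ∀ (k h : G) (a : A), ⟪(lp.single 2 k (lp.single 2 h (hat τ a)) : L2Sum G (L2M G τ)),
      (v : L2Sum G (L2M G τ))⟫_ℂ = 0 := by
    intro k h a
    have h1 := hv (elemM σ a h, elemM σ 1 k⁻¹)
    simp only [basicBimodule_act_embL2] at h1
    refine Eq.trans (congrArg (fun w : L2Sum G (L2M G τ) => ⟪w, (v : L2Sum G (L2M G τ))⟫_ℂ) ?_) h1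
    ext1
    funext g
    change _ = (opA G τ a * opU σ h) (jonesProj G τ ((opA G τ 1 * opU σ k⁻¹) (vecU τ g)))
    have h2 : (opA G τ 1 * opU σ k⁻¹) (vecU τ g) = vecU τ (k⁻¹ * g) := by
      rw [mul_apply_eq_comp, vecU, opU_single, opA_single]
      simp [vecU]
    rw [h2, jonesProj_vecU]
    by_cases hg : g = k
    · subst hg
      rw [inv_mul_cancel, if_pos rfl, mul_apply_eq_comp, vecU, opU_single, opA_single]
      simp [mulA_hat]
    · have : ¬ k⁻¹ * g = 1 := fun h => hg (by rw [inv_mul_eq_one] at h; exact h.symm)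
      simp [this, hg]
  refine Subtype.ext ?_
  exact ((total_hat τ).single (ι := G)).single (ι := G) (v : L2Sum G (L2M G τ))
    fun p => h p.1 p.2.1 p.2.2

/-- If `P` is a multiple of the regular representation, then `L²(A) ⊗ P ⊗ ℓ²(G)` is a multiple
of `L²⟨M, A⟩`. -/
theorem repBimodule_isomorphic_multiple (σ : TraceAction G τ) (ρ : G →* (P ≃ₗᵢ[ℂ] P)) {I : Type*}
    {p : I → P} (hp : Orthonormal ℂ fun i : G × I => ρ i.1 (p i.2))
    (hp' : Total fun i : G × I => ρ i.1 (p i.2)) :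
    (repBimodule σ ρ).Isomorphic ((basicBimodule σ).multiple I) := by
  classical
  have hact : ∀ (i : I) (x y : (crossedProduct σ).toStarSubalgebra) (v : L2Basic σ),
      ((basicBimodule σ).multiple I).act x (lp.single 2 i v : L2Sum I (L2Basic σ)) y =
        lp.single 2 i ((basicBimodule σ).act x v y) := fun i x y v => by
    change ampSum I (L2Basic σ) ((basicBimodule σ).left x)
      (ampSum I (L2Basic σ) ((basicBimodule σ).right (.op y)) (lp.single 2 i v)) = _
    rw [ampSum_single, ampSum_single]
    rfl
  refine Bimodule.isomorphic_of_total (ξ := fun i => repVec G τ (p i))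
    (η := fun i => (lp.single 2 i (embL2 σ (jonesHS σ)) : L2Sum I (L2Basic σ)))
    (total_repVec σ ρ hp') ?_ fun i j x y => ?_
  · simp only [hact]
    exact (total_jonesHS σ).single (ι := I)
  · rw [inner_repVec_of_orthonormal σ ρ hp, hact, lp.inner_single_left]
    by_cases hij : i = j
    · subst hij
      rw [if_pos rfl, lp.single_apply_self, inner_jonesHS]
    · simp [hij]

/-- Weak containment in any bimodule approximating `(x, y) ↦ τ(E(x) E(y))`. -/
theorem coef_repBimodule_mem (σ : TraceAction G τ) (ρ : G →* (P ≃ₗᵢ[ℂ] P))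
    {p : P} (hp : Orthonormal ℂ fun g : G => ρ g p) (hp' : Total fun g : G => ρ g p)
    {L : Type*} [NormedAddCommGroup L] [InnerProductSpace ℂ L] [CompleteSpace L]
    {C : Bimodule (crossedProduct σ) L} (hC : coefTerm σ 1 ∈ C.coefCone)
    (ζ : L2Sum G (HTensor (L2A τ) P)) : (repBimodule σ ρ).coef ζ ∈ C.coefCone := by
  -- A single vector p is enough: its orbit is an orthonormal basis, so 1 ⊗ p ⊗ δ_1 is cyclic with
  -- coefficient `coefTerm σ 1`.
  have h1 := total_repVec σ ρ (I := Unit) (p := fun _ => p)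
    (hp'.mono fun g => ⟨(g, ()), rfl⟩)
  have h2 : (repBimodule σ ρ).coef (repVec G τ p) = coefTerm σ 1 := by
    ext x y
    have := inner_repVec_of_orthonormal σ ρ (I := Unit) (p := fun _ => p)
      (hp.comp (fun g : G × Unit => g.1) fun a b h => Prod.ext h rfl) () () x y
    rwa [if_pos rfl] at this
  exact Bimodule.coef_mem_of_total (h1.mono fun i => ⟨i.2, rfl⟩) (h2 ▸ hC) ζ

lemma coefTerm_mem_basic (σ : TraceAction G τ) : coefTerm σ 1 ∈ (basicBimodule σ).coefCone := by
  have h : (basicBimodule σ).coef (embL2 σ (jonesHS σ)) = coefTerm σ 1 := by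
    ext x y
    exact inner_jonesHS σ x y
  exact h ▸ Bimodule.coef_mem_coefCone _ _

end Coefficients

end FellAbsorption

namespace FellAbsorption

/-! ### Approximation on finite sets -/

/-- A basic neighbourhood in the product topology constrains finitely many coordinates, for which
one common radius can be chosen. -/
lemma mem_closure_of_forall_finset {J E : Type*} [SeminormedAddCommGroup E] {φ : J → E}
    {S : Set (J → E)}
    (h : ∀ (F : Finset J) (ε : ℝ), 0 < ε → ∃ s ∈ S, ∀ j ∈ F, ‖φ j - s j‖ < ε) :
    φ ∈ closure S := by
  rw [mem_closure_iff]
  intro U hU hφ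
  obtain ⟨I, u, h1, h2⟩ := isOpen_pi_iff.1 hU φ hφ
  have h3 : ∀ᶠ ε : ℝ in nhdsWithin 0 (Set.Ioi 0), ∀ j ∈ I, Metric.ball (φ j) ε ⊆ u j := by
    rw [Filter.eventually_all_finset]
    intro j hj
    obtain ⟨ε, hε, hε'⟩ := Metric.isOpen_iff.1 (h1 j hj).1 _ (h1 j hj).2
    filter_upwards [Ioo_mem_nhdsGT hε] with δ hδ
    exact (Metric.ball_subset_ball hδ.2.le).trans hε'
  obtain ⟨ε, hε, hε'⟩ := (h3.and self_mem_nhdsWithin).exists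
  obtain ⟨s, hs, hs'⟩ := h I ε hε'
  refine ⟨s, h2 fun j hj => hε j hj ?_, hs⟩
  rw [Metric.mem_ball, dist_comm, dist_eq_norm]
  exact hs' j hj

lemma mem_closure_of_forall_finset₂ {J E : Type*} [SeminormedAddCommGroup E] {φ : J → J → E}
    {S : Set (J → J → E)}
    (h : ∀ (F : Finset J) (ε : ℝ), 0 < ε → ∃ s ∈ S, ∀ i ∈ F, ∀ j ∈ F, ‖φ i j - s i j‖ < ε) :
    φ ∈ closure S := by
  classical
  have h1 : Continuous fun f : J × J → E => fun i j => f (i, j) := by fun_prop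
  have h2 : (fun p : J × J => φ p.1 p.2) ∈
      closure {f : J × J → E | (fun i j => f (i, j)) ∈ S} := by
    refine mem_closure_of_forall_finset fun F ε hε => ?_
    -- A finite set of pairs lies in the square of the union of its two projections.
    obtain ⟨s, hs, hs'⟩ := h (F.image Prod.fst ∪ F.image Prod.snd) ε hε
    exact ⟨fun p => s p.1 p.2, hs, fun p hp => hs' _
      (Finset.mem_union_left _ (Finset.mem_image_of_mem _ hp)) _
      (Finset.mem_union_right _ (Finset.mem_image_of_mem _ hp))⟩
  exact map_mem_closure h1 h2 fun f hf => hf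

lemma norm_sum_inner_le {ι E : Type*} [Fintype ι] [NormedAddCommGroup E] [InnerProductSpace ℂ E]
    (x y : ι → E) :
    ‖∑ i, ⟪x i, y i⟫_ℂ‖ ≤ √(∑ i, ‖x i‖ ^ 2) * √(∑ i, ‖y i‖ ^ 2) :=
  (norm_sum_le _ _).trans <| (Finset.sum_le_sum fun i _ => norm_inner_le_norm (x i) (y i)).trans
    (Real.sum_mul_le_sqrt_mul_sqrt _ _ _)

/-! ### Partitions of unity in an abelian algebra -/

section Partition

variable {A : Type*} [CommCStarAlgebra A] [PartialOrder A] [StarOrderedRing A]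
  {τ : A →ₚ[ℂ] ℂ}

open WeakDual in
/-- A partition of unity `∑ b_i* b_i = 1` such that finitely many given elements of `A` are almost
constant on the support of each `b_i`. -/
lemma exists_partition (τ : A →ₚ[ℂ] ℂ) (S : Finset A) {ε : ℝ} (hε : 0 < ε) :
    ∃ (t : Finset (characterSpace ℂ A)) (b : t → A) (c : t → A → ℂ),
      ∑ i, star (b i) * b i = 1 ∧
      ∀ a ∈ S, ∀ i, ‖hat τ (b i * (a - c i a • (1 : A)))‖ ≤ ε * ‖hat τ (b i)‖ := by
  -- Via the Gelfand transform A becomes C(X) with X compact; X is covered by finitely many open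
  -- sets on which each element of `S` stays within ε of its value at a chosen point.
  let Φ := gelfandStarTransform A
  have hΦ : ∀ {a b : A}, Φ a = Φ b → a = b := fun h => Φ.injective h
  let U : characterSpace ℂ A → Set (characterSpace ℂ A) := fun x =>
    ⋂ a ∈ S, {s | ‖Φ a s - Φ a x‖ < ε}
  have hU : ∀ x, IsOpen (U x) := fun x => isOpen_biInter_finset fun a _ =>
    isOpen_lt (by fun_prop) continuous_const
  have hUx : ∀ x, x ∈ U x := fun x => by simp [U, hε]
  obtain ⟨t, ht⟩ := CompactSpace.elim_nhds_subcover U fun x => (hU x).mem_nhds (hUx x)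
  obtain ⟨ψ, hψ⟩ := PartitionOfUnity.exists_isSubordinate (s := Set.univ) isClosed_univ
    (fun i : t => U i) (fun i => hU i) (by
      intro s _
      have hs : s ∈ ⋃ x ∈ t, U x := ht ▸ Set.mem_univ s
      simp only [Set.mem_iUnion] at hs ⊢
      obtain ⟨x, hx, hs⟩ := hs
      exact ⟨⟨x, hx⟩, hs⟩)
  -- Square roots of a subordinate partition of unity, so that the squares sum to 1.
  let β : t → C(characterSpace ℂ A, ℂ) := fun i => ⟨fun s => ((√(ψ i s) : ℝ) : ℂ), by fun_prop⟩
  let c : t → A → ℂ := fun i a => Φ a i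
  refine ⟨t, fun i => Φ.symm (β i), c, ?_, ?_⟩
  · refine hΦ ?_
    rw [map_sum, map_one]
    ext s
    have h1 := ψ.sum_eq_one (Set.mem_univ s)
    rw [finsum_eq_sum_of_fintype] at h1
    simp only [map_mul, map_star, StarAlgEquiv.apply_symm_apply, ContinuousMap.coe_sum,
      Finset.sum_apply, ContinuousMap.mul_apply, ContinuousMap.star_apply, ContinuousMap.one_apply]
    rw [← Complex.ofReal_one, ← h1, Complex.ofReal_sum]
    refine Finset.sum_congr rfl fun i _ => ?_
    simp only [β, ContinuousMap.coe_mk, RCLike.star_def, Complex.conj_ofReal]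
    rw [← Complex.ofReal_mul, Real.mul_self_sqrt (ψ.nonneg i s)]
  · intro a ha i
    -- δ is a square root of ε²|β|² - |β(a - c)|². Since τ(δ*δ) ≥ 0, applying τ gives the norm
    -- inequality.
    let δ : C(characterSpace ℂ A, ℂ) :=
      ⟨fun s => ((√(ψ i s) * √(ε ^ 2 - ‖Φ a s - c i a‖ ^ 2) : ℝ) : ℂ), by fun_prop⟩
    have h1 : star (Φ.symm δ) * Φ.symm δ = ((ε ^ 2 : ℝ) : ℂ) • (star (Φ.symm (β i)) * Φ.symm (β i)) -
        star (Φ.symm (β i) * (a - c i a • (1 : A))) * (Φ.symm (β i) * (a - c i a • (1 : A))) := by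
      refine hΦ ?_
      ext s
      simp only [map_mul, map_star, map_sub, map_smul, map_one, StarAlgEquiv.apply_symm_apply,
        ContinuousMap.mul_apply, ContinuousMap.star_apply, ContinuousMap.sub_apply,
        ContinuousMap.smul_apply, ContinuousMap.one_apply]
      simp only [β, δ, ContinuousMap.coe_mk, RCLike.star_def, Complex.conj_ofReal, map_mul,
        smul_eq_mul, mul_one]
      have h2 : starRingEnd ℂ (Φ a s - c i a) * (Φ a s - c i a) =
          ((‖Φ a s - c i a‖ ^ 2 : ℝ) : ℂ) := by
        rw [Complex.conj_mul']
        push_cast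
        rfl
      have h3 : √(ψ i s) * √(ε ^ 2 - ‖Φ a s - c i a‖ ^ 2) *
          (√(ψ i s) * √(ε ^ 2 - ‖Φ a s - c i a‖ ^ 2)) =
          ε ^ 2 * (√(ψ i s) * √(ψ i s)) - √(ψ i s) * √(ψ i s) * ‖Φ a s - c i a‖ ^ 2 := by
        -- Where ψ vanishes both sides are zero, whatever the sign under the second root; elsewhere
        -- s lies in the small open set and that radicand is nonnegative.
        by_cases h0 : ψ i s = 0
        · simp [h0]
        · have hs : s ∈ U i := hψ i (subset_tsupport _ h0)
          have hs' : ‖Φ a s - c i a‖ < ε := by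
            simp only [U, Set.mem_iInter] at hs
            exact hs a ha
          have h4 : 0 ≤ ε ^ 2 - ‖Φ a s - c i a‖ ^ 2 := by
            have := pow_le_pow_left₀ (norm_nonneg _) hs'.le 2
            linarith
          have h5 := Real.mul_self_sqrt h4
          linear_combination (√(ψ i s) * √(ψ i s)) * h5
      have h6 := congrArg (fun r : ℝ => (r : ℂ)) h3
      push_cast at h6 h2
      push_cast
      rw [h6, ← h2]
      ring
    have h2 := congrArg τ h1
    rw [map_sub, map_smul, ← norm_hat_sq, ← norm_hat_sq, ← norm_hat_sq, smul_eq_mul] at h2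
    have h3 : ‖hat τ (Φ.symm δ)‖ ^ 2 = ε ^ 2 * ‖hat τ (Φ.symm (β i))‖ ^ 2 -
        ‖hat τ (Φ.symm (β i) * (a - c i a • (1 : A)))‖ ^ 2 := by exact_mod_cast h2
    refine le_of_sq_le_sq ?_ (by positivity)
    rw [mul_pow]
    nlinarith [sq_nonneg ‖hat τ (Φ.symm δ)‖]

/-- `L²(A)` is, as an `A`-bimodule, approximated by `L²(A) ⊗ L²(A)`. -/
lemma exists_partition_inner (τ : A →ₚ[ℂ] ℂ) {J : Type*} (F : Finset J) (w v : J → L2A τ) {ε : ℝ}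
    (hε : 0 < ε) : ∃ (t : Finset (WeakDual.characterSpace ℂ A)) (b : t → A),
      ∀ j ∈ F, ∀ k ∈ F, ‖⟪w k, v j⟫_ℂ - ∑ i, ⟪mulA τ (b i) (w k),
        (ℂ ∙ hat τ (b i)).starProjection (mulA τ (b i) (v j))⟫_ℂ‖ < ε := by
  classical
  obtain ⟨R, hR0, hR⟩ : ∃ R : ℝ, 0 < R ∧ ∀ k ∈ F, ‖w k‖ ≤ R :=
    ⟨∑ k ∈ F, ‖w k‖ + 1, by positivity, fun k hk =>
      (Finset.single_le_sum (f := fun k => ‖w k‖) (fun _ _ => norm_nonneg _) hk).trans (by simp)⟩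
  -- Chosen so that the two errors, Rδ from replacing `v j` by an element of A and Rδ‖1‖ from the
  -- partition, add up to ε/2.
  set δ := ε / (2 * (R * (1 + ‖hat τ 1‖))) with hδ
  have hδ0 : 0 < δ := by positivity
  have hδε : R * δ + R * (δ * ‖hat τ 1‖) < ε := by
    have : R * δ + R * (δ * ‖hat τ 1‖) = ε / 2 := by
      rw [hδ]; field_simp
    linarith
  have hap : ∀ j, ∃ a : A, ‖v j - hat τ a‖ < δ := fun j => by
    obtain ⟨a, ha⟩ := denseRange_hat.exists_dist_lt (v j) hδ0
    exact ⟨a, by rwa [dist_eq_norm] at ha⟩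
  choose a ha using hap
  obtain ⟨t, b, c, hb, hc⟩ := exists_partition τ (F.image a) hδ0
  refine ⟨t, b, fun j hj k hk => ?_⟩
  -- Since the sum of the b_i* b_i is 1, the map x ↦ (b_i x)_i is isometric.
  have hsum : ∀ x y : L2A τ, ∑ i, ⟪mulA τ (b i) x, mulA τ (b i) y⟫_ℂ = ⟪x, y⟫_ℂ := by
    intro x y
    have h1 : ∀ i, ⟪mulA τ (b i) x, mulA τ (b i) y⟫_ℂ = ⟪x, mulA τ (star (b i) * b i) y⟫_ℂ :=
      fun i => by
        rw [map_mul, map_star, mul_apply_eq_comp, ContinuousLinearMap.star_eq_adjoint,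
          ContinuousLinearMap.adjoint_inner_right]
    simp only [h1]
    rw [← inner_sum, ← sum_apply, ← map_sum, hb, map_one]
    rfl
  have hnorm : ∀ x : L2A τ, √(∑ i, ‖mulA τ (b i) x‖ ^ 2) = ‖x‖ := by
    intro x
    have h1 := hsum x x
    simp only [inner_self_eq_norm_sq_to_K] at h1
    rw [show ∑ i, ‖mulA τ (b i) x‖ ^ 2 = ‖x‖ ^ 2 by exact_mod_cast h1,
      Real.sqrt_sq (norm_nonneg _)]
  -- The error of the approximation: what is lost by projecting each b_i y onto the line spanned by
  -- b_i.
  let D : L2A τ → L2A τ → ℂ := fun x y =>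
    ∑ i, ⟪mulA τ (b i) x, (ℂ ∙ hat τ (b i))ᗮ.starProjection (mulA τ (b i) y)⟫_ℂ
  have hD : ∀ x y, ⟪x, y⟫_ℂ - ∑ i, ⟪mulA τ (b i) x,
      (ℂ ∙ hat τ (b i)).starProjection (mulA τ (b i) y)⟫_ℂ = D x y := by
    intro x y
    rw [← hsum, ← Finset.sum_sub_distrib]
    refine Finset.sum_congr rfl fun i _ => ?_
    rw [← inner_sub_right, Submodule.starProjection_orthogonal_val]
  have hD1 : ∀ x y, ‖D x y‖ ≤ ‖x‖ * ‖y‖ := by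
    intro x y
    refine (norm_sum_inner_le _ _).trans ?_
    rw [hnorm, ← hnorm y]
    gcongr
    exact Submodule.norm_starProjection_apply_le _ _
  -- On the support of b_i the element a_j is nearly the constant c_i(a_j), so b_i a_j is close to a
  -- multiple of b_i, and that multiple is killed by the complementary projection.
  have hD2 : ∀ x, ‖D x (hat τ (a j))‖ ≤ ‖x‖ * (δ * ‖hat τ 1‖) := by
    intro x
    refine (norm_sum_inner_le _ _).trans ?_
    rw [hnorm]
    gcongr
    rw [← hnorm (hat τ 1), Real.sqrt_le_left (by positivity), mul_pow,
      Real.sq_sqrt (Finset.sum_nonneg fun _ _ => by positivity), Finset.mul_sum]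
    refine Finset.sum_le_sum fun i _ => ?_
    rw [← mul_pow, mulA_hat, mulA_hat, mul_one]
    gcongr
    have h1 : hat τ (b i * a j) = hat τ (b i * (a j - c i (a j) • (1 : A))) +
        c i (a j) • hat τ (b i) := by
      rw [mul_sub, mul_smul_comm, mul_one, ← hatₗ_apply, ← hatₗ_apply, ← hatₗ_apply, map_sub,
        map_smul, sub_add_cancel]
    rw [h1, map_add, map_smul]
    have h2 : (ℂ ∙ hat τ (b i))ᗮ.starProjection (hat τ (b i)) = 0 := by
      rw [Submodule.starProjection_apply_eq_zero_iff, Submodule.orthogonal_orthogonal]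
      exact Submodule.mem_span_singleton_self _
    rw [h2, smul_zero, add_zero]
    exact (Submodule.norm_starProjection_apply_le _ _).trans
      (hc _ (Finset.mem_image_of_mem _ hj) i)
  rw [hD]
  have h3 : D (w k) (v j) = D (w k) (v j - hat τ (a j)) + D (w k) (hat τ (a j)) := by
    simp only [D, ← Finset.sum_add_distrib, ← inner_add_right, ← map_add, sub_add_cancel]
  rw [h3]
  refine lt_of_le_of_lt ((norm_add_le _ _).trans (add_le_add (hD1 _ _) (hD2 _))) (lt_of_le_of_lt ?_
    hδε)
  have h4 := hR k hk
  have h5 := (ha j).le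
  gcongr

end Partition

/-! ### Approximation of τ(E(x)E(y)) by coefficients of the coarse bimodule -/

section Coarse

variable {A : Type*} [CommCStarAlgebra A] [PartialOrder A] [StarOrderedRing A]
  {τ : A →ₚ[ℂ] ℂ} {G : Type*} [Group G]

lemma elemM_one_coe (σ : TraceAction G τ) (b : A) :
    (elemM σ b 1 : L2M G τ →L[ℂ] L2M G τ) = opA G τ b := by
  change opA G τ b * opU σ 1 = _
  ext f k
  rw [mul_apply_eq_comp, opA_apply, opU_apply]
  simp

lemma rightM_elemM_one (σ : TraceAction G τ) (b : A) (f : L2M G τ) :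
    rightM σ (.op (elemM σ b 1)) f 1 = mulA τ b (f 1) := by
  change antiConj (conjM σ) (star (elemM σ b 1 : L2M G τ →L[ℂ] L2M G τ)) f 1 = _
  rw [elemM_one_coe, star_opA, antiConj_opA, star_star, map_one]
  rfl

open scoped Classical in
-- The vector b̂ is the image of 1̂ under right multiplication by b, which commutes with x;
-- projecting back to L²(A) leaves b E(x).
lemma inner_single_left_action (σ : TraceAction G τ) (b : A)
    (x : (crossedProduct σ).toStarSubalgebra) :
    ⟪(lp.single 2 1 (hat τ b) : L2M G τ), (x : L2M G τ →L[ℂ] L2M G τ) (lp.single 2 1 (hat τ b))⟫_ℂ =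
      ⟪hat τ b, mulA τ b ((x : L2M G τ →L[ℂ] L2M G τ) (vecU τ 1) 1)⟫_ℂ := by
  have h1 : (lp.single 2 1 (hat τ b) : L2M G τ) = rightM σ (.op (elemM σ b 1)) (vecU τ 1) := by
    rw [vecU, rightM_elemM_single, mulA_hat]
    simp
  have h2 := DFunLike.congr_fun (rightM_commute σ x (elemM σ b 1)) (vecU τ 1)
  simp only [mul_apply_eq_comp] at h2
  rw [lp.inner_single_left]
  conv_lhs => rw [h1, h2, rightM_elemM_one]

open scoped Classical in
-- The mirror image: b̂ is now the image of 1̂ under left multiplication by b, which commutes with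
-- the right action.
lemma inner_single_right_action (σ : TraceAction G τ) (b : A)
    (y : (crossedProduct σ).toStarSubalgebra) :
    ⟪(lp.single 2 1 (hat τ b) : L2M G τ), rightM σ (.op y) (lp.single 2 1 (hat τ b))⟫_ℂ =
      ⟪mulA τ b (rightM σ (.op (star y)) (vecU τ 1) 1), hat τ b⟫_ℂ := by
  have h1 : (lp.single 2 1 (hat τ b) : L2M G τ) =
      (elemM σ b 1 : L2M G τ →L[ℂ] L2M G τ) (vecU τ 1) := by
    rw [elemM_one_coe, vecU, opA_single, mulA_hat, mul_one]
  have h2 := DFunLike.congr_fun (rightM_commute σ (elemM σ b 1) (star y)) (vecU τ 1)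
  simp only [mul_apply_eq_comp] at h2
  rw [← ContinuousLinearMap.adjoint_inner_left, ← ContinuousLinearMap.star_eq_adjoint, ← map_star,
    ← MulOpposite.op_star, lp.inner_single_right]
  conv_lhs => rw [h1, ← h2, elemM_one_coe, opA_apply]

lemma inv_mul_inv_mul_eq_div_sq (r : ℝ) (u v : ℂ) :
    ((r⁻¹ : ℝ) : ℂ) * (((r⁻¹ : ℝ) : ℂ) * (u * v)) = u / ((r ^ 2 : ℝ) : ℂ) * v := by
  push_cast
  ring

/-- The coefficient of ‖b‖⁻¹ b̂ ⊗ b̂ is ⟨b̂, x b̂⟩⟨b̂, b̂ y⟩/‖b‖², which equals the pairing of b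
E(y*) with the projection of b E(x) onto the line of b̂. Summed over a fine partition of unity,
these approximate ⟨E(y*), E(x)⟩ = τ(E(x)E(y)). -/
theorem coefTerm_mem_coarse (σ : TraceAction G τ) :
    coefTerm σ 1 ∈ (coarseBimodule σ).coefCone := by
  classical
  refine mem_closure_of_forall_finset₂ fun F ε hε => ?_
  obtain ⟨t, b, h⟩ := exists_partition_inner τ F
    (fun y => rightM σ (.op (star y)) (vecU τ 1) 1)
    (fun x : (crossedProduct σ).toStarSubalgebra =>
      (x : L2M G τ →L[ℂ] L2M G τ) (vecU τ 1) 1) hε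
  -- If b̂ = 0, the inverse norm is 0 by convention; the vector vanishes, and so does the projection
  -- onto the line of b̂.
  let θ : A → HTensor (L2M G τ) (L2M G τ) := fun b =>
    ((‖hat τ b‖⁻¹ : ℝ) : ℂ) • htmul (lp.single 2 1 (hat τ b)) (lp.single 2 1 (hat τ b))
  refine ⟨∑ i, (coarseBimodule σ).coef (θ (b i)),
    sum_mem fun i _ => AddSubmonoid.subset_closure ⟨_, rfl⟩, fun x hx y hy => ?_⟩
  refine lt_of_eq_of_lt ?_ (h x hx y hy)
  simp only [Finset.sum_apply]
  congr 2
  refine Finset.sum_congr rfl fun i _ => ?_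
  have h1 : (coarseBimodule σ).act x (θ (b i)) y = ((‖hat τ (b i)‖⁻¹ : ℝ) : ℂ) •
      htmul ((x : L2M G τ →L[ℂ] L2M G τ) (lp.single 2 1 (hat τ (b i))))
        (rightM σ (.op y) (lp.single 2 1 (hat τ (b i)))) := by
    change ampLeft _ _ (x : L2M G τ →L[ℂ] L2M G τ) (ampRight _ _ (rightM σ (.op y)) (θ (b i))) = _
    simp only [θ, map_smul, ampRight_htmul, ampLeft_htmul]
  rw [Bimodule.coef, h1]
  simp only [θ]
  rw [inner_smul_left, inner_smul_right, inner_htmul, inner_single_left_action,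
    inner_single_right_action, Submodule.starProjection_singleton, inner_smul_right,
    Complex.conj_ofReal]
  exact inv_mul_inv_mul_eq_div_sq _ _ _

end Coarse

end FellAbsorption

namespace FellAbsorption

/-! ### Matrix coefficients of the real regular representation -/

/-- The coefficients are nonnegative, which keeps the series inside a convex cone. The index starts
at k + 1 because the constant term is removed: the constant function 1 need not be a limit of
regular coefficients. -/
lemma hasSum_exp_two_mul_sub_one (x : ℝ) :
    HasSum (fun k : ℕ => (2 ^ (k + 1) / (k + 1).factorial : ℝ) * x ^ (k + 1))
      (Real.exp (2 * x) - 1) := by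
  have h := NormedSpace.expSeries_div_hasSum_exp (2 * x)
  rw [← Real.exp_eq_exp_ℝ, ← hasSum_nat_add_iff' 1] at h
  simp only [Finset.range_one, Finset.sum_singleton, pow_zero, Nat.factorial_zero,
    Nat.cast_one, div_one] at h
  convert! h using 1
  funext k
  rw [mul_pow]
  ring

section RegularCone

variable {Γ : Type*} [Group Γ] {ι : Type*}

/-- The matrix coefficients `g ↦ ⟨q_i, λ_g q_j⟩` of finitely supported functions. -/
noncomputable def regCoef (q : ι → Γ →₀ ℝ) : ι → ι → Γ → ℝ :=
  fun i j g => (q j).sum fun h c => q i (g * h) * c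

/-- The pointwise closure of the finite sums of matrix coefficients of the regular
representation. -/
noncomputable def regCone (Γ ι : Type*) [Group Γ] : AddSubmonoid (ι → ι → Γ → ℝ) :=
  (AddSubmonoid.closure (Set.range (regCoef (Γ := Γ) (ι := ι)))).topologicalClosure

lemma isClosed_regCone : IsClosed (regCone Γ ι : Set (ι → ι → Γ → ℝ)) :=
  AddSubmonoid.isClosed_topologicalClosure _

lemma regCoef_mem_regCone (q : ι → Γ →₀ ℝ) : regCoef q ∈ regCone Γ ι :=
  AddSubmonoid.le_topologicalClosure _ (AddSubmonoid.subset_closure ⟨q, rfl⟩)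

lemma regCoef_eq_sum (q : ι → Γ →₀ ℝ) {j : ι} {s : Finset Γ} (hs : (q j).support ⊆ s) (i : ι)
    (g : Γ) : regCoef q i j g = ∑ h ∈ s, q i (g * h) * q j h :=
  Finsupp.sum_of_support_subset _ hs _ (by simp)

/-- Fell's principle for the group: a product of coefficients is a coefficient of λ ⊗ λ, and for
each k the vectors δ_h ⊗ δ_{hk} span a copy of λ. Hence the product is the sum over k of the
coefficients of h ↦ q_i(h) r_i(hk). -/
lemma regCoef_mul_mem [Fintype ι] (q r : ι → Γ →₀ ℝ) : regCoef q * regCoef r ∈ regCone Γ ι := by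
  classical
  -- Only k = h⁻¹h' with h, h' in the supports of q_j and r_j contribute; finiteness of `ι` makes
  -- one finite set work for all j.
  let T : Finset Γ := Finset.univ.biUnion fun j =>
    ((q j).support ×ˢ (r j).support).image fun p => p.1⁻¹ * p.2
  let p : Γ → ι → Γ →₀ ℝ := fun k i =>
    Finsupp.onFinset (q i).support (fun h => q i h * r i (h * k)) fun h hh => by
      rw [Finsupp.mem_support_iff]
      exact left_ne_zero_of_mul hh
  have h : regCoef q * regCoef r = ∑ k ∈ T, regCoef (p k) := by
    ext i j g
    simp only [Finset.sum_apply, Pi.mul_apply]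
    have h1 : ∀ k, regCoef (p k) i j g =
        ∑ h ∈ (q j).support, q i (g * h) * q j h * (r i (g * (h * k)) * r j (h * k)) := fun k => by
      rw [regCoef_eq_sum (p k) (Finsupp.support_onFinset_subset)]
      refine Finset.sum_congr rfl fun h _ => ?_
      simp only [p, Finsupp.onFinset_apply, mul_assoc]
      ring
    simp only [h1]
    rw [Finset.sum_comm, regCoef_eq_sum q subset_rfl, regCoef_eq_sum r subset_rfl,
      Finset.sum_mul]
    refine Finset.sum_congr rfl fun h hh => ?_
    rw [← Finset.mul_sum]
    congr 1
    have h2 : ∑ k ∈ T, r i (g * (h * k)) * r j (h * k) =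
        ∑ k ∈ T.map (Equiv.mulLeft h).toEmbedding, r i (g * k) * r j k := by
      rw [Finset.sum_map]
      rfl
    rw [h2]
    refine Finset.sum_subset (fun k hk => ?_) fun k _ hk => ?_
    · refine Finset.mem_map.2 ⟨h⁻¹ * k, ?_, by simp⟩
      exact Finset.mem_biUnion.2 ⟨j, Finset.mem_univ _, Finset.mem_image.2
        ⟨(h, k), Finset.mem_product.2 ⟨hh, hk⟩, rfl⟩⟩
    · rw [Finsupp.notMem_support_iff.1 hk, mul_zero]
  rw [h]
  exact sum_mem fun k _ => regCoef_mem_regCone _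

/-- The closure is passed in one factor at a time, so only separate continuity of the product is
used. -/
lemma regCone_mul_mem [Fintype ι] {φ ψ : ι → ι → Γ → ℝ} (hφ : φ ∈ regCone Γ ι)
    (hψ : ψ ∈ regCone Γ ι) : φ * ψ ∈ regCone Γ ι := by
  have h1 : ∀ q, regCoef q * ψ ∈ regCone Γ ι := fun q =>
    map_mem_of_mem_topologicalClosure (AddMonoidHom.mulLeft (regCoef q))
      (continuous_const.mul continuous_id) isClosed_regCone
      (by rintro _ ⟨r, rfl⟩; exact regCoef_mul_mem q r) hψ
  exact map_mem_of_mem_topologicalClosure (AddMonoidHom.mulRight ψ)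
      (continuous_id.mul continuous_const) isClosed_regCone
      (by rintro _ ⟨q, rfl⟩; exact h1 q) hφ

lemma regCone_smul_mem {φ : ι → ι → Γ → ℝ} (hφ : φ ∈ regCone Γ ι) {c : ℝ} (hc : 0 ≤ c) :
    c • φ ∈ regCone Γ ι := by
  refine map_mem_of_mem_topologicalClosure (DistribSMul.toAddMonoidHom _ c)
    (continuous_const_smul c) isClosed_regCone ?_ hφ
  rintro _ ⟨q, rfl⟩
  have h : c • regCoef q = regCoef fun i => √c • q i := by
    ext i j g
    change c * _ = _
    rw [regCoef_eq_sum (fun i => √c • q i) (Finsupp.support_smul), regCoef_eq_sum q subset_rfl,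
      Finset.mul_sum]
    refine Finset.sum_congr rfl fun h _ => ?_
    simp only [Finsupp.smul_apply, smul_eq_mul]
    linear_combination (- q i (g * h) * q j h) * Real.mul_self_sqrt hc
  change c • regCoef q ∈ regCone Γ ι
  rw [h]
  exact regCoef_mem_regCone _

lemma regCone_pow_mem [Fintype ι] {φ : ι → ι → Γ → ℝ} (hφ : φ ∈ regCone Γ ι) (k : ℕ) :
    φ ^ (k + 1) ∈ regCone Γ ι := by
  induction k with
  | zero => simpa using hφ
  | succ k ih => rw [pow_succ]; exact regCone_mul_mem ih hφ

/-- The partial sums of the exponential series lie in the cone, and pointwise convergence suffices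
because the cone is closed. -/
lemma regCone_exp_mem [Fintype ι] {φ : ι → ι → Γ → ℝ} (hφ : φ ∈ regCone Γ ι) :
    (fun i j g => Real.exp (2 * φ i j g) - 1) ∈ regCone Γ ι := by
  have h2 : HasSum (fun k : ℕ => (2 ^ (k + 1) / (k + 1).factorial : ℝ) • φ ^ (k + 1))
      (fun i j g => Real.exp (2 * φ i j g) - 1) :=
    Pi.hasSum.2 fun i => Pi.hasSum.2 fun j => Pi.hasSum.2 fun g =>
      hasSum_exp_two_mul_sub_one (φ i j g)
  exact isClosed_regCone.mem_of_tendsto h2 (Filter.Eventually.of_forall fun s =>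
    sum_mem fun k _ => regCone_smul_mem (regCone_pow_mem hφ k) (by positivity))

/-- For finitely supported tuples, the tensors q_i ⊗ r_i, paired index by index, realize the product
as a coefficient of Γ × Γ'. Limits are then taken in each factor separately. -/
lemma regCone_prod_mem {Γ' : Type*} [Group Γ'] {φ : ι → ι → Γ → ℝ} {ψ : ι → ι → Γ' → ℝ}
    (hφ : φ ∈ regCone Γ ι) (hψ : ψ ∈ regCone Γ' ι) :
    (fun i j (g : Γ × Γ') => φ i j g.1 * ψ i j g.2) ∈ regCone (Γ × Γ') ι := by
  have h0 : ∀ (q : ι → Γ →₀ ℝ) (r : ι → Γ' →₀ ℝ),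
      (fun i j (g : Γ × Γ') => regCoef q i j g.1 * regCoef r i j g.2) ∈ regCone (Γ × Γ') ι := by
    intro q r
    let p : ι → Γ × Γ' →₀ ℝ := fun i =>
      Finsupp.onFinset ((q i).support ×ˢ (r i).support) (fun h => q i h.1 * r i h.2) fun h hh => by
        rw [Finset.mem_product, Finsupp.mem_support_iff, Finsupp.mem_support_iff]
        exact ⟨left_ne_zero_of_mul hh, right_ne_zero_of_mul hh⟩
    have h : (fun i j (g : Γ × Γ') => regCoef q i j g.1 * regCoef r i j g.2) = regCoef p := by
      ext i j g
      rw [regCoef_eq_sum p (Finsupp.support_onFinset_subset), regCoef_eq_sum q subset_rfl,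
        regCoef_eq_sum r subset_rfl, Finset.sum_mul_sum, Finset.sum_product]
      refine Finset.sum_congr rfl fun h _ => Finset.sum_congr rfl fun h' _ => ?_
      simp only [p, Finsupp.onFinset_apply, Prod.fst_mul, Prod.snd_mul]
      ring
    exact h ▸ regCoef_mem_regCone _
  have h1 : ∀ q : ι → Γ →₀ ℝ,
      (fun i j (g : Γ × Γ') => regCoef q i j g.1 * ψ i j g.2) ∈ regCone (Γ × Γ') ι := fun q => by
    refine map_mem_of_mem_topologicalClosure (B := ι → ι → Γ × Γ' → ℝ)
      { toFun := fun ψ i j g => regCoef q i j g.1 * ψ i j g.2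
        map_zero' := by ext; simp
        map_add' := fun _ _ => by ext; simp [mul_add] } ?_ isClosed_regCone ?_ hψ
    · change Continuous fun (ψ : ι → ι → Γ' → ℝ) i j (g : Γ × Γ') => regCoef q i j g.1 * ψ i j g.2
      fun_prop
    · rintro _ ⟨r, rfl⟩
      exact h0 q r
  refine map_mem_of_mem_topologicalClosure (B := ι → ι → Γ × Γ' → ℝ)
    { toFun := fun φ i j g => φ i j g.1 * ψ i j g.2
      map_zero' := by ext; simp
      map_add' := fun _ _ => by ext; simp [add_mul] } ?_ isClosed_regCone ?_ hφ
  · change Continuous fun (φ : ι → ι → Γ → ℝ) i j (g : Γ × Γ') => φ i j g.1 * ψ i j g.2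
    fun_prop
  · rintro _ ⟨q, rfl⟩
    exact h1 q

end RegularCone

/-! ### Tuples of vectors of an orthogonal representation -/

section OrthTuples

variable {Γ : Type*} [Group Γ] {ι : Type*}
  {V : Type*} [NormedAddCommGroup V] [InnerProductSpace ℝ V]

/-- The matrix coefficients of a tuple of vectors. -/
noncomputable def orthCoef (π : Γ →* (V ≃ₗᵢ[ℝ] V)) (v : ι → V) : ι → ι → Γ → ℝ :=
  fun i j g => ⟪v i, π g (v j)⟫_ℝ

lemma continuous_orthCoef (π : Γ →* (V ≃ₗᵢ[ℝ] V)) :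
    Continuous (orthCoef π : (ι → V) → ι → ι → Γ → ℝ) := by
  unfold orthCoef
  fun_prop

open scoped Classical in
lemma regularRep_single (g h : Γ) (c : ℝ) :
    regularRep Γ g (lp.single 2 h c) = lp.single 2 (g * h) c := by
  ext k
  change (lp.single 2 h c : L2Sum Γ ℝ) (g⁻¹ * k) = _
  by_cases hk : k = g * h
  · subst hk; simp
  · have : g⁻¹ * k ≠ h := fun h' => hk (by rw [← h']; simp)
    simp [hk, this]

/-- Truncations to finite subsets of Γ converge in norm, and coefficients depend continuously on the
vectors. -/
lemma orthCoef_regularRep_mem (η : ι → L2Sum Γ ℝ) :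
    orthCoef (regularRep Γ) η ∈ regCone Γ ι := by
  classical
  let η' : Finset Γ → ι → L2Sum Γ ℝ := fun s i => ∑ h ∈ s, lp.single 2 h (η i h)
  have h1 : Filter.Tendsto η' Filter.atTop (nhds η) :=
    tendsto_pi_nhds.2 fun i => lp.hasSum_single (p := 2) (E := fun _ : Γ => ℝ) (by simp) (η i)
  refine isClosed_regCone.mem_of_tendsto ((continuous_orthCoef _).tendsto η |>.comp h1)
    (Filter.Eventually.of_forall fun s => ?_)
  let q : ι → Γ →₀ ℝ := fun i => Finsupp.indicator s fun h _ => η i h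
  have h2 : ∀ i k, η' s i k = q i k := fun i k => by
    simp only [η', q, Finsupp.indicator_apply, lp.coeFn_sum, Finset.sum_apply]
    by_cases hk : k ∈ s
    · rw [Finset.sum_eq_single k]
      · simp [hk]
      · intro b _ hb; simp [hb.symm]
      · exact fun h => (h hk).elim
    · rw [Finset.sum_eq_zero]
      · simp [hk]
      · intro b hb
        have : k ≠ b := fun h => hk (h ▸ hb)
        simp [this]
  have h3 : orthCoef (regularRep Γ) (η' s) = regCoef q := by
    ext i j g
    rw [regCoef_eq_sum q (s := s) (Finsupp.support_indicator_subset _ _), orthCoef]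
    have h4 : regularRep Γ g (η' s j) = ∑ h ∈ s, lp.single 2 (g * h) (η j h) := by
      simp only [η', map_sum, regularRep_single]
    rw [h4, inner_sum]
    refine Finset.sum_congr rfl fun h hh => ?_
    rw [lp.inner_single_right, h2]
    simp [q, hh, mul_comm]
  change orthCoef (regularRep Γ) (η' s) ∈ regCone Γ ι
  rw [h3]
  exact regCoef_mem_regCone q

/-- The coefficients of the tuple `(∑_h a_i(h) π_h ξ)_i` in terms of the coefficient of `ξ`. -/
noncomputable def cyclicTransform (a : ι → Γ →₀ ℝ) : (Γ → ℝ) →+ (ι → ι → Γ → ℝ) where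
  toFun φ := fun i j g => (a i).sum fun h c => (a j).sum fun h' c' => c * (c' * φ (h⁻¹ * g * h'))
  map_zero' := by ext; simp
  map_add' φ ψ := by ext; simp [mul_add, Finsupp.sum_add]

lemma continuous_cyclicTransform (a : ι → Γ →₀ ℝ) : Continuous (cyclicTransform a) := by
  change Continuous fun (φ : Γ → ℝ) (i j : ι) (g : Γ) =>
    ∑ h ∈ (a i).support, ∑ h' ∈ (a j).support, a i h * (a j h' * φ (h⁻¹ * g * h'))
  fun_prop

/-- All coefficients of a tuple in the span of one orbit are determined, additively and
continuously, by the coefficient of the single vector ξ; the same formula applied to η in ℓ²(Γ)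
produces a tuple there. -/
lemma orthCoef_linearCombination (π : Γ →* (V ≃ₗᵢ[ℝ] V)) (ξ : V) (a : ι → Γ →₀ ℝ) :
    orthCoef π (fun i => Finsupp.linearCombination ℝ (fun h => π h ξ) (a i)) =
      cyclicTransform a fun g => ⟪ξ, π g ξ⟫_ℝ := by
  ext i j g
  change _ = ∑ h ∈ (a i).support, ∑ h' ∈ (a j).support, a i h * (a j h' * ⟪ξ, π (h⁻¹ * g * h') ξ⟫_ℝ)
  simp only [orthCoef, Finsupp.linearCombination_apply, Finsupp.sum, map_sum, map_smul, sum_inner,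
    inner_sum, inner_smul_left, inner_smul_right]
  simp only [Finset.mul_sum]
  rw [Finset.sum_comm]
  refine Finset.sum_congr rfl fun h _ => Finset.sum_congr rfl fun h' _ => ?_
  have h1 : ⟪π h ξ, π g (π h' ξ)⟫_ℝ = ⟪ξ, π (h⁻¹ * g * h') ξ⟫_ℝ := by
    rw [← LinearIsometryEquiv.inner_map_map (π h) ξ]
    congr 1
    change (π g * π h') ξ = (π h * π (h⁻¹ * g * h')) ξ
    rw [← map_mul, ← map_mul]
    congr 2
    group
  rw [h1]
  simp
  try ring

variable [CompleteSpace V]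

/-- Weak containment is a statement about one vector, and inside a cyclic subspace one vector
controls every tuple: first tuples in the span of the orbit, then norm limits of these. -/
lemma orthCoef_mem_of_cyclic {π : Γ →* (V ≃ₗᵢ[ℝ] V)}
    (hπ : OrthWeaklyContained π (regularRep Γ)) (ξ : V) {v : ι → V}
    (hv : ∀ i, v i ∈ (Submodule.span ℝ (Set.range fun g => π g ξ)).topologicalClosure) :
    orthCoef π v ∈ regCone Γ ι := by
  have h1 : (fun g => ⟪ξ, π g ξ⟫_ℝ) ∈ (AddSubmonoid.closure (Set.range fun (η : L2Sum Γ ℝ)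
      (g : Γ) => ⟪η, regularRep Γ g η⟫_ℝ)).topologicalClosure := by
    refine mem_closure_of_forall_finset fun F ε hε => ?_
    obtain ⟨n, η, h⟩ := hπ ξ F ε hε
    refine ⟨∑ i, fun g => ⟪η i, regularRep Γ g (η i)⟫_ℝ,
      sum_mem fun i _ => AddSubmonoid.subset_closure ⟨η i, rfl⟩, fun g hg => ?_⟩
    simpa using h g hg
  have h2 : ∀ a : ι → Γ →₀ ℝ,
      orthCoef π (fun i => Finsupp.linearCombination ℝ (fun h => π h ξ) (a i)) ∈ regCone Γ ι := by
    intro a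
    rw [orthCoef_linearCombination]
    refine map_mem_of_mem_topologicalClosure _ (continuous_cyclicTransform a) isClosed_regCone ?_ h1
    rintro _ ⟨η, rfl⟩
    rw [← orthCoef_linearCombination]
    exact orthCoef_regularRep_mem _
  have h3 : v ∈ closure (Set.pi Set.univ fun _ : ι =>
      (Submodule.span ℝ (Set.range fun g => π g ξ) : Set V)) := by
    rw [closure_pi_set]
    exact fun i _ => hv i
  refine closure_minimal (t := (orthCoef π) ⁻¹' (regCone Γ ι : Set (ι → ι → Γ → ℝ))) ?_
    (isClosed_regCone.preimage (continuous_orthCoef π)) h3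
  intro w hw
  have h4 : ∀ i, ∃ a : Γ →₀ ℝ, Finsupp.linearCombination ℝ (fun h => π h ξ) a = w i := fun i =>
    (Finsupp.mem_span_range_iff_exists_finsupp.1 (hw i (Set.mem_univ i)))
  choose a ha using h4
  have h5 := h2 a
  simp only [ha] at h5
  exact h5

/-- Weak containment in the regular representation holds for matrix coefficients of tuples. -/
theorem orthCoef_mem_regCone [Fintype ι] {π : Γ →* (V ≃ₗᵢ[ℝ] V)}
    (hπ : OrthWeaklyContained π (regularRep Γ)) (v : ι → V) : orthCoef π v ∈ regCone Γ ι := by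
  classical
  -- Induction on a set of indices outside which the tuple vanishes.
  suffices h : ∀ (S : Finset ι) (v : ι → V), (∀ i ∉ S, v i = 0) → orthCoef π v ∈ regCone Γ ι from
    h Finset.univ v fun i hi => (hi (Finset.mem_univ i)).elim
  intro S
  induction S using Finset.induction_on with
  | empty =>
    intro v hv
    have h : orthCoef π v = 0 := by
      ext i j g
      simp [orthCoef, hv]
    rw [h]
    exact zero_mem _
  | insert a S ha ih =>
    intro v hv
    -- The cyclic subspace of v_a. By invariance, coefficients between C and its complement vanish,
    -- so the tuple's coefficients split into a cyclic part and those of the complementary tuple,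
    -- whose entry at a is zero because v_a lies in C.
    set C := (Submodule.span ℝ (Set.range fun g => π g (v a))).topologicalClosure with hC
    have hcl : IsClosed (C : Set V) := Submodule.isClosed_topologicalClosure _
    have : CompleteSpace C := hcl.completeSpace_coe
    have hmem : ∀ g, π g (v a) ∈ C := fun g =>
      Submodule.le_topologicalClosure _ (Submodule.subset_span ⟨g, rfl⟩)
    have hinv : ∀ g, ∀ x ∈ C, π g x ∈ C := fun g x hx => by
      have hle : C ≤ C.comap (π g).toLinearEquiv.toLinearMap :=
        Submodule.topologicalClosure_minimal _ (Submodule.span_le.2 (by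
          rintro _ ⟨h, rfl⟩
          change (π g * π h) (v a) ∈ C
          rw [← map_mul]
          exact hmem _)) (hcl.preimage (π g).continuous)
      exact hle hx
    let d : ι → V := fun i => v i - C.starProjection (v i)
    have hd : ∀ i, d i ∈ Cᗮ := fun i => Submodule.sub_starProjection_mem_orthogonal _
    have hc : ∀ i, C.starProjection (v i) ∈ C := fun i => Submodule.starProjection_apply_mem C _
    have h1 : orthCoef π v = orthCoef π (fun i => C.starProjection (v i)) + orthCoef π d := by
      ext i j g
      have e1 : ⟪d i, π g (C.starProjection (v j))⟫_ℝ = 0 :=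
        (Submodule.mem_orthogonal' _ _).1 (hd i) _ (hinv g _ (hc j))
      have e2 : ⟪C.starProjection (v i), π g (d j)⟫_ℝ = 0 := by
        have e3 : C.starProjection (v i) = π g (π g⁻¹ (C.starProjection (v i))) := by
          change _ = (π g * π g⁻¹) _
          rw [← map_mul, mul_inv_cancel, map_one]
          rfl
        rw [e3, LinearIsometryEquiv.inner_map_map]
        exact (Submodule.mem_orthogonal _ _).1 (hd j) _ (hinv _ _ (hc i))
      have e4 : ∀ i, v i = C.starProjection (v i) + d i := fun i => by simp [d]
      change ⟪v i, π g (v j)⟫_ℝ = _ + ⟪d i, π g (d j)⟫_ℝ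
      conv_lhs => rw [e4 i, e4 j, map_add, inner_add_left, inner_add_right, inner_add_right, e1, e2]
      simp [orthCoef]
    rw [h1]
    refine add_mem (orthCoef_mem_of_cyclic hπ (v a) hc) (ih d fun i hi => ?_)
    by_cases hia : i = a
    · subst hia
      have h2 : v i ∈ C := by simpa using hmem 1
      simp only [d]
      rw [Submodule.starProjection_eq_self_iff.2 h2, sub_self]
    · simp [d, hv i (by simp [hia, hi])]

end OrthTuples

end FellAbsorption

namespace FellAbsorption

/-! ### Multiples of the complex regular representation -/

section RegRep

variable {G : Type*} [Group G] {J : Type*}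

/-- The left regular representation of `G` on `ℓ²(G × J)`. -/
noncomputable def regRep (G J : Type*) [Group G] :
    G →* (L2Sum (G × J) ℂ ≃ₗᵢ[ℂ] L2Sum (G × J) ℂ) where
  toFun g := l2sumCongr ((Equiv.mulLeft g⁻¹).prodCongr (Equiv.refl J))
    (fun _ => LinearIsometryEquiv.refl ℂ ℂ)
  map_one' := by
    ext f h
    change f (1⁻¹ * h.1, h.2) = f h
    simp
  map_mul' g g' := by
    ext f h
    change f ((g * g')⁻¹ * h.1, h.2) = f (g'⁻¹ * (g⁻¹ * h.1), h.2)
    simp [mul_assoc]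

lemma regRep_apply (g : G) (f : L2Sum (G × J) ℂ) (h : G × J) :
    regRep G J g f h = f (g⁻¹ * h.1, h.2) := rfl

lemma regRep_single [DecidableEq (G × J)] (g h : G) (j : J) (c : ℂ) :
    regRep G J g (lp.single 2 (h, j) c) = lp.single 2 (g * h, j) c := by
  ext k
  rw [regRep_apply]
  by_cases hk : k = (g * h, j)
  · subst hk; simp
  · have : (g⁻¹ * k.1, k.2) ≠ (h, j) := fun h' => hk (by
      obtain ⟨h1, h2⟩ := Prod.ext_iff.1 h'
      exact Prod.ext (eq_mul_of_inv_mul_eq h1) h2)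
    rw [lp.single_apply_ne (hij := hk)]
    exact lp.single_apply_ne (hij := this) ..

lemma total_single_one (X : Type*) [DecidableEq X] : Total fun x : X => (lp.single 2 x 1 : L2Sum X ℂ) := by
  intro f hf
  ext x
  have := hf x
  rw [lp.inner_single_left] at this
  simpa using this

lemma orthonormal_single_one (X : Type*) [DecidableEq X] :
    Orthonormal ℂ fun x : X => (lp.single 2 x 1 : L2Sum X ℂ) := by
  rw [orthonormal_iff_ite]
  intro x y
  rw [lp.inner_single_left]
  by_cases h : x = y
  · subst h; simp
  · simp [h]

lemma regRep_basis [DecidableEq (G × J)] (i : G × J) : regRep G J i.1 (lp.single 2 (1, i.2) 1) =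
    (lp.single 2 i 1 : L2Sum (G × J) ℂ) := by
  rw [regRep_single, mul_one]

/-- A finitely supported real function as a vector of `ℓ²(G)`. -/
noncomputable def finsuppVec (q : G →₀ ℝ) : L2Sum (G × Unit) ℂ :=
  open scoped Classical in ∑ h ∈ q.support, lp.single 2 (h, ()) ((q h : ℝ) : ℂ)

lemma finsuppVec_apply (q : G →₀ ℝ) (k : G × Unit) : finsuppVec q k = (q k.1 : ℂ) := by
  classical
  rw [finsuppVec, lp.coeFn_sum, Finset.sum_apply]
  by_cases hk : q k.1 = 0
  · rw [hk, Finset.sum_eq_zero]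
    · simp
    · intro h hh
      have : k ≠ (h, ()) := fun h' => Finsupp.mem_support_iff.1 hh (by rw [h'] at hk; exact hk)
      exact lp.single_apply_ne (hij := this) ..
  · rw [Finset.sum_eq_single k.1]
    · exact lp.single_apply_self ..
    · intro h _ hh
      have : k ≠ (h, ()) := fun h' => hh (by rw [h'])
      exact lp.single_apply_ne (hij := this) ..
    · exact fun h => (h (Finsupp.mem_support_iff.2 hk)).elim

lemma inner_finsuppVec {ι : Type*} (q : ι → G →₀ ℝ) (i j : ι) (g : G) :
    ⟪finsuppVec (q i), regRep G Unit g (finsuppVec (q j))⟫_ℂ = (regCoef q i j g : ℂ) := by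
  classical
  rw [finsuppVec.eq_1 (q j), map_sum, inner_sum, regCoef_eq_sum q subset_rfl, Complex.ofReal_sum]
  refine Finset.sum_congr rfl fun h _ => ?_
  rw [regRep_single, lp.inner_single_right, finsuppVec_apply]
  simp [mul_comm]

/-- Cauchy–Schwarz for one tuple, weakened to a sum so that it is additive in ψ and survives finite
sums. The bound is uniform in g but involves only values at 1, which pointwise convergence controls.
-/
lemma abs_le_of_mem_closure_regCoef {ι : Type*} {ψ : ι → ι → G → ℝ}
    (hψ : ψ ∈ AddSubmonoid.closure (Set.range (regCoef (Γ := G) (ι := ι)))) (i j : ι) (g : G) :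
    |ψ i j g| ≤ ψ i i 1 + ψ j j 1 := by
  induction hψ using AddSubmonoid.closure_induction with
  | mem ψ hψ =>
    obtain ⟨q, rfl⟩ := hψ
    have h1 : ∀ i, ‖finsuppVec (q i)‖ ^ 2 = regCoef q i i 1 := fun i => by
      have h2 := inner_finsuppVec q i i 1
      rw [map_one, LinearIsometryEquiv.coe_one, id, inner_self_eq_norm_sq_to_K] at h2
      exact Complex.ofReal_injective (by rw [← h2]; push_cast; rfl)
    have h3 := norm_inner_le_norm (𝕜 := ℂ) (finsuppVec (q i))
      (regRep G Unit g (finsuppVec (q j)))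
    rw [inner_finsuppVec, LinearIsometryEquiv.norm_map, Complex.norm_real, Real.norm_eq_abs] at h3
    rw [← h1, ← h1]
    nlinarith [sq_nonneg (‖finsuppVec (q i)‖ - ‖finsuppVec (q j)‖),
      sq_nonneg ‖finsuppVec (q i)‖, sq_nonneg ‖finsuppVec (q j)‖]
  | zero => simp
  | add φ ψ _ _ hφ hψ =>
    refine (abs_add_le _ _).trans ((add_le_add hφ hψ).trans_eq ?_)
    simp only [Pi.add_apply]
    ring

end RegRep

/-! ### Weak containment of `L²(A) ⊗ P ⊗ ℓ²(G)` -/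

section WeakContainment

variable {A : Type*} [CommCStarAlgebra A] [PartialOrder A] [StarOrderedRing A]
  {τ : A →ₚ[ℂ] ℂ} {G : Type*} [Group G]
  {P : Type*} [NormedAddCommGroup P] [InnerProductSpace ℂ P] [CompleteSpace P]

/-- The coefficient of `∑_k c_k (1 ⊗ p_k ⊗ δ_1) m_k` in terms of the functions
`g ↦ ⟨p_k, ρ_g p_l⟩`. -/
noncomputable def tupleCoef (σ : TraceAction G τ) {n : ℕ} (c : Fin n → ℂ)
    (m : Fin n → (crossedProduct σ).toStarSubalgebra) (φ : Fin n → Fin n → G → ℝ) :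
    (crossedProduct σ).toStarSubalgebra → (crossedProduct σ).toStarSubalgebra → ℂ :=
  fun x y => ∑ k, ∑ l, starRingEnd ℂ (c k) * c l *
    ∑' g, coefTerm σ g x (m l * y * star (m k)) * (φ k l g : ℂ)

lemma coef_eq_tupleCoef (σ : TraceAction G τ) (ρ : G →* (P ≃ₗᵢ[ℂ] P)) {n : ℕ} (c : Fin n → ℂ)
    (m : Fin n → (crossedProduct σ).toStarSubalgebra) (p : Fin n → P)
    {φ : Fin n → Fin n → G → ℝ} (h : ∀ k l g, ⟪p k, ρ g (p l)⟫_ℂ = φ k l g) :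
    (repBimodule σ ρ).coef (∑ k, c k • (repBimodule σ ρ).act 1 (repVec G τ (p k)) (m k)) =
      tupleCoef σ c m φ := by
  ext x y
  simp only [Bimodule.coef, tupleCoef, ← Bimodule.actL_apply, map_sum, map_smul, sum_inner,
    inner_sum, inner_smul_left, inner_smul_right]
  rw [Finset.sum_comm]
  refine Finset.sum_congr rfl fun l _ => ?_
  rw [Finset.mul_sum]
  refine Finset.sum_congr rfl fun k _ => ?_
  simp only [Bimodule.actL_apply, Bimodule.act_act, Bimodule.inner_act_act, inner_repVec, h]
  rw [star_one, one_mul, mul_one]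
  ring

lemma summable_coefTerm_mul (σ : TraceAction G τ) (x y : (crossedProduct σ).toStarSubalgebra)
    {φ : G → ℝ} {R : ℝ} (hφ : ∀ g, |φ g| ≤ R) : Summable fun g => coefTerm σ g x y * (φ g : ℂ) := by
  refine Summable.of_norm_bounded ((summable_norm_coefTerm σ x y).mul_right R) fun g => ?_
  rw [norm_mul, Complex.norm_real, Real.norm_eq_abs]
  exact mul_le_mul_of_nonneg_left (hφ g) (norm_nonneg _)

/-- For φ a regular coefficient, `tupleCoef` is a coefficient of the bimodule of the regular
representation, which is generated by one vector with coefficient `coefTerm σ 1`. For limits,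
pointwise convergence alone does not control the infinite sum over g, but the bound by the values at
1 permits dominated convergence. -/
lemma tupleCoef_mem (σ : TraceAction G τ) {n : ℕ} (c : Fin n → ℂ)
    (m : Fin n → (crossedProduct σ).toStarSubalgebra) {L : Type*} [NormedAddCommGroup L]
    [InnerProductSpace ℂ L] [CompleteSpace L] {C : Bimodule (crossedProduct σ) L}
    (hC : coefTerm σ 1 ∈ C.coefCone) {φ : Fin n → Fin n → G → ℝ} (hφ : φ ∈ regCone G (Fin n)) :
    tupleCoef σ c m φ ∈ C.coefCone := by
  classical
  set S := AddSubmonoid.closure (Set.range (regCoef (Γ := G) (ι := Fin n))) with hS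
  have h1 : ∀ ψ ∈ S, tupleCoef σ c m ψ ∈ C.coefCone := by
    intro ψ hψ
    induction hψ using AddSubmonoid.closure_induction with
    | mem ψ hψ =>
      obtain ⟨q, rfl⟩ := hψ
      rw [← coef_eq_tupleCoef σ (regRep G Unit) c m (fun k => finsuppVec (q k))
        (inner_finsuppVec q)]
      refine coef_repBimodule_mem σ (regRep G Unit) (p := lp.single 2 (1, ()) 1) ?_ ?_ hC _
      · simp only [regRep_single, mul_one]
        exact (orthonormal_single_one (G × Unit)).comp (fun g : G => (g, ()))
          fun a b h => (Prod.ext_iff.1 h).1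
      · simp only [regRep_single, mul_one]
        exact (total_single_one (G × Unit)).comp_surjective (f := fun g : G => (g, ()))
          fun g => ⟨g.1, rfl⟩
    | zero =>
      have h : tupleCoef σ c m 0 = 0 := by
        ext x y
        simp [tupleCoef]
      exact h ▸ zero_mem _
    | add φ ψ hφ' hψ' hφ hψ =>
      have h : tupleCoef σ c m (φ + ψ) = tupleCoef σ c m φ + tupleCoef σ c m ψ := by
        ext x y
        simp only [tupleCoef, Pi.add_apply, ← Finset.sum_add_distrib, ← mul_add]
        refine Finset.sum_congr rfl fun k _ => Finset.sum_congr rfl fun l _ => ?_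
        rw [← Summable.tsum_add
          (summable_coefTerm_mul σ _ _ (abs_le_of_mem_closure_regCoef hφ' k l))
          (summable_coefTerm_mul σ _ _ (abs_le_of_mem_closure_regCoef hψ' k l))]
        simp only [Complex.ofReal_add, mul_add]
      exact h ▸ add_mem hφ hψ
  -- The limit is taken along the filter of neighbourhoods of φ within the finite sums; dominated
  -- convergence for series is valid along any filter.
  have hne : (nhdsWithin φ (S : Set (Fin n → Fin n → G → ℝ))).NeBot :=
    mem_closure_iff_nhdsWithin_neBot.1 hφ
  refine C.isClosed_coefCone.mem_of_tendsto
    (b := nhdsWithin φ (S : Set (Fin n → Fin n → G → ℝ))) (f := tupleCoef σ c m) ?_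
    (by filter_upwards [self_mem_nhdsWithin] with ψ hψ using h1 ψ hψ)
  refine tendsto_pi_nhds.2 fun x => tendsto_pi_nhds.2 fun y => ?_
  refine tendsto_finsetSum _ fun k _ => tendsto_finsetSum _ fun l _ =>
    Filter.Tendsto.const_mul _ ?_
  have hev : ∀ k l : Fin n, ∀ g : G, Filter.Tendsto (fun ψ : Fin n → Fin n → G → ℝ => ψ k l g)
      (nhdsWithin φ (S : Set (Fin n → Fin n → G → ℝ))) (nhds (φ k l g)) := fun k l g =>
    (Continuous.tendsto (by fun_prop : Continuous fun ψ : Fin n → Fin n → G → ℝ => ψ k l g)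
      φ).mono_left nhdsWithin_le_nhds
  -- Near φ the values ψ_kk(1) and ψ_ll(1) exceed those of φ by less than 1, which explains the two
  -- added units in the bound.
  refine tendsto_tsum_of_dominated_convergence
    (bound := fun g => ‖coefTerm σ g x (m l * y * star (m k))‖ * (φ k k 1 + 1 + (φ l l 1 + 1)))
    ((summable_norm_coefTerm σ _ _).mul_right _) (fun g => ?_) ?_
  · exact ((Complex.continuous_ofReal.tendsto _).comp (hev k l g)).const_mul _
  · filter_upwards [self_mem_nhdsWithin, (hev k k 1).eventually (gt_mem_nhds (lt_add_one _)),
      (hev l l 1).eventually (gt_mem_nhds (lt_add_one _))] with ψ hψ hk hl g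
    rw [norm_mul, Complex.norm_real, Real.norm_eq_abs]
    refine mul_le_mul_of_nonneg_left ?_ (norm_nonneg _)
    have := abs_le_of_mem_closure_regCoef hψ k l g
    linarith

/-- If the matrix coefficients of a total family of vectors of `P` are approximated by those of
the regular representation, then `L²(A) ⊗ P ⊗ ℓ²(G)` is weakly contained in any bimodule
approximating `(x, y) ↦ τ(E(x) E(y))`. -/
theorem repBimodule_weaklyContained (σ : TraceAction G τ) (ρ : G →* (P ≃ₗᵢ[ℂ] P)) {I : Type*}
    {t : I → P} (ht : Total t) {φ : I → I → G → ℝ} (h : ∀ i j g, ⟪t i, ρ g (t j)⟫_ℂ = φ i j g)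
    (hφ : ∀ (n : ℕ) (f : Fin n → I), (fun k l => φ (f k) (f l)) ∈ regCone G (Fin n))
    {L : Type*} [NormedAddCommGroup L] [InnerProductSpace ℂ L] [CompleteSpace L]
    {C : Bimodule (crossedProduct σ) L} (hC : coefTerm σ 1 ∈ C.coefCone) :
    (repBimodule σ ρ).WeaklyContained C := by
  refine Bimodule.weaklyContained_of_coef_mem fun ζ => ?_
  have h1 := (total_repVec_right σ ρ ht).topologicalClosure_span
  have h2 := (Submodule.dense_iff_topologicalClosure_eq_top).2 h1
  refine closure_minimal (t := (repBimodule σ ρ).coef ⁻¹' (C.coefCone : Set _)) ?_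
    (C.isClosed_coefCone.preimage (repBimodule σ ρ).continuous_coef) (h2 ζ)
  intro ζ' hζ'
  obtain ⟨n, c, f, rfl⟩ := Submodule.mem_span_set'.1 hζ'
  choose i hi using fun k => (f k).2
  simp only [← hi]
  change (repBimodule σ ρ).coef (∑ k, c k • (repBimodule σ ρ).act 1 (repVec G τ (t (i k).1)) (i k).2)
    ∈ C.coefCone
  rw [coef_eq_tupleCoef σ ρ c (fun k => (i k).2) (fun k => t (i k).1)
    (φ := fun k l => φ (i k).1 (i l).1) fun k l g => h _ _ g]
  exact tupleCoef_mem σ c _ hC (hφ n fun k => (i k).1)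

end WeakContainment

end FellAbsorption

namespace FellAbsorption

/-! ### The centered exponential vectors of the Gaussian construction -/

namespace GaussianConstruction

variable {Y : Type*} [MeasurableSpace Y] {ν : Measure Y} [IsProbabilityMeasure ν]
  {V : Type*} [NormedAddCommGroup V] [InnerProductSpace ℝ V] (Ω : GaussianConstruction V ν)

lemma inner_one_vec (ξ : V) : ⟪one ν, Ω.vec ξ⟫_ℂ = Real.exp (-‖ξ‖ ^ 2) := by
  rw [← Ω.vec_zero, inner_vec, sub_zero]

lemma inner_vec_one (ξ : V) : ⟪Ω.vec ξ, one ν⟫_ℂ = Real.exp (-‖ξ‖ ^ 2) := by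
  rw [← Ω.vec_zero, inner_vec, zero_sub, norm_neg]

lemma inner_one_one : ⟪one ν, one ν⟫_ℂ = 1 := by
  rw [L2.inner_def, integral_congr_ae (g := fun _ => (1 : ℂ))]
  · simp
  · filter_upwards [coeFn_one (ν := ν)] with y h
    rw [h]
    simp

/-- The vector `exp(‖ξ‖²) ω(ξ) - 1` of `L²₀(Y, ν)`. -/
noncomputable def expVec (ξ : V) : L20 ν :=
  ⟨((Real.exp (‖ξ‖ ^ 2) : ℝ) : ℂ) • Ω.vec ξ - one ν, by
    rw [Submodule.mem_orthogonal_singleton_iff_inner_right, inner_sub_right, inner_smul_right,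
      Ω.inner_one_vec, inner_one_one, ← Complex.ofReal_mul, ← Real.exp_add]
    simp⟩

lemma expVec_coe (ξ : V) : (Ω.expVec ξ : Lp ℂ 2 ν) =
    ((Real.exp (‖ξ‖ ^ 2) : ℝ) : ℂ) • Ω.vec ξ - one ν := rfl

/-- The factors exp(‖ξ‖²) and exp(‖η‖²) cancel the diagonal part of exp(-‖η - ξ‖²), leaving exp(2⟨ξ,
η⟩); removing the component along 1 subtracts 1. -/
lemma inner_expVec (ξ η : V) :
    ⟪Ω.expVec ξ, Ω.expVec η⟫_ℂ = ((Real.exp (2 * ⟪ξ, η⟫_ℝ) - 1 : ℝ) : ℂ) := by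
  rw [Submodule.coe_inner, expVec_coe, expVec_coe, inner_sub_left, inner_sub_right,
    inner_sub_right, inner_smul_left, inner_smul_left, inner_smul_right, inner_smul_right,
    inner_vec, Ω.inner_one_vec, Ω.inner_vec_one, inner_one_one, Complex.conj_ofReal]
  norm_cast
  have h1 : Real.exp (‖ξ‖ ^ 2) * (Real.exp (‖η‖ ^ 2) * Real.exp (-‖η - ξ‖ ^ 2)) =
      Real.exp (2 * ⟪ξ, η⟫_ℝ) := by
    rw [← Real.exp_add, ← Real.exp_add, norm_sub_sq_real, real_inner_comm]
    congr 1
    ring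
  have h2 : ∀ ζ : V, Real.exp (‖ζ‖ ^ 2) * Real.exp (-‖ζ‖ ^ 2) = 1 := fun ζ => by
    rw [← Real.exp_add]
    simp
  rw [h1, h2, h2]
  ring

/-- On vectors orthogonal to constants, pairing with `expVec ξ` is a positive multiple of pairing
with ω(ξ), and the latter vectors span a dense subspace. -/
lemma total_expVec : Total Ω.expVec := by
  intro x hx
  have h1 : ∀ ξ, ⟪Ω.vec ξ, (x : Lp ℂ 2 ν)⟫_ℂ = 0 := fun ξ => by
    have h2 := hx ξ
    rw [Submodule.coe_inner, expVec_coe, inner_sub_left, inner_smul_left,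
      (Submodule.mem_orthogonal_singleton_iff_inner_right).1 x.2, sub_zero, Complex.conj_ofReal,
      mul_eq_zero] at h2
    exact h2.resolve_left (by exact_mod_cast (Real.exp_pos _).ne')
  refine Subtype.ext (total_of_denseRange Ω.denseRange_lin _ fun c => ?_)
  rw [lin, Finsupp.linearCombination_apply, Finsupp.sum, sum_inner]
  exact Finset.sum_eq_zero fun ξ _ => by rw [inner_smul_left, h1, mul_zero]

lemma koopman₀_expVec {Γ : Type*} [Group Γ] (π : Γ →* (V ≃ₗᵢ[ℝ] V)) (g : Γ) (ξ : V) :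
    Ω.koopman₀ π g (Ω.expVec ξ) = Ω.expVec (π g ξ) := by
  refine Subtype.ext ?_
  rw [koopman₀_coe, expVec_coe, map_sub, map_smul, koopman_vec, expVec_coe,
    LinearIsometryEquiv.norm_map]
  congr 1
  rw [← Ω.vec_zero, koopman_vec, map_zero]

end GaussianConstruction

/-! ### Weak containment of the Gaussian bimodule -/

section Weak

variable {A : Type*} [CommCStarAlgebra A] [PartialOrder A] [StarOrderedRing A]
  {τ : A →ₚ[ℂ] ℂ} {Γ₁ Γ₂ : Type*} [Group Γ₁] [Group Γ₂]
  {V₁ V₂ : Type*} [NormedAddCommGroup V₁] [InnerProductSpace ℝ V₁] [CompleteSpace V₁]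
  [NormedAddCommGroup V₂] [InnerProductSpace ℝ V₂] [CompleteSpace V₂]
  {Y₁ Y₂ : Type*} [MeasurableSpace Y₁] [MeasurableSpace Y₂]
  {ν₁ : Measure Y₁} [IsProbabilityMeasure ν₁] {ν₂ : Measure Y₂} [IsProbabilityMeasure ν₂]

/-- If the `π_i` are weakly contained in the regular representations, then the Gaussian bimodule
is weakly contained in any bimodule approximating `(x, y) ↦ τ(E(x) E(y))`. -/
theorem gaussianBimodule_weaklyContained (σ : TraceAction (Γ₁ × Γ₂) τ)
    (Ω₁ : GaussianConstruction V₁ ν₁) (Ω₂ : GaussianConstruction V₂ ν₂)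
    {π₁ : Γ₁ →* (V₁ ≃ₗᵢ[ℝ] V₁)} {π₂ : Γ₂ →* (V₂ ≃ₗᵢ[ℝ] V₂)}
    (hπ₁ : OrthWeaklyContained π₁ (regularRep Γ₁)) (hπ₂ : OrthWeaklyContained π₂ (regularRep Γ₂))
    {L : Type*} [NormedAddCommGroup L] [InnerProductSpace ℂ L] [CompleteSpace L]
    {C : Bimodule (crossedProduct σ) L} (hC : coefTerm σ 1 ∈ C.coefCone) :
    (gaussianBimodule σ Ω₁ π₁ Ω₂ π₂).WeaklyContained C := by
  refine repBimodule_weaklyContained σ _ (Ω₁.total_expVec.htmul Ω₂.total_expVec)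
    (φ := fun a b g => (Real.exp (2 * ⟪a.1, π₁ g.1 b.1⟫_ℝ) - 1) *
      (Real.exp (2 * ⟪a.2, π₂ g.2 b.2⟫_ℝ) - 1)) (fun a b g => ?_) (fun n f => ?_) hC
  · change ⟪_, hunitary (Ω₁.koopman₀ π₁ g.1) (Ω₂.koopman₀ π₂ g.2) _⟫_ℂ = _
    rw [hunitary_htmul, inner_htmul, GaussianConstruction.koopman₀_expVec,
      GaussianConstruction.koopman₀_expVec, GaussianConstruction.inner_expVec,
      GaussianConstruction.inner_expVec, ← Complex.ofReal_mul]
  · exact regCone_prod_mem (regCone_exp_mem (orthCoef_mem_regCone hπ₁ fun k => (f k).1))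
      (regCone_exp_mem (orthCoef_mem_regCone hπ₂ fun k => (f k).2))

end Weak

end FellAbsorption

namespace FellAbsorption

/-! ### The Fock space model of the centered exponential vectors -/

section Fock

lemma hasSum_prod_pi {X : Type*} {u : X → ℝ} {s : ℝ} (hu : HasSum u s) (k : ℕ) :
    HasSum (fun x : Fin k → X => ∏ i, u (x i)) (s ^ k) := by
  induction k with
  | zero => simp [hasSum_unique]
  | succ k ih =>
    have h1 : Summable fun x : X × (Fin k → X) => u x.1 * ∏ i, u (x.2 i) :=
      summable_mul_of_summable_norm (g := fun x : Fin k → X => ∏ i, u (x i)) hu.summable.abs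
        ih.summable.abs
    have h2 := hu.mul (g := fun x : Fin k → X => ∏ i, u (x i)) ih h1
    rw [← pow_succ'] at h2
    refine (Fin.consEquiv fun _ => X).hasSum_iff.1 (h2.congr_fun fun x => ?_)
    simp [Fin.consEquiv, Fin.prod_univ_succ]

/-- The words of positive length in `Γ` form a free `Γ`-set. -/
def wordsEquiv (Γ : Type*) [Group Γ] :
    Γ × (Σ k : ℕ, (Fin k → Γ)) ≃ Σ k : ℕ, (Fin (k + 1) → Γ) where
  toFun p := ⟨p.2.1, Fin.cons p.1 fun i => p.1 * p.2.2 i⟩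
  invFun y := (y.2 0, ⟨y.1, fun i => (y.2 0)⁻¹ * y.2 i.succ⟩)
  left_inv p := by
    obtain ⟨g, k, x⟩ := p
    simp
  right_inv y := by
    obtain ⟨k, x⟩ := y
    simp only [mul_inv_cancel_left, Sigma.mk.injEq, heq_eq_eq, true_and]
    funext i
    refine Fin.cases ?_ (fun i => ?_) i <;> simp

variable {Γ : Type*}

/-- The coordinates of the exponential vector `⊕_k √(2^k / k!) f^{⊗ k}`, for `k ≥ 1`. -/
noncomputable def fockFun (f : Γ → ℝ) (y : Σ k : ℕ, (Fin (k + 1) → Γ)) : ℝ :=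
  √(2 ^ (y.1 + 1) / (y.1 + 1).factorial) * ∏ i, f (y.2 i)

/-- Over words of length k + 1 the products sum to s^{k+1}, and the squared weights 2^{k+1}/(k+1)!
assemble these powers into exp(2s) - 1. -/
lemma hasSum_fockFun_mul {f f' : Γ → ℝ} {s : ℝ} (h : HasSum (fun g => f g * f' g) s) :
    HasSum (fun y => fockFun f y * fockFun f' y) (Real.exp (2 * s) - 1) := by
  have h0 : ∀ u : Γ → ℝ, ∀ t, HasSum u t → ∀ k : ℕ, HasSum (fun x : Fin (k + 1) → Γ =>
      (2 ^ (k + 1) / (k + 1).factorial : ℝ) * ∏ i, u (x i))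
        ((2 ^ (k + 1) / (k + 1).factorial : ℝ) * t ^ (k + 1)) :=
    fun u t hu k => (hasSum_prod_pi hu (k + 1)).mul_left _
  have h1 : ∀ y : Σ k : ℕ, (Fin (k + 1) → Γ), fockFun f y * fockFun f' y =
      (2 ^ (y.1 + 1) / (y.1 + 1).factorial : ℝ) * ∏ i, (f (y.2 i) * f' (y.2 i)) := fun y => by
    rw [fockFun, fockFun, Finset.prod_mul_distrib, mul_mul_mul_comm, Real.mul_self_sqrt
      (by positivity)]
  simp only [h1]
  refine (hasSum_exp_two_mul_sub_one s).sigma_of_hasSum (fun k => h0 _ _ h k) ?_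
  -- Summing over all words at once needs absolute convergence, obtained from the same computation
  -- with |f f'| in place of f f'.
  refine Summable.of_abs ?_
  have h2 := h0 _ _ h.summable.abs.hasSum
  have h3 : ∀ y : Σ k : ℕ, (Fin (k + 1) → Γ),
      |(2 ^ (y.1 + 1) / (y.1 + 1).factorial : ℝ) * ∏ i, (f (y.2 i) * f' (y.2 i))| =
      (2 ^ (y.1 + 1) / (y.1 + 1).factorial : ℝ) * ∏ i, |f (y.2 i) * f' (y.2 i)| := fun y => by
    rw [abs_mul, Finset.abs_prod, abs_of_nonneg (by positivity)]
  simp only [h3]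
  refine (summable_sigma_of_nonneg fun y => by positivity).2 ⟨fun k => (h2 k).summable, ?_⟩
  simp only [fun k => (h2 k).tsum_eq]
  exact (hasSum_exp_two_mul_sub_one _).summable

variable [Group Γ]

/-- Translating f translates all letters of a word simultaneously. In the coordinates (first letter,
remaining letters relative to it) only the first letter moves, so the action is a multiple of the
regular one. -/
lemma fockFun_mul (f : Γ → ℝ) (g h : Γ) (j : Σ k : ℕ, (Fin k → Γ)) :
    fockFun (fun k => f (g * k)) (wordsEquiv Γ (h, j)) = fockFun f (wordsEquiv Γ (g * h, j)) := by
  refine congrArg (_ * ·) (Finset.prod_congr rfl fun i _ => congrArg f ?_)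
  change g * Fin.cons (n := j.1) (α := fun _ => Γ) h (fun i => h * j.2 i) i =
    Fin.cons (n := j.1) (α := fun _ => Γ) (g * h) (fun i => g * h * j.2 i) i
  refine Fin.cases ?_ (fun i => ?_) i
  · rfl
  · exact (mul_assoc _ _ _).symm

lemma hasSum_mul_l2 (ξ η : L2Sum Γ ℝ) : HasSum (fun g => ξ g * η g) ⟪ξ, η⟫_ℝ := by
  simpa [mul_comm] using lp.hasSum_inner (𝕜 := ℝ) ξ η

/-- The vector `⊕_k √(2^k / k!) ξ^{⊗ k}`, for `k ≥ 1`, of the full Fock space of `ℓ²(Γ)`, in which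
words are indexed by `Γ × J`. -/
noncomputable def fockVec (ξ : L2Sum Γ ℝ) : L2Sum (Γ × (Σ k : ℕ, (Fin k → Γ))) ℂ :=
  ⟨fun p => (fockFun ξ (wordsEquiv Γ p) : ℂ), (memlp_two_iff _).2 (by
    simp only [Complex.norm_real, Real.norm_eq_abs, sq_abs]
    have h := ((wordsEquiv Γ).hasSum_iff.2 (hasSum_fockFun_mul (hasSum_mul_l2 ξ ξ))).summable
    simpa only [Function.comp_def, ← sq] using h)⟩

lemma fockVec_apply (ξ : L2Sum Γ ℝ) (p) : fockVec ξ p = (fockFun ξ (wordsEquiv Γ p) : ℂ) := rfl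

/-- The Gram matrix agrees with that of the vectors `expVec`, which is what produces an isometry
from L²₀(Y). -/
lemma inner_fockVec (ξ η : L2Sum Γ ℝ) :
    ⟪fockVec ξ, fockVec η⟫_ℂ = ((Real.exp (2 * ⟪ξ, η⟫_ℝ) - 1 : ℝ) : ℂ) := by
  refine (lp.hasSum_inner (fockVec ξ) (fockVec η)).unique ?_
  have h := Complex.hasSum_ofReal.2
    ((wordsEquiv Γ).hasSum_iff.2 (hasSum_fockFun_mul (hasSum_mul_l2 ξ η)))
  simpa [Function.comp_def, fockVec_apply, mul_comm] using h

lemma fockVec_regularRep (g : Γ) (ξ : L2Sum Γ ℝ) :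
    fockVec (regularRep Γ g ξ) = regRep Γ _ g (fockVec ξ) := by
  ext p
  rw [regRep_apply, fockVec_apply, fockVec_apply, ← fockFun_mul]
  rfl

end Fock

/-! ### Free orbits of orthonormal families -/

section Orbits

variable {G : Type*} [Group G] {P : Type*} [NormedAddCommGroup P] [InnerProductSpace ℂ P]

lemma inner_eq_zero_of_mem_span {y : ℕ → P} {S T : P →ₗ[ℂ] P}
    (h : ∀ n m, ⟪S (y n), T (y m)⟫_ℂ = 0) {u v : P} (hu : u ∈ Submodule.span ℂ (Set.range y))
    (hv : v ∈ Submodule.span ℂ (Set.range y)) : ⟪S u, T v⟫_ℂ = 0 := by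
  induction hu, hv using Submodule.span_induction₂ with
  | mem_mem x y hx hy =>
    obtain ⟨n, rfl⟩ := hx
    obtain ⟨m, rfl⟩ := hy
    exact h n m
  | zero_left => simp
  | zero_right => simp
  | add_left x y z _ _ _ h1 h2 => rw [map_add, inner_add_left, h1, h2, add_zero]
  | add_right x y z _ _ _ h1 h2 => rw [map_add, inner_add_right, h1, h2, add_zero]
  | smul_left r x y _ _ h => rw [map_smul, inner_smul_left, h, mul_zero]
  | smul_right r x y _ _ h => rw [map_smul, inner_smul_right, h, mul_zero]

/-- A linearly independent sequence whose translates are mutually orthogonal can be replaced by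
an orthonormal one. -/
lemma exists_orthonormal_orbit (κ : G →* (P ≃ₗᵢ[ℂ] P)) {y : ℕ → P} (hy : LinearIndependent ℂ y)
    (h : ∀ g k : G, g ≠ k → ∀ n m, ⟪κ g (y n), κ k (y m)⟫_ℂ = 0) :
    ∃ x : ℕ → P, Orthonormal ℂ fun i : G × ℕ => κ i.1 (x i.2) := by
  classical
  refine ⟨InnerProductSpace.gramSchmidtNormed ℂ y, ?_⟩
  have h1 := InnerProductSpace.gramSchmidtNormed_orthonormal (𝕜 := ℂ) hy
  -- Gram–Schmidt stays within the span of the sequence, so orthogonality between distinct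
  -- translates persists.
  have h2 : ∀ n, InnerProductSpace.gramSchmidtNormed ℂ y n ∈ Submodule.span ℂ (Set.range y) :=
    fun n => by
      rw [← InnerProductSpace.span_gramSchmidt ℂ y,
        ← InnerProductSpace.span_gramSchmidtNormed_range]
      exact Submodule.subset_span ⟨n, rfl⟩
  rw [orthonormal_iff_ite] at h1 ⊢
  rintro ⟨g, n⟩ ⟨k, m⟩
  by_cases hg : g = k
  · subst hg
    simpa using h1 n m
  · rw [if_neg fun h' => hg (Prod.ext_iff.1 h').1]
    exact inner_eq_zero_of_mem_span (S := (κ g).toLinearEquiv.toLinearMap)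
      (T := (κ k).toLinearEquiv.toLinearMap) (h g k hg) (h2 n) (h2 m)

/-- A unitary representation which embeds into a multiple of the regular representation, and into
which this multiple embeds, has an orthonormal basis permuted freely by the group. -/
lemma exists_free_basis [CompleteSpace P] {κ : G →* (P ≃ₗᵢ[ℂ] P)} {J : Type*}
    (V : P →ₗᵢ[ℂ] L2Sum (G × J) ℂ) (hV : ∀ g x, V (κ g x) = regRep G J g (V x)) {x : J → P}
    (hx : Orthonormal ℂ fun i : G × J => κ i.1 (x i.2)) :
    ∃ p : J → P, (Orthonormal ℂ fun i : G × J => κ i.1 (p i.2)) ∧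
      Total fun i : G × J => κ i.1 (p i.2) := by
  classical
  obtain ⟨W, hW⟩ := exists_isometry_of_inner_eq (total_single_one (G × J))
    (w := fun i => κ i.1 (x i.2)) fun i j => by
      rw [orthonormal_iff_ite.1 (orthonormal_single_one (G × J)), orthonormal_iff_ite.1 hx]
  have hWκ : ∀ g f, W (regRep G J g f) = κ g (W f) := fun g => DFunLike.congr_fun
    ((total_single_one (G × J)).ext
      (S := W.toContinuousLinearMap.comp (regRep G J g).toContinuousLinearEquiv.toContinuousLinearMap)
      (T := (κ g).toContinuousLinearEquiv.toContinuousLinearMap.comp W.toContinuousLinearMap)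
      fun i => by
        change W (regRep G J g (lp.single 2 (i.1, i.2) 1)) = κ g (W (lp.single 2 i 1))
        rw [regRep_single, hW, hW, map_mul]
        rfl)
  -- Cantor–Bernstein applied to the given embedding `V` and to `W`, which sends the basis vector at
  -- (g, j) to κ_g x_j. The free basis is then pulled back along the resulting equivalence.
  obtain ⟨U, hU⟩ := exists_unitary_intertwiner V hV W hWκ
  have h1 : ∀ i : G × J, κ i.1 (U.symm (lp.single 2 (1, i.2) 1)) =
      U.symm (lp.single 2 i 1) := fun i => by
    rw [LinearIsometryEquiv.eq_symm_apply, hU, LinearIsometryEquiv.apply_symm_apply, regRep_basis]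
  refine ⟨fun j => U.symm (lp.single 2 (1, j) 1), ?_, ?_⟩
  · simp only [h1]
    exact (orthonormal_single_one (G × J)).comp_linearIsometryEquiv U.symm
  · simp only [h1]
    exact (total_single_one (G × J)).map U.symm

/-- Reconciles the two index sets: the embedding is indexed by words, the orthonormal orbits by
integers. -/
lemma exists_free_basis_nat [CompleteSpace P] {κ : G →* (P ≃ₗᵢ[ℂ] P)} {J : Type*} (e : ℕ ≃ J)
    (V : P →ₗᵢ[ℂ] L2Sum (G × J) ℂ) (hV : ∀ g x, V (κ g x) = regRep G J g (V x)) {x : ℕ → P}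
    (hx : Orthonormal ℂ fun i : G × ℕ => κ i.1 (x i.2)) :
    ∃ p : ℕ → P, (Orthonormal ℂ fun i : G × ℕ => κ i.1 (p i.2)) ∧
      Total fun i : G × ℕ => κ i.1 (p i.2) := by
  obtain ⟨p, hp, hp'⟩ := exists_free_basis V hV (x := fun j => x (e.symm j))
    (hx.comp (fun i : G × J => (i.1, e.symm i.2))
      (Function.injective_id.prodMap e.symm.injective))
  exact ⟨fun n => p (e n), hp.comp (fun i : G × ℕ => (i.1, e i.2))
      (Function.injective_id.prodMap e.injective),
    hp'.comp_surjective (f := fun i : G × ℕ => (i.1, e i.2))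
      (Function.surjective_id.prodMap e.surjective)⟩

end Orbits

/-! ### The Gaussian bimodule of the regular representations -/

section Regular

open Polynomial in
-- Pairing a linear relation with the vectors attached to m e shows that the polynomial with terms
-- c_i (X^{i+1} - 1) vanishes at every exp(2m), hence identically. Multiples start at n + 1 because
-- the vector attached to 0 is zero.
lemma GaussianConstruction.linearIndependent_expVec {Y : Type*} [MeasurableSpace Y] {ν : Measure Y}
    [IsProbabilityMeasure ν] {V : Type*} [NormedAddCommGroup V] [InnerProductSpace ℝ V]
    (Ω : GaussianConstruction V ν) {e : V} (he : ‖e‖ = 1) :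
    LinearIndependent ℂ fun n : ℕ => Ω.expVec ((n + 1 : ℝ) • e) := by
  rw [linearIndependent_iff']
  intro s c hc n hn
  let p : ℂ[X] := ∑ i ∈ s, C (c i) * (X ^ (i + 1) - 1)
  have hp : p = 0 := by
    refine p.eq_zero_of_infinite_isRoot ?_
    refine Set.infinite_of_injective_forall_mem
      (f := fun m : ℕ => ((Real.exp (2 * m) : ℝ) : ℂ)) (fun m m' h => ?_) fun m => ?_
    · simpa using Real.exp_injective (Complex.ofReal_injective h)
    · have h := congrArg (fun v => ⟪Ω.expVec ((m : ℝ) • e), v⟫_ℂ) hc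
      simp only [inner_sum, inner_smul_right, Ω.inner_expVec, inner_zero_right,
        real_inner_smul_left, real_inner_self_eq_norm_sq, he] at h
      simp only [Set.mem_ofPred_eq, IsRoot, p, eval_finsetSum, eval_mul, eval_C, eval_sub,
        eval_pow, eval_X, eval_one]
      rw [← h]
      refine Finset.sum_congr rfl fun i _ => ?_
      have h1 : 2 * ((i + 1 : ℝ) * (m * 1 ^ 2)) = ((i + 1 : ℕ) : ℝ) * (2 * m) := by
        push_cast
        ring
      rw [h1, Complex.ofReal_sub, Complex.ofReal_one, Real.exp_nat_mul, Complex.ofReal_pow]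
  -- In degree n + 1 ≥ 1 the constants -1 do not contribute, so the coefficient is c_n.
  have h1 := congrArg (fun q : ℂ[X] => q.coeff (n + 1)) hp
  simpa [p, finsetSum_coeff, coeff_X_pow, coeff_one, hn] using h1

namespace GaussianConstruction

variable {Γ : Type*} [Group Γ] {Y : Type*} [MeasurableSpace Y] {ν : Measure Y}
  [IsProbabilityMeasure ν] {V : Type*} [NormedAddCommGroup V] [InnerProductSpace ℝ V]
  (Ω : GaussianConstruction V ν) {π : Γ →* (V ≃ₗᵢ[ℝ] V)}

/-- Matching Gram matrices give the isometry, and both sides move the exponential vector of ξ to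
that of π_g ξ. Being onto is not required. -/
lemma exists_fock_embedding (hπ : OrthEquivalent π (regularRep Γ)) :
    ∃ U : L20 ν →ₗᵢ[ℂ] L2Sum (Γ × (Σ k : ℕ, (Fin k → Γ))) ℂ,
      ∀ g x, U (Ω.koopman₀ π g x) = regRep Γ _ g (U x) := by
  obtain ⟨T, hT⟩ := hπ
  obtain ⟨U, hU⟩ := exists_isometry_of_inner_eq Ω.total_expVec (w := fun ξ => fockVec (T ξ))
    fun ξ η => by rw [Ω.inner_expVec, inner_fockVec, T.inner_map_map]
  refine ⟨U, fun g => DFunLike.congr_fun (Ω.total_expVec.ext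
    (S := U.toContinuousLinearMap.comp
      (Ω.koopman₀ π g).toContinuousLinearEquiv.toContinuousLinearMap)
    (T := (regRep Γ _ g).toContinuousLinearEquiv.toContinuousLinearMap.comp
      U.toContinuousLinearMap) fun ξ => ?_)⟩
  change U (Ω.koopman₀ π g (Ω.expVec ξ)) = regRep Γ _ g (U (Ω.expVec ξ))
  rw [Ω.koopman₀_expVec, hU, hU, hT, fockVec_regularRep]

/-- Let e correspond to δ_1. Distinct translates of e are orthogonal, so the exponential vectors of
their multiples have inner product exp(0) - 1 = 0. Together with linear independence along the ray
of e, this gives infinitely many orthogonal free orbits. -/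
lemma exists_orthonormal_orbit_koopman₀ (hπ : OrthEquivalent π (regularRep Γ)) :
    ∃ x : ℕ → L20 ν, Orthonormal ℂ fun i : Γ × ℕ => Ω.koopman₀ π i.1 (x i.2) := by
  classical
  obtain ⟨T, hT⟩ := hπ
  obtain ⟨e, he⟩ := T.surjective (lp.single 2 1 1)
  have he1 : ‖e‖ = 1 := by
    rw [← T.norm_map, he, lp.norm_single (by norm_num), norm_one]
  have h1 : ∀ a b : Γ, regularRep Γ a (lp.single 2 1 1) b = if b = a then 1 else 0 := by
    intro a b
    change (lp.single 2 1 1 : L2Sum Γ ℝ) (a⁻¹ * b) = _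
    rw [lp.coeFn_single, Pi.single_apply]
    simp only [inv_mul_eq_one, eq_comm]
  have he2 : ∀ g k : Γ, g ≠ k → ⟪π g e, π k e⟫_ℝ = 0 := fun g k hgk => by
    rw [← T.inner_map_map, hT, hT, he]
    refine (hasSum_mul_l2 _ _).unique ?_
    convert hasSum_zero with b
    rw [h1, h1]
    split_ifs with h2 h3
    · exact absurd (h2.symm.trans h3) hgk
    all_goals simp
  refine exists_orthonormal_orbit (Ω.koopman₀ π) (Ω.linearIndependent_expVec he1)
    fun g k hgk n m => ?_
  rw [Ω.koopman₀_expVec, Ω.koopman₀_expVec, Ω.inner_expVec, map_smul, map_smul,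
    real_inner_smul_left, real_inner_smul_right, he2 g k hgk]
  simp

/-- The Koopman representation on `L²₀(Y, ν)` of the Gaussian action associated with the regular
representation of `Γ` is an infinite multiple of the regular representation. -/
theorem exists_free_basis_koopman₀ [Countable Γ] (hπ : OrthEquivalent π (regularRep Γ)) :
    ∃ p : ℕ → L20 ν, (Orthonormal ℂ fun i : Γ × ℕ => Ω.koopman₀ π i.1 (p i.2)) ∧
      Total fun i : Γ × ℕ => Ω.koopman₀ π i.1 (p i.2) := by
  obtain ⟨U, hU⟩ := Ω.exists_fock_embedding hπ
  obtain ⟨x, hx⟩ := Ω.exists_orthonormal_orbit_koopman₀ hπ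
  -- The words are countable because Γ is, and infinite even for trivial Γ because lengths are
  -- unbounded; so the multiplicities of the two embeddings agree.
  have enc : ℕ ≃ (Σ k : ℕ, (Fin k → Γ)) := by
    have : Infinite (Σ k : ℕ, (Fin k → Γ)) :=
      Infinite.of_injective (fun k : ℕ => (⟨k, fun _ => 1⟩ : Σ k : ℕ, (Fin k → Γ)))
        fun k l h => (Sigma.mk.inj_iff.1 h).1
    exact Classical.choice nonempty_equiv_of_countable
  exact exists_free_basis_nat enc U hU hx

end GaussianConstruction

variable {A : Type*} [CommCStarAlgebra A] [PartialOrder A] [StarOrderedRing A]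
  {τ : A →ₚ[ℂ] ℂ} {Γ₁ Γ₂ : Type*} [Group Γ₁] [Countable Γ₁] [Group Γ₂] [Countable Γ₂]
  {V₁ V₂ : Type*} [NormedAddCommGroup V₁] [InnerProductSpace ℝ V₁]
  [NormedAddCommGroup V₂] [InnerProductSpace ℝ V₂]
  {Y₁ Y₂ : Type*} [MeasurableSpace Y₁] [MeasurableSpace Y₂]
  {ν₁ : Measure Y₁} [IsProbabilityMeasure ν₁] {ν₂ : Measure Y₂} [IsProbabilityMeasure ν₂]

/-- If the `π_i` are equivalent to the regular representations, then the Gaussian bimodule is a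
multiple of `L²⟨M, A⟩`. -/
theorem gaussianBimodule_isomorphic (σ : TraceAction (Γ₁ × Γ₂) τ)
    (Ω₁ : GaussianConstruction V₁ ν₁) (Ω₂ : GaussianConstruction V₂ ν₂)
    {π₁ : Γ₁ →* (V₁ ≃ₗᵢ[ℝ] V₁)} {π₂ : Γ₂ →* (V₂ ≃ₗᵢ[ℝ] V₂)}
    (hπ₁ : OrthEquivalent π₁ (regularRep Γ₁)) (hπ₂ : OrthEquivalent π₂ (regularRep Γ₂)) :
    (gaussianBimodule σ Ω₁ π₁ Ω₂ π₂).Isomorphic ((basicBimodule σ).multiple (ℕ × ℕ)) := by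
  classical
  obtain ⟨p, hp, hp'⟩ := Ω₁.exists_free_basis_koopman₀ hπ₁
  obtain ⟨q, hq, hq'⟩ := Ω₂.exists_free_basis_koopman₀ hπ₂
  have h : ∀ i : (Γ₁ × Γ₂) × (ℕ × ℕ), prodRep (Ω₁.koopman₀ π₁) (Ω₂.koopman₀ π₂) i.1
      (htmul (p i.2.1) (q i.2.2)) =
      htmul (Ω₁.koopman₀ π₁ i.1.1 (p i.2.1)) (Ω₂.koopman₀ π₂ i.1.2 (q i.2.2)) :=
    fun i => hunitary_htmul _ _ _ _
  -- Tensors of the two free bases form a basis on which Γ₁ × Γ₂ acts freely, with orbits indexed by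
  -- pairs of integers.
  refine repBimodule_isomorphic_multiple σ (prodRep (Ω₁.koopman₀ π₁) (Ω₂.koopman₀ π₂))
    (p := fun i : ℕ × ℕ => htmul (p i.1) (q i.2)) ?_ ?_
  · simp only [h]
    rw [orthonormal_iff_ite] at hp hq ⊢
    rintro ⟨⟨g₁, g₂⟩, n₁, n₂⟩ ⟨⟨k₁, k₂⟩, m₁, m₂⟩
    rw [inner_htmul, hp (g₁, n₁) (k₁, m₁), hq (g₂, n₂) (k₂, m₂)]
    simp only [Prod.mk.injEq]
    split_ifs <;> simp_all
  · simp only [h]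
    exact (hp'.htmul hq').comp_surjective
      (f := fun i : (Γ₁ × Γ₂) × (ℕ × ℕ) => ((i.1.1, i.2.1), (i.1.2, i.2.2)))
      fun i => ⟨((i.1.1, i.2.1), (i.1.2, i.2.2)), rfl⟩

end Regular

end FellAbsorption

theorem mainTheorem11
    {A : Type*} [CommCStarAlgebra A] [PartialOrder A] [StarOrderedRing A] [WStarAlgebra A]
    {τ : A →ₚ[ℂ] ℂ} (hτ : IsFaithfulNormalTrace τ)
    {Γ₁ Γ₂ : Type*} [Group Γ₁] [Countable Γ₁] [Group Γ₂] [Countable Γ₂]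
    (σ : TraceAction (Γ₁ × Γ₂) τ)
    {H₁ H₂ : Type*} [NormedAddCommGroup H₁] [InnerProductSpace ℝ H₁] [CompleteSpace H₁]
    [NormedAddCommGroup H₂] [InnerProductSpace ℝ H₂] [CompleteSpace H₂]
    (π₁ : Γ₁ →* (H₁ ≃ₗᵢ[ℝ] H₁)) (π₂ : Γ₂ →* (H₂ ≃ₗᵢ[ℝ] H₂))
    (hπ₁ : OrthWeaklyContained π₁ (regularRep Γ₁))
    (hπ₂ : OrthWeaklyContained π₂ (regularRep Γ₂))
    {Y₁ Y₂ : Type*} [MeasurableSpace Y₁] [MeasurableSpace Y₂]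
    {ν₁ : Measure Y₁} [IsProbabilityMeasure ν₁] {ν₂ : Measure Y₂} [IsProbabilityMeasure ν₂]
    (Ω₁ : GaussianConstruction H₁ ν₁) (Ω₂ : GaussianConstruction H₂ ν₂) :
    (gaussianBimodule σ Ω₁ π₁ Ω₂ π₂).WeaklyContained (basicBimodule σ) ∧
    (OrthEquivalent π₁ (regularRep Γ₁) → OrthEquivalent π₂ (regularRep Γ₂) →
      ∃ I : Type, (gaussianBimodule σ Ω₁ π₁ Ω₂ π₂).Isomorphic ((basicBimodule σ).multiple I)) ∧
    (gaussianBimodule σ Ω₁ π₁ Ω₂ π₂).WeaklyContained (coarseBimodule σ) := by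
  -- Both weak containments come from one criterion, applied to two bimodules whose coefficients
  -- approximate τ(E(x)E(y)).
  exact ⟨gaussianBimodule_weaklyContained σ Ω₁ Ω₂ hπ₁ hπ₂ (coefTerm_mem_basic σ),
    fun h₁ h₂ => ⟨ℕ × ℕ, gaussianBimodule_isomorphic σ Ω₁ Ω₂ h₁ h₂⟩,
    gaussianBimodule_weaklyContained σ Ω₁ Ω₂ hπ₁ hπ₂ (coefTerm_mem_coarse σ)⟩
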